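/- A lattice is a discrete subgroup $G\subset\mathbb{R}^2$ spanning $\mathbb{R}^2$. A periodic $2$-tiling $\mathbf T$ of the plane is given by a lattice $G$ and two Lebesgue measurable sets $E_1,E_2$ (the generators) such that the sets $E_k+g$ ($k\in\{1,2\}$, $g\in G$) are pairwise disjoint and cover $\mathbb{R}^2$, up to Lebesgue-negligible sets. It is non-degenerate if $|E_1|>0$ and $|E_2|>0$, and its perimeter is $\mathrm{Per}(\mathbf T)=\tfrac12\big(\mathrm{Per}(E_1)+\mathrm{Per}(E_2)\big)$, where $\mathrm{Per}(E)$ is the Caccioppoli perimeter. It is isoperimetric if $\mathrm{Per}(\mathbf T)\le\mathrm{Per}(\mathbf T')$ for every periodic $2$-tiling $\mathbf T'$ of the plane, with respect to any lattice, whose generators $E_1',E_2'$ satisfy $|E_k'|=|E_k|$ for $k=1,2$. It is a $(6;6)$ configuration if, up to negligible sets, $E_1$ and $E_2$ are both hexagons with straight edges and all interior angles equal to $120^\circ$. **Theorem.** Let $\mathbf T$ be a non-degenerate isoperimetric periodic $2$-tiling of the plane, with lattice $G$ and generators $E_1,E_2$, which is a $(6;6)$ configuration. Then: 1. $G$ admits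 a fundamental domain $D=H_1\cup H_2$, where $H_1$ and $H_2$ are two regular hexagons meeting exactly along a common edge. 2. $\displaystyle \frac16<\frac{|E_i|}{|E_1|+|E_2|}<\frac56$ for $i=1,2$. 3. $\mathrm{Per}(\mathbf T)=2\sqrt[4]{3}\,\sqrt{|E_1|+|E_2|}$. 4. Given $|E_1|$ and $|E_2|$, the configuration is unique up to isometries: if $\mathbf T'$ is another non-degenerate isoperimetric periodic $2$-tiling which is a $(6;6)$ configuration, with lattice $G'$ and generators $E_1',E_2'$ such that $|E_k'|=|E_k|$ for $k=1,2$, then there is an isometry $f$ of the plane whose linear part maps $G$ onto $G'$ and such that, for $k=1,2$, $f(E_k)=E_k'+g_k$ up to a negligible set for some $g_k\in G'$. -/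

import Mathlib

open MeasureTheory Set
open scoped ENNReal Pointwise

/-- The Euclidean plane. -/
abbrev Plane : Type := EuclideanSpace ℝ (Fin 2)

/-- The divergence `∂₁φ₁ + ∂₂φ₂` of a vector field on the plane. -/
noncomputable def divergence (φ : Plane → Plane) (x : Plane) : ℝ :=
  ∑ i : Fin 2, (fderiv ℝ φ x (EuclideanSpace.single i 1)) i

/-- The Caccioppoli (De Giorgi) perimeter of a set: the supremum of `∫_E div φ` over all
compactly supported `C¹` vector fields `φ` with `|φ| ≤ 1` everywhere. -/
noncomputable def caccioppoliPerimeter (E : Set Plane) : ℝ≥0∞ :=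
  ⨆ (φ : Plane → Plane) (_ : ContDiff ℝ 1 φ) (_ : HasCompactSupport φ) (_ : ∀ x, ‖φ x‖ ≤ 1),
    ENNReal.ofReal (∫ x in E, divergence φ x)

/-- A periodic `N`-tiling of the plane: a lattice `G` (a discrete subgroup spanning the plane) and
`N` Lebesgue measurable generators `E₁, …, E_N` such that the sets `E_k + g`, indexed by the pairs
`(k, g)`, are pairwise disjoint and cover the plane, up to Lebesgue-negligible sets. -/
structure PeriodicTiling (N : ℕ) where
  lattice : Submodule ℤ Plane
  discrete : DiscreteTopology lattice
  isZLattice : IsZLattice ℝ lattice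
  tile : Fin N → Set Plane
  nullMeasurableSet_tile : ∀ k, NullMeasurableSet (tile k) volume
  aedisjoint : Pairwise fun p q : Fin N × lattice =>
    AEDisjoint volume ((p.2 : Plane) +ᵥ tile p.1) ((q.2 : Plane) +ᵥ tile q.1)
  ae_cover : ∀ᵐ x : Plane, ∃ (k : Fin N) (g : lattice), x ∈ (g : Plane) +ᵥ tile k

namespace PeriodicTiling

variable {N : ℕ}

/-- All generators have positive area. -/
def Nondegenerate (T : PeriodicTiling N) : Prop :=
  ∀ k, 0 < volume (T.tile k)

/-- The area `|E_k|` of the `k`-th generator as a real number. (It is finite, since the translates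
of `E_k` by the lattice do not overlap.) -/
noncomputable def area (T : PeriodicTiling N) (k : Fin N) : ℝ :=
  (volume (T.tile k)).toReal

/-- `Per(T) = ½ ∑ₖ Per(E_k)`. -/
noncomputable def perimeter (T : PeriodicTiling N) : ℝ≥0∞ :=
  (1 / 2) * ∑ k, caccioppoliPerimeter (T.tile k)

/-- `T` minimizes the perimeter among all periodic `N`-tilings, with respect to any lattice, whose
generators have the same areas. -/
def Isoperimetric (T : PeriodicTiling N) : Prop :=
  ∀ T' : PeriodicTiling N, (∀ k, volume (T'.tile k) = volume (T.tile k)) →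
    T.perimeter ≤ T'.perimeter

/-- `T` and `T'` coincide up to an isometry of the plane: there is an isometry `f` whose linear part
maps the lattice of `T` onto the lattice of `T'`, and which maps each generator of `T`, up to a
negligible set, onto a translate of the corresponding generator of `T'` by the lattice of `T'`. -/
def Congruent (T T' : PeriodicTiling N) : Prop :=
  ∃ f : Plane ≃ᵃⁱ[ℝ] Plane,
    (∀ x : Plane, x ∈ T.lattice ↔ f.linearIsometryEquiv x ∈ T'.lattice) ∧
    ∀ k, ∃ g ∈ T'.lattice, f '' T.tile k =ᵐ[volume] g +ᵥ T'.tile k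

end PeriodicTiling

/-- The unit vector with polar angle `θ`. -/
noncomputable def unitVec (θ : ℝ) : Plane := !₂[Real.cos θ, Real.sin θ]

/-- `v 0, …, v 5` are, in counterclockwise order, the vertices of a hexagon with straight edges of
positive length and all interior angles equal to 120 degrees: passing from an edge to the next one,
the direction turns by 60 degrees counterclockwise. (Indices are modulo 6.) -/
def IsEquiangularHexagon (v : Fin 6 → Plane) : Prop :=
  ∃ (θ : ℝ) (l : Fin 6 → ℝ), (∀ i, 0 < l i) ∧
    ∀ i : Fin 6, v (i + 1) - v i = l i • unitVec (θ + ((i : ℕ) : ℝ) * (Real.pi / 3))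

/-- `v 0, …, v 5` are, in counterclockwise order, the vertices of a regular hexagon. -/
def IsRegularHexagon (v : Fin 6 → Plane) : Prop :=
  IsEquiangularHexagon v ∧ ∀ i j : Fin 6, dist (v i) (v (i + 1)) = dist (v j) (v (j + 1))

/-- The closed region bounded by a convex hexagon with the given vertices. -/
def hexagonRegion (v : Fin 6 → Plane) : Set Plane := convexHull ℝ (range v)

/-- The two hexagons with vertices `v` and `w` meet exactly along a common edge. -/
def ShareEdge (v w : Fin 6 → Plane) : Prop :=
  ∃ i j : Fin 6, hexagonRegion v ∩ hexagonRegion w = segment ℝ (v i) (v (i + 1)) ∧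
    segment ℝ (v i) (v (i + 1)) = segment ℝ (w j) (w (j + 1))

/-- Configuration `(6;6)`: up to negligible sets, both generators are hexagons with straight edges
and angles of 120 degrees. -/
def PeriodicTiling.IsType66 (T : PeriodicTiling 2) : Prop :=
  ∀ k, ∃ v : Fin 6 → Plane, IsEquiangularHexagon v ∧ T.tile k =ᵐ[volume] hexagonRegion v

/-! The lattice translates of the two hexagons form a locally finite tiling. Around a point `m`,
take six small generic points obtained from one another by turns of 60 degrees about `m`. A hexagon
contains all six, three consecutive ones, or two consecutive ones, according as `m` lies in its
interior, on an open edge or at a vertex. If a vertex lay inside an edge, then 6 = 3 + 2 + 1 would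
leave one point for a third hexagon, which is impossible. Hence the tiling is edge-to-edge
(`IsHexagonTiling.edge_to_edge`).

Modulo the lattice, each edge of the first hexagon is therefore glued to an opposite edge of one of
the two hexagons. Two consecutive edges cannot both be glued to the first hexagon itself, as its
translates alone would cover the plane. If no edge is, then following the vertices shows that the
two hexagons overlap after a translation. So one pair of opposite edges is self-glued and the other
edges are glued to the second hexagon. This makes both hexagons centrally symmetric, with sides `a₁,
b, c` and `a₂, b, c`, and determines the lattice, which depends on `a₁` and `a₂` only through their
sum (`PeriodicTiling.IsType66.exists_isStandard`).

The areas are `√3/2 * (aₖ(b + c) + bc)`, and the perimeter is `a₁ + a₂ + 2b + 2c` by a direct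
divergence theorem. Every positive choice of the four lengths gives a tiling, so an isoperimetric
tiling minimizes the perimeter over these parameters at fixed areas. Replacing `b, c` by more equal
values with the same sum forces `b = c`; varying the common value then forces `a₁ + a₂ = 2b`
(`eq_of_forall_perimeter_le`). With `x = b`, the lattice is that of two regular hexagons of side
`x`, the bounds on the area ratio say `0 < aₖ < 2x`, the perimeter is `6x` for total area `3√3 x²`,
and the areas determine `x, a₁, a₂`, hence the tiling up to a rigid motion. -/

/-! ### Edge directions, normals and oblique coordinates. -/

/-- The polar angle `θ + iπ/3` of the `i`-th edge of an equiangular hexagon. -/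
noncomputable def hexAngle (θ : ℝ) (i : Fin 6) : ℝ := θ + ((i : ℕ) : ℝ) * (Real.pi / 3)

/-- The inner product with the unit vector obtained by turning `unitVec φ` clockwise by a right
angle. -/
noncomputable def outerNormal (φ : ℝ) : Plane →L[ℝ] ℝ :=
  Real.sin φ • EuclideanSpace.proj (0 : Fin 2) - Real.cos φ • EuclideanSpace.proj (1 : Fin 2)

/-- `v` are the vertices of an equiangular hexagon with side lengths `l` and initial edge direction
`unitVec θ`. -/
def IsHexagonWith (θ : ℝ) (l : Fin 6 → ℝ) (v : Fin 6 → Plane) : Prop :=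
  (∀ i, 0 < l i) ∧ ∀ i : Fin 6, v (i + 1) - v i = l i • unitVec (hexAngle θ i)

theorem outerNormal_apply (φ : ℝ) (y : Plane) :
    outerNormal φ y = Real.sin φ * y 0 - Real.cos φ * y 1 := by
  simp [outerNormal]

@[simp] theorem unitVec_zero_apply (φ : ℝ) : unitVec φ 0 = Real.cos φ := by simp [unitVec]

@[simp] theorem unitVec_one_apply (φ : ℝ) : unitVec φ 1 = Real.sin φ := by simp [unitVec]

theorem plane_ext {x y : Plane} (h0 : x 0 = y 0) (h1 : x 1 = y 1) : x = y := by
  ext i; fin_cases i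
  · exact h0
  · exact h1

theorem outerNormal_unitVec (φ ψ : ℝ) : outerNormal φ (unitVec ψ) = Real.sin (φ - ψ) := by
  rw [outerNormal_apply, unitVec_zero_apply, unitVec_one_apply, Real.sin_sub]

theorem norm_unitVec (φ : ℝ) : ‖unitVec φ‖ = 1 := by
  rw [EuclideanSpace.norm_eq]; simp [Fin.sum_univ_two]

theorem abs_outerNormal_le (φ : ℝ) (y : Plane) : |outerNormal φ y| ≤ ‖y‖ := by
  rw [outerNormal_apply, EuclideanSpace.norm_eq, Fin.sum_univ_two]
  apply Real.abs_le_sqrt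
  simp only [Real.norm_eq_abs, sq_abs]
  nlinarith [sq_nonneg (Real.cos φ * y 0 + Real.sin φ * y 1), Real.sin_sq_add_cos_sq φ]

theorem unitVec_periodic : Function.Periodic unitVec (2 * Real.pi) := fun φ => by
  simp [unitVec]

theorem outerNormal_periodic : Function.Periodic outerNormal (2 * Real.pi) := fun φ => by
  simp [outerNormal]

/-- The rotation `R` by 60 degrees satisfies `R² = R - 1`. With the analogue for `outerNormal`, this
reduces all six directions and normals to the first two. -/
theorem unitVec_add_two_thirds (φ : ℝ) :
    unitVec (φ + Real.pi / 3 + Real.pi / 3) = unitVec (φ + Real.pi / 3) - unitVec φ := by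
  have h3 : Real.sqrt 3 * Real.sqrt 3 = 3 := Real.mul_self_sqrt (by norm_num)
  apply plane_ext <;>
    simp only [unitVec_zero_apply, unitVec_one_apply, PiLp.sub_apply, Real.cos_add, Real.sin_add,
      Real.cos_pi_div_three, Real.sin_pi_div_three]
  · linear_combination (-1/4 * Real.cos φ) * h3
  · linear_combination (-1/4 * Real.sin φ) * h3

theorem outerNormal_add_two_thirds (φ : ℝ) :
    outerNormal (φ + Real.pi / 3 + Real.pi / 3) =
      outerNormal (φ + Real.pi / 3) - outerNormal φ := by
  have h3 : Real.sqrt 3 * Real.sqrt 3 = 3 := Real.mul_self_sqrt (by norm_num)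
  ext y
  simp only [outerNormal_apply, sub_apply, Real.cos_add, Real.sin_add,
      Real.cos_pi_div_three, Real.sin_pi_div_three]
  linear_combination (-1/4 * Real.sin φ * y 0 + 1/4 * Real.cos φ * y 1) * h3

theorem hexAngle_zero (θ : ℝ) : hexAngle θ 0 = θ := by simp [hexAngle]

theorem hexAngle_one (θ : ℝ) : hexAngle θ 1 = θ + Real.pi / 3 := by simp [hexAngle]

/-- Addition in `Fin 6` wraps around, so the angles may differ by `2π`; only their images under a
periodic function agree. -/
theorem periodic_hexAngle_add {X : Type*} {f : ℝ → X} (hf : Function.Periodic f (2 * Real.pi))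
    (θ : ℝ) (i j : Fin 6) : f (hexAngle θ (i + j)) = f (hexAngle (hexAngle θ j) i) := by
  have h : ((i + j : Fin 6) : ℕ) = i.val + j.val ∨ ((i + j : Fin 6) : ℕ) + 6 = i.val + j.val := by
    omega
  rcases h with h | h
  · congr 1
    simp only [hexAngle, h]; push_cast; ring
  · have h' : (((i + j : Fin 6) : ℕ) : ℝ) + 6 = (i.val : ℝ) + j.val := by exact_mod_cast h
    rw [← hf]
    congr 1
    simp only [hexAngle]
    linear_combination (Real.pi / 3) * h'

theorem hexAngle_succ_cases {X : Type*} [AddCommGroup X] {f : ℝ → X}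
    (hf : ∀ φ, f (φ + Real.pi / 3 + Real.pi / 3) = f (φ + Real.pi / 3) - f φ) (θ : ℝ) :
    f (hexAngle θ 2) = f (hexAngle θ 1) - f (hexAngle θ 0) ∧
    f (hexAngle θ 3) = - f (hexAngle θ 0) ∧ f (hexAngle θ 4) = - f (hexAngle θ 1) ∧
    f (hexAngle θ 5) = f (hexAngle θ 0) - f (hexAngle θ 1) := by
  have e (i : Fin 6) (h : i.val + 1 < 6) : hexAngle θ (i + 1) = hexAngle θ i + Real.pi / 3 := by
    have : ((i + 1 : Fin 6) : ℕ) = i.val + 1 := by omega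
    simp only [hexAngle, this]; push_cast; ring
  have e1 := e 0 (by decide)
  have e2 := e 1 (by decide)
  have e3 := e 2 (by decide)
  have e4 := e 3 (by decide)
  have e5 := e 4 (by decide)
  have h2 := hf (hexAngle θ 0)
  have h3 := hf (hexAngle θ 1)
  have h4 := hf (hexAngle θ 2)
  have h5 := hf (hexAngle θ 3)
  simp only [zero_add] at e1
  have q2 : (1 + 1 : Fin 6) = 2 := rfl
  have q3 : (2 + 1 : Fin 6) = 3 := rfl
  have q4 : (3 + 1 : Fin 6) = 4 := rfl
  have q5 : (4 + 1 : Fin 6) = 5 := rfl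
  rw [q2] at e2; rw [q3] at e3; rw [q4] at e4; rw [q5] at e5
  rw [← e1, ← e2] at h2
  rw [← e2, ← e3] at h3
  rw [← e3, ← e4] at h4
  rw [← e4, ← e5] at h5
  rw [h5, h4, h3, h2]
  refine ⟨rfl, ?_, ?_, ?_⟩ <;> abel

/-- Cyclic relabelling: facts about edge `0` transfer to every edge. -/
theorem IsHexagonWith.shift {θ : ℝ} {l : Fin 6 → ℝ} {v : Fin 6 → Plane}
    (h : IsHexagonWith θ l v) (j : Fin 6) :
    IsHexagonWith (hexAngle θ j) (fun i => l (i + j)) (fun i => v (i + j)) := by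
  refine ⟨fun i => h.1 _, fun i => ?_⟩
  rw [← periodic_hexAngle_add unitVec_periodic, ← h.2 (i + j), add_right_comm]

theorem IsHexagonWith.vadd {θ : ℝ} {l : Fin 6 → ℝ} {v : Fin 6 → Plane}
    (h : IsHexagonWith θ l v) (g : Plane) : IsHexagonWith θ l (fun i => g + v i) := by
  refine ⟨h.1, fun i => ?_⟩
  simp only [add_sub_add_left_eq_sub]
  exact h.2 i

theorem hexagonRegion_shift (v : Fin 6 → Plane) (j : Fin 6) :
    hexagonRegion (fun i => v (i + j)) = hexagonRegion v := by
  have : (fun i => v (i + j)) = v ∘ (Equiv.addRight j) := rfl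
  rw [hexagonRegion, this, (Equiv.addRight j).surjective.range_comp, hexagonRegion]

theorem hexagonRegion_vadd (v : Fin 6 → Plane) (g : Plane) :
    hexagonRegion (fun i => g + v i) = g +ᵥ hexagonRegion v := by
  rw [hexagonRegion, hexagonRegion, ← convexHull_vadd]
  congr 1
  ext x; simp [mem_vadd_set]

/-- The point with oblique coordinates `(α, β)` with respect to the origin `p` and the directions
`θ` and `θ + π/3`. -/
noncomputable def oblique (θ : ℝ) (p : Plane) (α β : ℝ) : Plane :=
  p + α • unitVec (hexAngle θ 0) + β • unitVec (hexAngle θ 1)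

theorem outerNormal_zero_zero (θ : ℝ) :
    outerNormal (hexAngle θ 0) (unitVec (hexAngle θ 0)) = 0 := by
  simp [outerNormal_unitVec]

theorem outerNormal_zero_one (θ : ℝ) :
    outerNormal (hexAngle θ 0) (unitVec (hexAngle θ 1)) = - (√3 / 2) := by
  rw [outerNormal_unitVec, hexAngle_one, hexAngle_zero, ← Real.sin_pi_div_three, ← Real.sin_neg]
  ring_nf

theorem outerNormal_one_zero (θ : ℝ) :
    outerNormal (hexAngle θ 1) (unitVec (hexAngle θ 0)) = √3 / 2 := by
  rw [outerNormal_unitVec, hexAngle_one, hexAngle_zero, ← Real.sin_pi_div_three]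
  ring_nf

theorem outerNormal_one_one (θ : ℝ) :
    outerNormal (hexAngle θ 1) (unitVec (hexAngle θ 1)) = 0 := by
  simp [outerNormal_unitVec]

theorem exists_eq_oblique (θ : ℝ) (p x : Plane) : ∃ α β, x = oblique θ p α β := by
  have h3 : Real.sqrt 3 * Real.sqrt 3 = 3 := Real.mul_self_sqrt (by norm_num)
  have hs := Real.sin_sq_add_cos_sq θ
  have h0 : Real.sqrt 3 ≠ 0 := by positivity
  -- Each of the two normals kills one basis vector and takes the value `±√3/2` on the other, so it
  -- reads off one coordinate.
  refine ⟨2 / √3 * outerNormal (hexAngle θ 1) (x - p),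
    - (2 / √3 * outerNormal (hexAngle θ 0) (x - p)), ?_⟩
  apply plane_ext <;>
    simp only [oblique, hexAngle_zero, hexAngle_one, unitVec_zero_apply, unitVec_one_apply,
      PiLp.sub_apply, PiLp.add_apply, PiLp.smul_apply, smul_eq_mul, outerNormal_apply,
      Real.cos_add, Real.sin_add, Real.cos_pi_div_three, Real.sin_pi_div_three] <;>
    field_simp
  · linear_combination (-√3 * (x 0 - p 0)) * hs
  · linear_combination (-√3 * (x 1 - p 1)) * hs

theorem oblique_inj {θ : ℝ} {p : Plane} {α β α' β' : ℝ}
    (h : oblique θ p α β = oblique θ p α' β') : α = α' ∧ β = β' := by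
  have h0 := congrArg (fun x => outerNormal (hexAngle θ 0) (x - p)) h
  have h1 := congrArg (fun x => outerNormal (hexAngle θ 1) (x - p)) h
  simp only [oblique, add_assoc, add_sub_cancel_left, map_add, map_smul, outerNormal_zero_zero,
    outerNormal_zero_one, outerNormal_one_zero, outerNormal_one_one, smul_eq_mul, mul_zero,
    add_zero, zero_add] at h0 h1
  have : √3 / 2 ≠ 0 := by positivity
  constructor
  · exact mul_right_cancel₀ this h1
  · exact mul_right_cancel₀ (neg_ne_zero.mpr this) h0

/-! ### An equiangular hexagon as an intersection of six half-planes. -/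

section coordinates

variable {θ : ℝ} {l : Fin 6 → ℝ} {v : Fin 6 → Plane}

/-- Edges `0, 1, 2` run forwards and edges `5, 4` run backwards from `v 0` reach all vertices. Edge
`3` joins the two paths; comparing coordinates there gives the two closing relations among the side
lengths. -/
theorem IsHexagonWith.vertex_eq (h : IsHexagonWith θ l v) :
    v 0 = oblique θ (v 0) 0 0 ∧ v 1 = oblique θ (v 0) (l 0) 0 ∧
    v 2 = oblique θ (v 0) (l 0) (l 1) ∧
    v 3 = oblique θ (v 0) (l 0 - l 2) (l 1 + l 2) ∧
    v 4 = oblique θ (v 0) (- l 5) (l 4 + l 5) ∧ v 5 = oblique θ (v 0) (- l 5) (l 5) ∧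
    l 3 = l 0 - l 2 + l 5 ∧ l 1 + l 2 = l 4 + l 5 := by
  obtain ⟨u2, u3, u4, u5⟩ := hexAngle_succ_cases unitVec_add_two_thirds θ
  have h0 := h.2 0
  have h1 := h.2 1
  have h2 := h.2 2
  have h3 := h.2 3
  have h4 := h.2 4
  have h5 := h.2 5
  have q2 : (1 + 1 : Fin 6) = 2 := rfl
  have q3 : (2 + 1 : Fin 6) = 3 := rfl
  have q4 : (3 + 1 : Fin 6) = 4 := rfl
  have q5 : (4 + 1 : Fin 6) = 5 := rfl
  have q6 : (5 + 1 : Fin 6) = 0 := rfl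
  rw [zero_add] at h0
  rw [q2] at h1
  rw [q3, u2] at h2
  rw [q4, u3] at h3
  rw [q5, u4] at h4
  rw [q6, u5] at h5
  set a := unitVec (hexAngle θ 0) with ha
  set b := unitVec (hexAngle θ 1) with hb
  have w1 : v 1 = v 0 + l 0 • a := by rw [← h0]; abel
  have w2 : v 2 = v 0 + l 0 • a + l 1 • b := by rw [← w1, ← h1]; abel
  have w3 : v 3 = v 0 + (l 0 - l 2) • a + (l 1 + l 2) • b := by
    have : v 3 = v 2 + l 2 • (b - a) := by rw [← h2]; abel
    rw [this, w2]; module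
  have w5 : v 5 = v 0 + (-l 5) • a + l 5 • b := by
    have : v 5 = v 0 - l 5 • (a - b) := by rw [← h5]; abel
    rw [this]; module
  have w4 : v 4 = v 0 + (-l 5) • a + (l 4 + l 5) • b := by
    have : v 4 = v 5 - l 4 • (-b) := by rw [← h4]; abel
    rw [this, w5]; module
  have w34 : oblique θ (v 0) (-l 5) (l 4 + l 5) =
      oblique θ (v 0) (l 0 - l 2 - l 3) (l 1 + l 2) := by
    have : v 4 = v 3 + l 3 • (-a) := by rw [← h3]; abel
    rw [w3, w4] at this
    simp only [oblique, ← ha, ← hb, this]; module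
  have := oblique_inj w34
  refine ⟨by simp [oblique], by simp [oblique, ← ha, w1], w2, w3, w4, w5, ?_, ?_⟩
  · linarith [this.1]
  · linarith [this.2]

/-- The values at the point with oblique coordinates `(α, β)` of the six linear inequalities that
define an equiangular hexagon. -/
theorem IsHexagonWith.outerNormal_oblique (h : IsHexagonWith θ l v) (α β : ℝ) (i : Fin 6) :
    outerNormal (hexAngle θ i) (oblique θ (v 0) α β - v i) =
      √3 / 2 * (![-β, α - l 0, α + β - l 0 - l 1, β - l 1 - l 2, -l 5 - α, -(α + β)] i) := by
  obtain ⟨w0, w1, w2, w3, w4, w5, e1, e2⟩ := h.vertex_eq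
  obtain ⟨n2, n3, n4, n5⟩ := hexAngle_succ_cases outerNormal_add_two_thirds θ
  have key (α β α' β' : ℝ) :
      (outerNormal (hexAngle θ 0)) (oblique θ (v 0) α β - oblique θ (v 0) α' β') =
        √3 / 2 * (β' - β) ∧
      (outerNormal (hexAngle θ 1)) (oblique θ (v 0) α β - oblique θ (v 0) α' β') =
        √3 / 2 * (α - α') := by
    have : oblique θ (v 0) α β - oblique θ (v 0) α' β' =
        (α - α') • unitVec (hexAngle θ 0) + (β - β') • unitVec (hexAngle θ 1) := by
      simp only [oblique]; module
    rw [this]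
    simp only [map_add, map_smul, outerNormal_zero_zero,
      outerNormal_zero_one, outerNormal_one_zero, outerNormal_one_one, smul_eq_mul]
    constructor <;> ring
  fin_cases i <;> simp only [Fin.zero_eta, Fin.mk_one, Fin.reduceFinMk]
  · have := (key α β 0 0).1
    rw [← w0] at this
    rw [this]; simp
  · rw [w1, (key _ _ _ _).2]; simp
  · rw [w2, n2, sub_apply, (key _ _ _ _).1, (key _ _ _ _).2]; simp; ring
  · rw [w3, n3, neg_apply, (key _ _ _ _).1]; simp; ring
  · rw [w4, n4, neg_apply, (key _ _ _ _).2]; simp; ring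
  · rw [w5, n5, sub_apply, (key _ _ _ _).1, (key _ _ _ _).2]; simp; ring

end coordinates

theorem oblique_convex_comb {S : Set Plane} (hS : Convex ℝ S) {θ : ℝ} {p : Plane}
    {α₁ β₁ α₂ β₂ t : ℝ} (h₁ : oblique θ p α₁ β₁ ∈ S) (h₂ : oblique θ p α₂ β₂ ∈ S)
    (h0 : 0 ≤ t) (h1 : t ≤ 1) :
    oblique θ p (α₁ + t * (α₂ - α₁)) (β₁ + t * (β₂ - β₁)) ∈ S := by
  have : oblique θ p (α₁ + t * (α₂ - α₁)) (β₁ + t * (β₂ - β₁)) =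
      (1 - t) • oblique θ p α₁ β₁ + t • oblique θ p α₂ β₂ := by
    simp only [oblique]; module
  rw [this]
  exact hS h₁ h₂ (by linarith) h0 (by ring)

section region

variable {θ : ℝ} {l : Fin 6 → ℝ} {v : Fin 6 → Plane}

theorem outerNormal_le_iff (h : IsHexagonWith θ l v) (α β : ℝ) :
    (∀ i, outerNormal (hexAngle θ i) (oblique θ (v 0) α β - v i) ≤ 0) ↔
      0 ≤ β ∧ α ≤ l 0 ∧ α + β ≤ l 0 + l 1 ∧ β ≤ l 1 + l 2 ∧ -l 5 ≤ α ∧ 0 ≤ α + β := by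
  have hk : (0 : ℝ) < √3 / 2 := by positivity
  have hm : ∀ y : ℝ, √3 / 2 * y ≤ 0 ↔ y ≤ 0 := fun y => by
    rw [← mul_zero (√3 / 2), mul_le_mul_iff_right₀ hk, mul_zero]
  simp only [h.outerNormal_oblique, hm]
  constructor
  · intro H
    have a1 := H 0
    have a2 := H 1
    have a3 := H 2
    have a4 := H 3
    have a5 := H 4
    have a6 := H 5
    simp at a1 a2 a3 a4 a5 a6
    refine ⟨?_, ?_, ?_, ?_, ?_, ?_⟩ <;> linarith
  · rintro ⟨a1, a2, a3, a4, a5, a6⟩ i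
    fin_cases i <;> simp <;> linarith

theorem convex_setOf_outerNormal_le (θ : ℝ) (v : Fin 6 → Plane) :
    Convex ℝ {x | ∀ i, outerNormal (hexAngle θ i) (x - v i) ≤ 0} := by
  rw [ofPred_forall]
  refine convex_iInter fun i => ?_
  have := convex_halfSpace_le (𝕜 := ℝ) (f := outerNormal (hexAngle θ i))
    (outerNormal (hexAngle θ i)).toLinearMap.isLinear (outerNormal (hexAngle θ i) (v i))
  simpa only [map_sub, sub_nonpos] using this

/-- The vertices satisfy the six inequalities. Conversely, the line through a solution parallel to
edge `0` meets the chain `v 0, v 5, v 4` on one side and `v 1, v 2, v 3` on the other, and the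
solution lies between these two points of the hull. -/
theorem IsHexagonWith.hexagonRegion_eq (h : IsHexagonWith θ l v) :
    hexagonRegion v = {x | ∀ i, outerNormal (hexAngle θ i) (x - v i) ≤ 0} := by
  obtain ⟨w0, w1, w2, w3, w4, w5, e1, e2⟩ := h.vertex_eq
  have p0 := h.1 0
  have p1 := h.1 1
  have p2 := h.1 2
  have p3 := h.1 3
  have p4 := h.1 4
  have p5 := h.1 5
  apply Subset.antisymm
  · refine convexHull_min ?_ (convex_setOf_outerNormal_le θ v)
    rintro _ ⟨j, rfl⟩
    have key : ∃ α β, v j = oblique θ (v 0) α β ∧ (0 ≤ β ∧ α ≤ l 0 ∧ α + β ≤ l 0 + l 1 ∧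
        β ≤ l 1 + l 2 ∧ -l 5 ≤ α ∧ 0 ≤ α + β) := by
      fin_cases j
      · exact ⟨_, _, w0, by refine ⟨?_, ?_, ?_, ?_, ?_, ?_⟩ <;> linarith⟩
      · exact ⟨_, _, w1, by refine ⟨?_, ?_, ?_, ?_, ?_, ?_⟩ <;> linarith⟩
      · exact ⟨_, _, w2, by refine ⟨?_, ?_, ?_, ?_, ?_, ?_⟩ <;> linarith⟩
      · exact ⟨_, _, w3, by refine ⟨?_, ?_, ?_, ?_, ?_, ?_⟩ <;> linarith⟩
      · exact ⟨_, _, w4, by refine ⟨?_, ?_, ?_, ?_, ?_, ?_⟩ <;> linarith⟩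
      · exact ⟨_, _, w5, by refine ⟨?_, ?_, ?_, ?_, ?_, ?_⟩ <;> linarith⟩
    obtain ⟨α, β, e, H⟩ := key
    rw [e]
    exact (outerNormal_le_iff h α β).2 H
  · intro x hx
    obtain ⟨α, β, rfl⟩ := exists_eq_oblique θ (v 0) x
    obtain ⟨a1, a2, a3, a4, a5, a6⟩ := (outerNormal_le_iff h α β).1 hx
    have hc : Convex ℝ (hexagonRegion v) := convex_convexHull ℝ _
    have hv : ∀ j, v j ∈ hexagonRegion v := fun j => subset_convexHull ℝ _ (mem_range_self j)
    have v0 := hv 0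
    have v1 := hv 1
    have v2 := hv 2
    have v3 := hv 3
    have v4 := hv 4
    have v5 := hv 5
    rw [w0] at v0; rw [w1] at v1; rw [w2] at v2; rw [w3] at v3; rw [w4] at v4; rw [w5] at v5
    have left : ∃ α₁ ≤ α, oblique θ (v 0) α₁ β ∈ hexagonRegion v := by
      rcases le_total β (l 5) with hb | hb
      · refine ⟨-β, by linarith, ?_⟩
        have := oblique_convex_comb hc v0 v5 (t := β / l 5) (by positivity)
          (by rw [div_le_one p5]; exact hb)
        convert this using 2 <;> field_simp <;> ring
      · refine ⟨-l 5, by linarith, ?_⟩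
        have := oblique_convex_comb hc v5 v4 (t := (β - l 5) / l 4)
          (div_nonneg (by linarith) p4.le) (by rw [div_le_one p4]; linarith)
        convert this using 2 <;> field_simp <;> ring
    have right : ∃ α₂ ≥ α, oblique θ (v 0) α₂ β ∈ hexagonRegion v := by
      rcases le_total β (l 1) with hb | hb
      · refine ⟨l 0, by linarith, ?_⟩
        have := oblique_convex_comb hc v1 v2 (t := β / l 1) (by positivity)
          (by rw [div_le_one p1]; exact hb)
        convert this using 2 <;> field_simp <;> ring
      · refine ⟨l 0 + l 1 - β, by linarith, ?_⟩
        have := oblique_convex_comb hc v2 v3 (t := (β - l 1) / l 2)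
          (div_nonneg (by linarith) p2.le) (by rw [div_le_one p2]; linarith)
        convert this using 2 <;> field_simp <;> ring
    obtain ⟨α₁, hl, m1⟩ := left
    obtain ⟨α₂, hr, m2⟩ := right
    rcases eq_or_lt_of_le (hl.trans hr) with he | hlt
    · have : α = α₁ := le_antisymm (by rw [he]; exact hr) hl
      rw [this]; exact m1
    · have hd : 0 < α₂ - α₁ := sub_pos.2 hlt
      have := oblique_convex_comb hc m1 m2 (t := (α - α₁) / (α₂ - α₁))
          (div_nonneg (by linarith) hd.le) (by rw [div_le_one hd]; linarith)
      convert this using 2 <;> field_simp <;> ring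

theorem IsHexagonWith.mem_hexagonRegion_iff (h : IsHexagonWith θ l v) (x : Plane) :
    x ∈ hexagonRegion v ↔ ∀ i, outerNormal (hexAngle θ i) (x - v i) ≤ 0 := by
  rw [h.hexagonRegion_eq]; rfl

theorem IsHexagonWith.oblique_mem_iff (h : IsHexagonWith θ l v) (α β : ℝ) :
    oblique θ (v 0) α β ∈ hexagonRegion v ↔
      0 ≤ β ∧ α ≤ l 0 ∧ α + β ≤ l 0 + l 1 ∧ β ≤ l 1 + l 2 ∧ -l 5 ≤ α ∧ 0 ≤ α + β := by
  rw [h.mem_hexagonRegion_iff, outerNormal_le_iff h]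

theorem outerNormal_hexAngle_add (θ : ℝ) (i j : Fin 6) :
    outerNormal (hexAngle θ (i + j)) = outerNormal (hexAngle (hexAngle θ j) i) :=
  periodic_hexAngle_add outerNormal_periodic θ i j

theorem unitVec_hexAngle_add (θ : ℝ) (i j : Fin 6) :
    unitVec (hexAngle θ (i + j)) = unitVec (hexAngle (hexAngle θ j) i) :=
  periodic_hexAngle_add unitVec_periodic θ i j

theorem IsHexagonWith.exists_of_outerNormal_eq_zero (h : IsHexagonWith θ l v) {x : Plane}
    (hx : x ∈ hexagonRegion v) {i : Fin 6} (hi : outerNormal (hexAngle θ i) (x - v i) = 0) :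
    ∃ t, 0 ≤ t ∧ t ≤ l i ∧ x = v i + t • unitVec (hexAngle θ i) := by
  have h' := h.shift i
  rw [← hexagonRegion_shift v i] at hx
  obtain ⟨α, β, rfl⟩ := exists_eq_oblique (hexAngle θ i) (v (0 + i)) x
  have e := h'.outerNormal_oblique α β 0
  rw [← outerNormal_hexAngle_add] at e
  simp only [zero_add] at e hx hi
  rw [hi] at e
  have hb : β = 0 := by simpa using e
  have := (h'.oblique_mem_iff α β).1 (by simpa using hx)
  simp only [zero_add, hb] at this
  obtain ⟨a1, a2, a3, a4, a5, a6⟩ := this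
  refine ⟨α, by linarith, by linarith, ?_⟩
  simp [oblique, hb, hexAngle_zero]

/-- Entries are counted from edge `i`. For `0 < t < l i` only entry `0` vanishes; at the vertex `t =
0` entries `0` and `5` vanish, where `i + 5` is the preceding edge modulo 6. -/
theorem IsHexagonWith.outerNormal_edge (h : IsHexagonWith θ l v) (i : Fin 6) (t : ℝ)
    (j : Fin 6) : outerNormal (hexAngle θ (j + i))
        (v i + t • unitVec (hexAngle θ i) - v (j + i)) =
      √3 / 2 * (![0, t - l i, t - l i - l (1 + i), - l (1 + i) - l (2 + i), -l (5 + i) - t, -t]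
        j) := by
  have e := (h.shift i).outerNormal_oblique t 0 j
  rw [← outerNormal_hexAngle_add] at e
  have hx : oblique (hexAngle θ i) (v (0 + i)) t 0 = v i + t • unitVec (hexAngle θ i) := by
    simp [oblique, hexAngle_zero]
  rw [hx] at e
  rw [e]
  simp

theorem IsHexagonWith.outerNormal_edge_lt (h : IsHexagonWith θ l v) {i j : Fin 6} {t : ℝ}
    (h0 : 0 < t) (h1 : t < l i) (hj : j ≠ i) :
    outerNormal (hexAngle θ j) (v i + t • unitVec (hexAngle θ i) - v j) < 0 := by
  obtain ⟨k, rfl⟩ : ∃ k, j = k + i := ⟨j - i, by simp⟩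
  rw [h.outerNormal_edge i t k]
  have p := h.1
  refine mul_neg_of_pos_of_neg (by positivity) ?_
  have hk : k ≠ 0 := by rintro rfl; simp at hj
  have p1 := p (1 + i)
  have p2 := p (2 + i)
  have p5 := p (5 + i)
  fin_cases k
  · exact absurd rfl hk
  all_goals simp
  all_goals linarith

theorem outerNormal_edge_self (θ : ℝ) (v : Fin 6 → Plane) (i : Fin 6) (t : ℝ) :
    outerNormal (hexAngle θ i) (v i + t • unitVec (hexAngle θ i) - v i) = 0 := by
  simp [outerNormal_unitVec]

theorem IsHexagonWith.outerNormal_vertex_lt (h : IsHexagonWith θ l v) {i j : Fin 6}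
    (hj : j ≠ i) (hj' : j ≠ i + 5) : outerNormal (hexAngle θ j) (v i - v j) < 0 := by
  obtain ⟨k, rfl⟩ : ∃ k, j = k + i := ⟨j - i, by simp⟩
  have := h.outerNormal_edge i 0 k
  rw [zero_smul, add_zero] at this
  rw [this]
  have p := h.1
  refine mul_neg_of_pos_of_neg (by positivity) ?_
  have hk : k ≠ 0 := by rintro rfl; simp at hj
  have hk5 : k ≠ 5 := by rintro rfl; exact hj' (add_comm _ _)
  have p0 := p i
  have p1 := p (1 + i)
  have p2 := p (2 + i)
  have p5 := p (5 + i)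
  fin_cases k
  · exact absurd rfl hk
  · simp; linarith
  · simp; linarith
  · simp; linarith
  · simp; linarith
  · exact absurd rfl hk5

theorem IsHexagonWith.outerNormal_vertex_pred (h : IsHexagonWith θ l v) (i : Fin 6) :
    outerNormal (hexAngle θ (i + 5)) (v i - v (i + 5)) = 0 := by
  have := h.outerNormal_edge i 0 5
  rw [zero_smul, add_zero, add_comm 5 i] at this
  rw [this]; simp

theorem IsHexagonWith.edge_mem (h : IsHexagonWith θ l v) {i : Fin 6} {t : ℝ}
    (h0 : 0 < t) (h1 : t < l i) : v i + t • unitVec (hexAngle θ i) ∈ hexagonRegion v := by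
  rw [h.mem_hexagonRegion_iff]
  intro j
  by_cases hj : j = i
  · rw [hj, outerNormal_edge_self]
  · exact (h.outerNormal_edge_lt h0 h1 hj).le

theorem vertex_mem_hexagonRegion (v : Fin 6 → Plane) (i : Fin 6) : v i ∈ hexagonRegion v :=
  subset_convexHull ℝ _ (mem_range_self i)

/-- A point of a hexagon is interior, or lies on an open edge, or is a vertex. -/
theorem IsHexagonWith.trichotomy (h : IsHexagonWith θ l v) {x : Plane}
    (hx : x ∈ hexagonRegion v) : (∀ j, outerNormal (hexAngle θ j) (x - v j) < 0) ∨
      (∃ i t, 0 < t ∧ t < l i ∧ x = v i + t • unitVec (hexAngle θ i)) ∨ ∃ i, x = v i := by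
  by_cases hs : ∀ j, outerNormal (hexAngle θ j) (x - v j) < 0
  · exact Or.inl hs
  right
  push Not at hs
  obtain ⟨i, hi⟩ := hs
  have hi0 := le_antisymm ((h.mem_hexagonRegion_iff x).1 hx i) hi
  obtain ⟨t, t0, t1, e⟩ := h.exists_of_outerNormal_eq_zero hx hi0
  rcases t0.eq_or_lt with rfl | t0
  · exact Or.inr ⟨i, by simpa using e⟩
  rcases t1.eq_or_lt with rfl | t1
  · refine Or.inr ⟨i + 1, ?_⟩
    rw [e, ← h.2 i]; abel
  · exact Or.inl ⟨i, t, t0, t1, e⟩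

theorem isCompact_hexagonRegion (v : Fin 6 → Plane) : IsCompact (hexagonRegion v) :=
  (finite_range v).isCompact_convexHull ℝ

end region

/-! ### Local structure of a hexagon tiling: six samples around a point. -/

/-- The rotation of the plane by the angle `ψ`. -/
noncomputable def planeRotation (ψ : ℝ) : Plane ≃ₗᵢ[ℝ] Plane where
  toFun x := !₂[Real.cos ψ * x 0 - Real.sin ψ * x 1, Real.sin ψ * x 0 + Real.cos ψ * x 1]
  invFun x := !₂[Real.cos ψ * x 0 + Real.sin ψ * x 1, -Real.sin ψ * x 0 + Real.cos ψ * x 1]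
  map_add' x y := by apply plane_ext <;> simp <;> ring
  map_smul' c x := by apply plane_ext <;> simp <;> ring
  left_inv x := by
    apply plane_ext <;> simp
    · linear_combination (x 0) * Real.sin_sq_add_cos_sq ψ
    · linear_combination (x 1) * Real.sin_sq_add_cos_sq ψ
  right_inv x := by
    apply plane_ext <;> simp
    · linear_combination (x 0) * Real.sin_sq_add_cos_sq ψ
    · linear_combination (x 1) * Real.sin_sq_add_cos_sq ψ
  norm_map' x := by
    simp only [EuclideanSpace.norm_eq, Fin.sum_univ_two]
    congr 1
    simp
    linear_combination (x 0 ^ 2 + x 1 ^ 2) * Real.sin_sq_add_cos_sq ψ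

theorem planeRotation_zero_apply (ψ : ℝ) (x : Plane) :
    planeRotation ψ x 0 = Real.cos ψ * x 0 - Real.sin ψ * x 1 := rfl

theorem planeRotation_one_apply (ψ : ℝ) (x : Plane) :
    planeRotation ψ x 1 = Real.sin ψ * x 0 + Real.cos ψ * x 1 := rfl

theorem outerNormal_planeRotation (φ ψ : ℝ) (x : Plane) :
    outerNormal φ (planeRotation ψ x) = outerNormal (φ - ψ) x := by
  simp only [outerNormal_apply, planeRotation_zero_apply, planeRotation_one_apply, Real.sin_sub,
    Real.cos_sub]
  ring

theorem planeRotation_unitVec (ψ φ : ℝ) : planeRotation ψ (unitVec φ) = unitVec (φ + ψ) := by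
  apply plane_ext <;>
    simp only [planeRotation_zero_apply, planeRotation_one_apply, unitVec_zero_apply,
      unitVec_one_apply, Real.cos_add, Real.sin_add] <;> ring

/-- A locally finite tiling of the plane, up to negligible sets, by equiangular hexagons. -/
structure IsHexagonTiling {ι : Type*} (θ : ι → ℝ) (l : ι → Fin 6 → ℝ) (v : ι → Fin 6 → Plane) :
    Prop where
  countable : Countable ι
  hexagon : ∀ q, IsHexagonWith (θ q) (l q) (v q)
  aedisjoint : Pairwise fun q q' => AEDisjoint volume (hexagonRegion (v q)) (hexagonRegion (v q'))
  ae_cover : ∀ᵐ x : Plane, ∃ q, x ∈ hexagonRegion (v q)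
  locallyFinite : LocallyFinite fun q => hexagonRegion (v q)

theorem ae_outerNormal_ne_zero (φ : ℝ) : ∀ᵐ x : Plane, outerNormal φ x ≠ 0 := by
  have h : LinearMap.ker (outerNormal φ).toLinearMap ≠ ⊤ := by
    intro h
    have : unitVec (φ - Real.pi / 2) ∈ LinearMap.ker (outerNormal φ).toLinearMap := by
      rw [h]; trivial
    have : outerNormal φ (unitVec (φ - Real.pi / 2)) = 0 := this
    simp [outerNormal_unitVec] at this
  have := Measure.addHaar_submodule (volume : Measure Plane) _ h
  rw [ae_iff]
  simp only [not_not]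
  exact this

/-- The samples `d` turned by the multiples of 60 degrees. -/
noncomputable def sample (d : Plane) (j : Fin 6) : Plane := planeRotation (hexAngle 0 j) d

/-- The relation `R² = R - 1` makes the six values a cyclic sequence determined by two of them, with
opposite samples having opposite values. -/
theorem outerNormal_sample (φ : ℝ) (d : Plane) :
    let a := outerNormal φ d
    let b := outerNormal (φ - Real.pi / 3) d
    ∀ j, outerNormal φ (sample d j) = ![a, b, b - a, -a, -b, a - b] j := by
  intro a b
  have e (φ : ℝ) : outerNormal φ d + outerNormal (φ - Real.pi / 3 - Real.pi / 3) d
      = outerNormal (φ - Real.pi / 3) d := by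
    have := outerNormal_add_two_thirds (φ - Real.pi / 3 - Real.pi / 3)
    simp only [sub_add_cancel] at this
    rw [this, sub_apply]; ring
  have f (j : Fin 6) : outerNormal φ (sample d j) = outerNormal (φ - j.val * (Real.pi / 3)) d := by
    rw [sample, outerNormal_planeRotation, hexAngle, zero_add]
  have e0 := e φ
  have e1 := e (φ - Real.pi / 3)
  have e2 := e (φ - Real.pi / 3 - Real.pi / 3)
  have e3 := e (φ - Real.pi / 3 - Real.pi / 3 - Real.pi / 3)
  have g2 : φ - Real.pi / 3 - Real.pi / 3 = φ - 2 * (Real.pi / 3) := by ring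
  have g3 : φ - 2 * (Real.pi / 3) - Real.pi / 3 = φ - 3 * (Real.pi / 3) := by ring
  have g4 : φ - 3 * (Real.pi / 3) - Real.pi / 3 = φ - 4 * (Real.pi / 3) := by ring
  have g5 : φ - 4 * (Real.pi / 3) - Real.pi / 3 = φ - 5 * (Real.pi / 3) := by ring
  simp only [g2, g3, g4, g5] at e0 e1 e2 e3
  intro j
  rw [f j]
  fin_cases j <;> simp
  · rfl
  · rfl
  · linarith
  · linarith
  · linarith
  · linarith

/-- Of six generic samples, three consecutive ones lie in a given half-plane. -/
theorem exists_three_samples {φ : ℝ} {d : Plane} (hd : ∀ j, outerNormal φ (sample d j) ≠ 0) :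
    ∃ j₀ : Fin 6, ∀ j, outerNormal φ (sample d j) < 0 ↔ j = j₀ ∨ j = j₀ + 1 ∨ j = j₀ + 2 := by
  have h := outerNormal_sample φ d
  simp only [h] at hd ⊢
  generalize outerNormal φ d = a at *
  generalize outerNormal (φ - Real.pi / 3) d = b at *
  have h0 := hd 0
  have h1 := hd 1
  have h2 := hd 2
  simp at h0 h1 h2
  -- Of the eight sign patterns of `a, b, b - a`, two are contradictory; each of the other six gives
  -- one value of `j₀`.
  rcases lt_or_gt_of_ne h0 with h0 | h0 <;> rcases lt_or_gt_of_ne h1 with h1 | h1 <;>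
    rcases lt_or_gt_of_ne h2 with h2 | h2
  · refine ⟨0, fun j => ?_⟩
    fin_cases j <;> simp <;> linarith
  · refine ⟨5, fun j => ?_⟩
    fin_cases j <;> simp <;> linarith
  · linarith
  · refine ⟨4, fun j => ?_⟩
    fin_cases j <;> simp <;> linarith
  · refine ⟨1, fun j => ?_⟩
    fin_cases j <;> simp <;> linarith
  · linarith
  · refine ⟨2, fun j => ?_⟩
    fin_cases j <;> simp <;> linarith
  · refine ⟨3, fun j => ?_⟩
    fin_cases j <;> simp <;> linarith

/-- Turning the normal back by 60 degrees amounts to passing to the next sample. This compares the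
two edges at a vertex. -/
theorem outerNormal_sub_sample {φ : ℝ} {d : Plane} (j : Fin 6) :
    outerNormal (φ - Real.pi / 3) (sample d j) = outerNormal φ (sample d (j + 1)) := by
  rw [sample, sample, outerNormal_planeRotation, outerNormal_planeRotation]
  have := periodic_hexAngle_add (f := fun x => outerNormal (φ - x)) (fun x => by
    have := outerNormal_periodic (φ - (x + 2 * Real.pi))
    simp only at this ⊢
    rw [← this]; congr 1; ring) 0 j 1
  simp only [hexAngle_one, zero_add] at this
  rw [this]
  congr 2
  simp only [hexAngle]; ring

section tiling

variable {ι : Type*} {θ : ι → ℝ} {l : ι → Fin 6 → ℝ} {v : ι → Fin 6 → Plane}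

theorem continuous_sample (j : Fin 6) : Continuous fun d => sample d j :=
  (planeRotation _).continuous

theorem sample_zero (j : Fin 6) : sample 0 j = 0 := by simp [sample]

theorem quasiMeasurePreserving_add_sample (m : Plane) (j : Fin 6) :
    Measure.QuasiMeasurePreserving (fun d => m + sample d j) volume volume :=
  ((measurePreserving_add_left volume m).comp
    (planeRotation (hexAngle 0 j)).measurePreserving).quasiMeasurePreserving

theorem quasiMeasurePreserving_sample (j : Fin 6) :
    Measure.QuasiMeasurePreserving (fun d => sample d j) volume volume :=
  (planeRotation (hexAngle 0 j)).measurePreserving.quasiMeasurePreserving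

/-- For almost every `d`, each sample lies in exactly one hexagon and on no line through `m`
parallel to an edge. For every `d` near `0`, the samples lie only in hexagons through `m`, by local
finiteness, and inequalities strict at `m` stay strict. A conull set is dense, so it meets this
neighbourhood of `0`. -/
theorem IsHexagonTiling.exists_samples (h : IsHexagonTiling θ l v) (m : Plane) :
    ∃ d, (∀ j, ∃ q, m + sample d j ∈ hexagonRegion (v q)) ∧
      (∀ j q q', q ≠ q' → m + sample d j ∈ hexagonRegion (v q) →
        m + sample d j ∉ hexagonRegion (v q')) ∧
      (∀ j q, m + sample d j ∈ hexagonRegion (v q) → m ∈ hexagonRegion (v q)) ∧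
      (∀ q i, m ∈ hexagonRegion (v q) → outerNormal (hexAngle (θ q) i) (m - v q i) < 0 →
        ∀ j, outerNormal (hexAngle (θ q) i) (m + sample d j - v q i) < 0) ∧
      (∀ q i j, outerNormal (hexAngle (θ q) i) (sample d j) ≠ 0) := by
  have := h.countable
  have hA : ∀ᵐ d : Plane, ∀ j, ∃ q, m + sample d j ∈ hexagonRegion (v q) :=
    ae_all_iff.2 fun j => (quasiMeasurePreserving_add_sample m j).ae h.ae_cover
  have hB : ∀ᵐ d : Plane, ∀ j q q', q ≠ q' → m + sample d j ∈ hexagonRegion (v q) →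
        m + sample d j ∉ hexagonRegion (v q') := by
    refine ae_all_iff.2 fun j => ?_
    refine (quasiMeasurePreserving_add_sample m j).ae
      (p := fun x => ∀ q q', q ≠ q' → x ∈ hexagonRegion (v q) → x ∉ hexagonRegion (v q')) ?_
    refine ae_all_iff.2 fun q => ae_all_iff.2 fun q' => ?_
    by_cases hq : q = q'
    · exact Filter.Eventually.of_forall fun x hx => absurd hq hx
    · have := h.aedisjoint hq
      have h2 : ∀ᵐ x : Plane, x ∉ hexagonRegion (v q) ∩ hexagonRegion (v q') := by
        rw [ae_iff]; simp only [not_not]; exact this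
      filter_upwards [h2] with x hx _ hx1 hx2
      exact hx ⟨hx1, hx2⟩
  have hE : ∀ᵐ d : Plane, ∀ q i j, outerNormal (hexAngle (θ q) i) (sample d j) ≠ 0 :=
    ae_all_iff.2 fun q => ae_all_iff.2 fun i => ae_all_iff.2 fun j =>
      (quasiMeasurePreserving_sample j).ae (ae_outerNormal_ne_zero _)
  have lim (j : Fin 6) : Filter.Tendsto (fun d => m + sample d j) (nhds 0) (nhds m) := by
    have : Continuous fun d => m + sample d j := continuous_const.add (continuous_sample j)
    have := this.tendsto 0
    rwa [sample_zero, add_zero] at this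
  have hC : ∀ᶠ d in nhds (0 : Plane), ∀ j q, m + sample d j ∈ hexagonRegion (v q) →
      m ∈ hexagonRegion (v q) := by
    refine Filter.eventually_all.2 fun j => ?_
    have := h.locallyFinite.eventually_subset
      (fun q => (isCompact_hexagonRegion (v q)).isClosed) m
    exact (lim j).eventually this
  have hD : ∀ᶠ d in nhds (0 : Plane), ∀ q, m ∈ hexagonRegion (v q) → ∀ i,
      outerNormal (hexAngle (θ q) i) (m - v q i) < 0 →
        ∀ j, outerNormal (hexAngle (θ q) i) (m + sample d j - v q i) < 0 := by
    have hfin := h.locallyFinite.point_finite m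
    refine (Filter.eventually_all_finite hfin).2 fun q _ => Filter.eventually_all.2 fun i => ?_
    by_cases hs : outerNormal (hexAngle (θ q) i) (m - v q i) < 0
    · have : ∀ᶠ d in nhds (0 : Plane), ∀ j,
          outerNormal (hexAngle (θ q) i) (m + sample d j - v q i) < 0 := by
        refine Filter.eventually_all.2 fun j => (lim j).eventually
          (p := fun x => outerNormal (hexAngle (θ q) i) (x - v q i) < 0) ?_
        have hc : Continuous fun x => outerNormal (hexAngle (θ q) i) (x - v q i) := by fun_prop
        exact hc.continuousAt.eventually_lt continuousAt_const hs
      filter_upwards [this] with d hd _ using hd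
    · exact Filter.Eventually.of_forall fun d h => absurd h hs
  have hdense := Measure.dense_of_ae (hA.and (hB.and hE))
  obtain ⟨d, ⟨hd1, hd2⟩⟩ := hdense.inter_nhds_nonempty (hC.and hD)
  exact ⟨d, hd1.1, hd1.2.1, hd2.1, fun q i hq => hd2.2 q hq i, hd1.2.2⟩

end tiling

section counting

variable {θ : ℝ} {l : Fin 6 → ℝ} {v : Fin 6 → Plane} {m d : Plane}

theorem IsHexagonWith.sample_mem_of_interior (h : IsHexagonWith θ l v)
    (hm : ∀ i, outerNormal (hexAngle θ i) (m - v i) < 0)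
    (hD : ∀ i, outerNormal (hexAngle θ i) (m - v i) < 0 →
        ∀ j, outerNormal (hexAngle θ i) (m + sample d j - v i) < 0) (j : Fin 6) :
    m + sample d j ∈ hexagonRegion v :=
  (h.mem_hexagonRegion_iff _).2 fun i => (hD i (hm i) j).le

/-- Near a point of an open edge the hexagon coincides with a half-plane, which contains three
consecutive samples. -/
theorem IsHexagonWith.sample_mem_of_edge (h : IsHexagonWith θ l v) {i : Fin 6} {t : ℝ}
    (h0 : 0 < t) (h1 : t < l i) (hm : m = v i + t • unitVec (hexAngle θ i))
    (hD : ∀ i, outerNormal (hexAngle θ i) (m - v i) < 0 →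
        ∀ j, outerNormal (hexAngle θ i) (m + sample d j - v i) < 0)
    (hE : ∀ i j, outerNormal (hexAngle θ i) (sample d j) ≠ 0) :
    ∃ j₀ : Fin 6, ∀ j, m + sample d j ∈ hexagonRegion v ↔ j = j₀ ∨ j = j₀ + 1 ∨ j = j₀ + 2 := by
  obtain ⟨j₀, hj⟩ := exists_three_samples (hE i)
  refine ⟨j₀, fun j => ?_⟩
  rw [← hj, h.mem_hexagonRegion_iff]
  have hi : outerNormal (hexAngle θ i) (m + sample d j - v i) =
      outerNormal (hexAngle θ i) (sample d j) := by
    rw [add_sub_right_comm, map_add, hm, outerNormal_edge_self, zero_add]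
  constructor
  · intro H
    exact lt_of_le_of_ne (hi ▸ H i) (hE i j)
  · intro H k
    by_cases hk : k = i
    · rw [hk, hi]; exact H.le
    · exact (hD k (hm ▸ h.outerNormal_edge_lt h0 h1 hk) j).le

theorem consecutive_iff (j j₀ : Fin 6) : (j = j₀ ∨ j = j₀ + 1) ↔
    ((j = j₀ ∨ j = j₀ + 1 ∨ j = j₀ + 2) ∧ (j + 1 = j₀ ∨ j + 1 = j₀ + 1 ∨ j + 1 = j₀ + 2)) := by
  revert j j₀; decide

/-- At a vertex two inequalities are active. The sign pattern of the preceding edge is that of edge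
`i` shifted by one sample, so two triples overlapping in a pair are intersected. -/
theorem IsHexagonWith.sample_mem_of_vertex (h : IsHexagonWith θ l v) {i : Fin 6} (hm : m = v i)
    (hD : ∀ i, outerNormal (hexAngle θ i) (m - v i) < 0 →
        ∀ j, outerNormal (hexAngle θ i) (m + sample d j - v i) < 0)
    (hE : ∀ i j, outerNormal (hexAngle θ i) (sample d j) ≠ 0) :
    ∃ j₀ : Fin 6, ∀ j, m + sample d j ∈ hexagonRegion v ↔ j = j₀ ∨ j = j₀ + 1 := by
  obtain ⟨j₀, hj⟩ := exists_three_samples (hE i)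
  refine ⟨j₀, fun j => ?_⟩
  have hpred : ∀ j, outerNormal (hexAngle θ (i + 5)) (sample d j) =
      outerNormal (hexAngle θ i) (sample d (j + 1)) := fun j => by
    rw [← outerNormal_sub_sample]
    have hp : Function.Periodic (fun φ => outerNormal (φ - Real.pi / 3)) (2 * Real.pi) :=
      outerNormal_periodic.sub_const _
    have e : 1 + (i + 5) = i := by omega
    have := periodic_hexAngle_add hp θ 1 (i + 5)
    simp only [e, hexAngle_one, add_sub_cancel_right] at this
    rw [this]
  have hi : outerNormal (hexAngle θ i) (m + sample d j - v i) =
      outerNormal (hexAngle θ i) (sample d j) := by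
    rw [add_sub_right_comm, map_add, hm, sub_self, map_zero, zero_add]
  have hi' : outerNormal (hexAngle θ (i + 5)) (m + sample d j - v (i + 5)) =
      outerNormal (hexAngle θ i) (sample d (j + 1)) := by
    rw [add_sub_right_comm, map_add, hm, h.outerNormal_vertex_pred, zero_add, hpred]
  have key : (j = j₀ ∨ j = j₀ + 1) ↔ (outerNormal (hexAngle θ i) (sample d j) < 0 ∧
      outerNormal (hexAngle θ i) (sample d (j + 1)) < 0) := by
    rw [hj, hj]
    exact consecutive_iff j j₀
  rw [key, h.mem_hexagonRegion_iff]
  constructor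
  · intro H
    exact ⟨lt_of_le_of_ne (hi ▸ H i) (hE i j), lt_of_le_of_ne (hi' ▸ H _) (hE i _)⟩
  · intro H k
    by_cases hk : k = i
    · rw [hk, hi]; exact H.1.le
    by_cases hk' : k = i + 5
    · rw [hk', hi']; exact H.2.le
    · exact (hD k (hm ▸ h.outerNormal_vertex_lt hk hk') j).le

end counting

theorem exists_not_mem_of_disjoint (j₀ j₁ : Fin 6)
    (h : ∀ j : Fin 6, (j = j₀ ∨ j = j₀ + 1 ∨ j = j₀ + 2) → ¬ (j = j₁ ∨ j = j₁ + 1)) :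
    ∃ k : Fin 6, ∀ j, (¬ (j = j₀ ∨ j = j₀ + 1 ∨ j = j₀ + 2) ∧ ¬ (j = j₁ ∨ j = j₁ + 1)) ↔ j = k := by
  revert j₀ j₁; decide

theorem exists_not_mem_three (j₀ : Fin 6) :
    ∃ k : Fin 6, ¬ (k = j₀ ∨ k = j₀ + 1 ∨ k = j₀ + 2) := by
  revert j₀; decide

/-! ### Hexagon tilings are edge-to-edge. -/

section tiling

variable {ι : Type*} {θ : ι → ℝ} {l : ι → Fin 6 → ℝ} {v : ι → Fin 6 → Plane}

/-- Two different hexagons that meet at a point of an open edge of the first one share an open edge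
point: no vertex lies inside an edge. -/
theorem IsHexagonTiling.mem_edge_of_mem (h : IsHexagonTiling θ l v) {q q' : ι} (hq : q' ≠ q)
    {i : Fin 6} {t : ℝ} (h0 : 0 < t) (h1 : t < l q i)
    (hm : v q i + t • unitVec (hexAngle (θ q) i) ∈ hexagonRegion (v q')) :
    ∃ j s, 0 < s ∧ s < l q' j ∧
      v q i + t • unitVec (hexAngle (θ q) i) = v q' j + s • unitVec (hexAngle (θ q') j) := by
  obtain ⟨d, hA, hB, hC, hD, hE⟩ := h.exists_samples (v q i + t • unitVec (hexAngle (θ q) i))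
  have hmq := (h.hexagon q).edge_mem h0 h1
  set m := v q i + t • unitVec (hexAngle (θ q) i) with hmdef
  obtain ⟨j₀, hj₀⟩ := (h.hexagon q).sample_mem_of_edge h0 h1 hmdef (fun i => hD q i hmq) (hE q)
  rcases (h.hexagon q').trichotomy hm with hint | hedge | ⟨k, hk⟩
  · exact absurd ((h.hexagon q').sample_mem_of_interior hint (fun i => hD q' i hm) j₀)
      (hB j₀ q q' hq.symm ((hj₀ j₀).2 (Or.inl rfl)))
  · obtain ⟨j, s, hs0, hs1, e⟩ := hedge
    exact ⟨j, s, hs0, hs1, e⟩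
  · exfalso
    obtain ⟨j₁, hj₁⟩ := (h.hexagon q').sample_mem_of_vertex hk (fun i => hD q' i hm) (hE q')
    -- Three samples belong to `q` and two to `q'`. The single sample `k` left over must lie in a
    -- third hexagon through `m`.
    obtain ⟨k, hk⟩ := exists_not_mem_of_disjoint j₀ j₁ fun j hj hj' =>
      hB j q q' hq.symm ((hj₀ j).2 hj) ((hj₁ j).2 hj')
    obtain ⟨hk0, hk1⟩ := (hk k).2 rfl
    rw [← hj₀] at hk0
    rw [← hj₁] at hk1
    obtain ⟨q'', hq''⟩ := hA k
    have hm'' := hC k q'' hq''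
    have n0 : q'' ≠ q := by rintro rfl; exact hk0 hq''
    have n1 : q'' ≠ q' := by rintro rfl; exact hk1 hq''
    -- Whatever the position of `m` in the third hexagon, it contains at least two samples, while
    -- only one is free.
    have other : ∃ k' ≠ k, m + sample d k' ∈ hexagonRegion (v q'') := by
      rcases (h.hexagon q'').trichotomy hm'' with hint | ⟨i', t', ht0, ht1, e⟩ | ⟨i', e⟩
      · exact ⟨k + 1, by simp, (h.hexagon q'').sample_mem_of_interior hint
          (fun i => hD q'' i hm'') _⟩
      · obtain ⟨j₂, hj₂⟩ :=
          (h.hexagon q'').sample_mem_of_edge ht0 ht1 e (fun i => hD q'' i hm'') (hE q'')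
        by_cases hjk : j₂ = k
        · exact ⟨j₂ + 1, by simp [hjk], (hj₂ _).2 (Or.inr (Or.inl rfl))⟩
        · exact ⟨j₂, hjk, (hj₂ _).2 (Or.inl rfl)⟩
      · obtain ⟨j₂, hj₂⟩ :=
          (h.hexagon q'').sample_mem_of_vertex e (fun i => hD q'' i hm'') (hE q'')
        by_cases hjk : j₂ = k
        · exact ⟨j₂ + 1, by simp [hjk], (hj₂ _).2 (Or.inr rfl)⟩
        · exact ⟨j₂, hjk, (hj₂ _).2 (Or.inl rfl)⟩
    obtain ⟨k', hk', hmem⟩ := other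
    refine hk' ((hk k').1 ⟨fun hh => ?_, fun hh => ?_⟩)
    · exact hB k' q q'' n0.symm ((hj₀ k').2 hh) hmem
    · exact hB k' q' q'' n1.symm ((hj₁ k').2 hh) hmem

theorem IsHexagonTiling.exists_neighbor (h : IsHexagonTiling θ l v) {q : ι}
    {i : Fin 6} {t : ℝ} (h0 : 0 < t) (h1 : t < l q i) :
    ∃ q' ≠ q, v q i + t • unitVec (hexAngle (θ q) i) ∈ hexagonRegion (v q') := by
  obtain ⟨d, hA, hB, hC, hD, hE⟩ := h.exists_samples (v q i + t • unitVec (hexAngle (θ q) i))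
  have hmq := (h.hexagon q).edge_mem h0 h1
  set m := v q i + t • unitVec (hexAngle (θ q) i) with hmdef
  obtain ⟨j₀, hj₀⟩ := (h.hexagon q).sample_mem_of_edge h0 h1 hmdef (fun i => hD q i hmq) (hE q)
  obtain ⟨k, hk⟩ := exists_not_mem_three j₀
  rw [← hj₀] at hk
  obtain ⟨q', hq'⟩ := hA k
  exact ⟨q', by rintro rfl; exact hk hq', hC k q' hq'⟩

theorem IsHexagonTiling.not_both_interior (h : IsHexagonTiling θ l v) {q q' : ι} (hq : q ≠ q')
    (x : Plane) (hx : ∀ i, outerNormal (hexAngle (θ q) i) (x - v q i) < 0) :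
    ¬ ∀ i, outerNormal (hexAngle (θ q') i) (x - v q' i) < 0 := by
  intro hx'
  have key (q : ι) (hx : ∀ i, outerNormal (hexAngle (θ q) i) (x - v q i) < 0) :
      ∀ᶠ y in nhds x, y ∈ hexagonRegion (v q) := by
    have : ∀ᶠ y in nhds x, ∀ i, outerNormal (hexAngle (θ q) i) (y - v q i) < 0 := by
      refine Filter.eventually_all.2 fun i => ?_
      have hc : Continuous fun x => outerNormal (hexAngle (θ q) i) (x - v q i) := by fun_prop
      exact hc.continuousAt.eventually_lt continuousAt_const (hx i)
    filter_upwards [this] with y hy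
    exact ((h.hexagon q).mem_hexagonRegion_iff y).2 fun i => (hy i).le
  have hpos : 0 < volume (hexagonRegion (v q) ∩ hexagonRegion (v q')) :=
    Measure.measure_pos_of_mem_nhds _ (Filter.inter_mem (key q hx) (key q' hx'))
  exact hpos.ne' (h.aedisjoint hq)

/-- Two half-planes through a common point, bounded by edges of different hexagons of a tiling, are
opposite to each other. -/
theorem IsHexagonTiling.unitVec_eq_neg (h : IsHexagonTiling θ l v) {q q' : ι} (hq : q ≠ q')
    {i j : Fin 6} {t s : ℝ} (h0 : 0 < t) (h1 : t < l q i) (hs0 : 0 < s) (hs1 : s < l q' j)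
    (e : v q i + t • unitVec (hexAngle (θ q) i) = v q' j + s • unitVec (hexAngle (θ q') j)) :
    unitVec (hexAngle (θ q') j) = - unitVec (hexAngle (θ q) i) := by
  set φ := hexAngle (θ q) i with hφ
  set ψ := hexAngle (θ q') j with hψ
  by_cases hc : Real.cos (φ - ψ) = -1
  · have h1 : (Real.cos φ + Real.cos ψ) ^ 2 + (Real.sin φ + Real.sin ψ) ^ 2 = 0 := by
      rw [Real.cos_sub] at hc
      linear_combination Real.sin_sq_add_cos_sq φ + Real.sin_sq_add_cos_sq ψ + 2 * hc
    have h2 : Real.cos φ + Real.cos ψ = 0 := by nlinarith [sq_nonneg (Real.sin φ + Real.sin ψ)]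
    have h3 : Real.sin φ + Real.sin ψ = 0 := by nlinarith [sq_nonneg (Real.cos φ + Real.cos ψ)]
    apply plane_ext
    · simp; linarith
    · simp; linarith
  · exfalso
    have hc' : -1 < Real.cos (φ - ψ) := lt_of_le_of_ne (Real.neg_one_le_cos _) (Ne.symm hc)
    -- The sum of the two inner unit normals: both outer normals take the value `-1 - cos (φ - ψ) <
    -- 0` on it. A small step along `y` then enters the interior of both hexagons.
    set y : Plane := unitVec (φ + Real.pi / 2) + unitVec (ψ + Real.pi / 2) with hy
    have n1 : outerNormal φ y < 0 := by
      rw [hy, map_add, outerNormal_unitVec, outerNormal_unitVec, ← sub_sub, ← sub_sub,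
        Real.sin_sub_pi_div_two, Real.sin_sub_pi_div_two, sub_self, Real.cos_zero]
      linarith
    have n2 : outerNormal ψ y < 0 := by
      rw [hy, map_add, outerNormal_unitVec, outerNormal_unitVec, ← sub_sub, ← sub_sub,
        Real.sin_sub_pi_div_two, Real.sin_sub_pi_div_two, sub_self, Real.cos_zero,
        ← neg_sub φ ψ, Real.cos_neg]
      linarith
    have key (q : ι) (i : Fin 6) (t : ℝ) (h0 : 0 < t) (h1 : t < l q i)
        (n : outerNormal (hexAngle (θ q) i) y < 0) : ∀ᶠ ε in nhdsWithin (0 : ℝ) (Ioi 0),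
        ∀ k, outerNormal (hexAngle (θ q) k)
          (v q i + t • unitVec (hexAngle (θ q) i) + ε • y - v q k) < 0 := by
      refine Filter.eventually_all.2 fun k => ?_
      by_cases hk : k = i
      · filter_upwards [self_mem_nhdsWithin] with ε hε
        rw [add_sub_right_comm, map_add, hk, outerNormal_edge_self, zero_add, map_smul,
          smul_eq_mul]
        exact mul_neg_of_pos_of_neg hε n
      · refine nhdsWithin_le_nhds ?_
        have hc : Continuous fun ε : ℝ => outerNormal (hexAngle (θ q) k)
          (v q i + t • unitVec (hexAngle (θ q) i) + ε • y - v q k) := by fun_prop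
        refine hc.continuousAt.eventually_lt continuousAt_const ?_
        simpa using (h.hexagon q).outerNormal_edge_lt h0 h1 hk
    obtain ⟨ε, e1, e2⟩ := ((key q i t h0 h1 n1).and (key q' j s hs0 hs1 n2)).exists
    rw [← hψ, ← e] at e2
    exact h.not_both_interior hq _ e1 e2

/-- Edge-to-edge property: each edge of a hexagon of a tiling is also an edge, run through in the
opposite direction, of another hexagon of the tiling. -/
theorem IsHexagonTiling.edge_to_edge (h : IsHexagonTiling θ l v) (q : ι) (i : Fin 6) :
    ∃ q' ≠ q, ∃ j, unitVec (hexAngle (θ q') j) = - unitVec (hexAngle (θ q) i) ∧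
      l q' j = l q i ∧ v q' j = v q (i + 1) ∧ v q' (j + 1) = v q i := by
  have hl := (h.hexagon q).1 i
  have ht0 : 0 < l q i / 2 := by linarith
  have ht1 : l q i / 2 < l q i := by linarith
  obtain ⟨q', hq', hm⟩ := h.exists_neighbor ht0 ht1
  obtain ⟨j, s, hs0, hs1, e⟩ := h.mem_edge_of_mem hq' ht0 ht1 hm
  have hu := h.unitVec_eq_neg hq'.symm ht0 ht1 hs0 hs1 e
  -- A vertex of `q'` on an open edge of `q` would lie on an open edge of `q'` itself. But a vertex
  -- lies on two edge lines of its hexagon, an open edge point on only one.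
  have vertex_not (q q' : ι) (hq : q' ≠ q) (i k : Fin 6) (t : ℝ) (h0 : 0 < t) (h1 : t < l q i)
      (e : v q i + t • unitVec (hexAngle (θ q) i) = v q' k) : False := by
    obtain ⟨j, s, hs0, hs1, e'⟩ := h.mem_edge_of_mem hq h0 h1
      (e ▸ vertex_mem_hexagonRegion (v q') k)
    rw [e] at e'
    have hk := (h.hexagon q').outerNormal_edge_lt hs0 hs1 (j := k)
    have hk' := (h.hexagon q').outerNormal_edge_lt hs0 hs1 (j := k + 5)
    rw [← e'] at hk hk'
    rw [(h.hexagon q').outerNormal_vertex_pred] at hk'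
    simp only [sub_self, map_zero, lt_irrefl, imp_false, not_not] at hk hk'
    rw [← hk] at hk'
    simp at hk'
  have hv' : v q' j = v q i + (l q i / 2 + s) • unitVec (hexAngle (θ q) i) := by
    rw [add_smul, ← add_assoc, e, hu]; module
  have hv1' : v q' (j + 1) = v q i + (l q i / 2 + s - l q' j) • unitVec (hexAngle (θ q) i) := by
    have := (h.hexagon q').2 j
    rw [sub_eq_iff_eq_add] at this
    rw [this, hv', hu]; module
  have hv1 : v q (i + 1) = v q i + l q i • unitVec (hexAngle (θ q) i) := by
    rw [← (h.hexagon q).2 i]; abel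
  -- Both edges lie on one line and overlap, and no endpoint of either is interior to the other; the
  -- four inequalities make the endpoints coincide.
  have c1 : l q i ≤ l q i / 2 + s := by
    by_contra hlt
    exact vertex_not q q' hq' i j (l q i / 2 + s) (by linarith) (by linarith) hv'.symm
  have c2 : l q i / 2 + s - l q' j ≤ 0 := by
    by_contra hlt
    exact vertex_not q q' hq' i (j + 1) (l q i / 2 + s - l q' j) (by linarith) (by linarith)
      hv1'.symm
  have c3 : l q i / 2 + s ≤ l q i := by
    by_contra hlt
    refine vertex_not q' q hq'.symm j (i + 1) (l q i / 2 + s - l q i) (by linarith)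
      (by linarith) ?_
    rw [hv', hv1, hu]; module
  have c4 : l q' j ≤ l q i / 2 + s := by
    by_contra hlt
    refine vertex_not q' q hq'.symm j i (l q i / 2 + s) (by linarith)
      (by linarith) ?_
    rw [hv', hu]; module
  have hs : s = l q i / 2 := by linarith
  have hl' : l q' j = l q i := by linarith
  refine ⟨q', hq', j, hu, hl', ?_, ?_⟩
  · rw [hv', hv1, hs]; congr 2; ring
  · rw [hv1', hl', hs]; simp

end tiling

/-! ### Integration in oblique coordinates and the divergence theorem on a hexagon. -/

/-- The linear map sending the standard basis to the unit vectors with polar angles `θ` and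
`θ + π/3`. -/
noncomputable def obliqueLinear (θ : ℝ) : Plane →ₗ[ℝ] Plane where
  toFun x := x 0 • unitVec (hexAngle θ 0) + x 1 • unitVec (hexAngle θ 1)
  map_add' x y := by simp only [PiLp.add_apply]; module
  map_smul' c x := by simp only [PiLp.smul_apply, smul_eq_mul, RingHom.id_apply]; module

theorem det_obliqueLinear (θ : ℝ) : LinearMap.det (obliqueLinear θ) = √3 / 2 := by
  rw [← LinearMap.det_toMatrix (EuclideanSpace.basisFun (Fin 2) ℝ).toBasis, Matrix.det_fin_two]
  simp only [LinearMap.toMatrix_apply, OrthonormalBasis.coe_toBasis, EuclideanSpace.basisFun_apply,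
    OrthonormalBasis.coe_toBasis_repr_apply, EuclideanSpace.basisFun_repr, obliqueLinear]
  simp [hexAngle_zero, hexAngle_one, Real.cos_add, Real.sin_add]
  linear_combination (√3 / 2) * Real.sin_sq_add_cos_sq θ

theorem continuous_oblique (θ : ℝ) (p : Plane) :
    Continuous fun z : ℝ × ℝ => oblique θ p z.1 z.2 := by
  unfold oblique; fun_prop

theorem measurableEmbedding_oblique (θ : ℝ) (p : Plane) :
    MeasurableEmbedding fun z : ℝ × ℝ => oblique θ p z.1 z.2 :=
  (continuous_oblique θ p).measurableEmbedding fun _ _ h => Prod.ext_iff.2 (oblique_inj h)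

theorem measurePreserving_oblique (θ : ℝ) (p : Plane) :
    MeasurePreserving (fun z : ℝ × ℝ => oblique θ p z.1 z.2) volume
      (ENNReal.ofReal (√3 / 2)⁻¹ • volume) := by
  have hk : (0 : ℝ) < √3 / 2 := by positivity
  have e1 : MeasurePreserving (fun z : ℝ × ℝ => (!₂[z.1, z.2] : Plane)) volume volume :=
    (EuclideanSpace.volume_preserving_symm_measurableEquiv_toLp (Fin 2)).symm.comp
      (volume_preserving_finTwoArrow ℝ).symm
  have e2 : MeasurePreserving (obliqueLinear θ) volume
      (ENNReal.ofReal (√3 / 2)⁻¹ • volume) := by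
    refine ⟨(obliqueLinear θ).continuous_of_finiteDimensional.measurable, ?_⟩
    rw [Measure.map_linearMap_addHaar_eq_smul_addHaar, det_obliqueLinear, abs_of_pos (by positivity)]
    rw [det_obliqueLinear]; exact hk.ne'
  have e3 : MeasurePreserving (fun x : Plane => p + x) (ENNReal.ofReal (√3 / 2)⁻¹ • volume)
      (ENNReal.ofReal (√3 / 2)⁻¹ • volume) :=
    (measurePreserving_add_left volume p).smul_measure _
  convert (e3.comp e2).comp e1 using 1
  ext z : 1
  simp [oblique, obliqueLinear, add_assoc]

theorem setIntegral_eq_setIntegral_oblique (θ : ℝ) (p : Plane) (S : Set Plane) (g : Plane → ℝ) :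
    ∫ x in S, g x = √3 / 2 *
      ∫ z in (fun z : ℝ × ℝ => oblique θ p z.1 z.2) ⁻¹' S, g (oblique θ p z.1 z.2) := by
  have hk : (0 : ℝ) < √3 / 2 := by positivity
  rw [(measurePreserving_oblique θ p).setIntegral_preimage_emb (measurableEmbedding_oblique θ p),
    Measure.restrict_smul, integral_smul_measure, ENNReal.toReal_ofReal (by positivity),
    smul_eq_mul, mul_inv_cancel_left₀ hk.ne']

section slicing

variable {θ : ℝ} {l : Fin 6 → ℝ} {v : Fin 6 → Plane}

/-- Fubini along slices parallel to edge `0`. A slice starts on edge `5` and, above height `l 5`, on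
edge `4`; it ends on edge `1` and, above height `l 1`, on edge `2`. This accounts for the maximum
and the minimum. -/
theorem IsHexagonWith.setIntegral_eq (h : IsHexagonWith θ l v) {g : Plane → ℝ}
    (hg : Continuous g) : ∫ x in hexagonRegion v, g x = √3 / 2 *
      ∫ β in (0)..(l 1 + l 2), ∫ α in (max (-l 5) (-β))..(min (l 0) (l 0 + l 1 - β)),
        g (oblique θ (v 0) α β) := by
  obtain ⟨w0, w1, w2, w3, w4, w5, e1, e2⟩ := h.vertex_eq
  have p0 := h.1 0
  have p1 := h.1 1
  have p2 := h.1 2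
  have p4 := h.1 4
  have p5 := h.1 5
  rw [setIntegral_eq_setIntegral_oblique θ (v 0)]
  congr 1
  set S := (fun z : ℝ × ℝ => oblique θ (v 0) z.1 z.2) ⁻¹' hexagonRegion v with hS
  set G : ℝ × ℝ → ℝ := fun z => g (oblique θ (v 0) z.1 z.2) with hG
  have hGc : Continuous G := hg.comp (continuous_oblique θ _)
  have hSclosed : IsClosed S :=
    (isCompact_hexagonRegion v).isClosed.preimage (continuous_oblique θ _)
  have hSmem : ∀ α β, (α, β) ∈ S ↔ (β ∈ Icc 0 (l 1 + l 2) ∧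
      α ∈ Icc (max (-l 5) (-β)) (min (l 0) (l 0 + l 1 - β))) := by
    intro α β
    refine (h.oblique_mem_iff α β).trans ?_
    simp only [mem_Icc, max_le_iff, le_min_iff]
    constructor
    · rintro ⟨a1, a2, a3, a4, a5, a6⟩
      refine ⟨⟨?_, ?_⟩, ⟨?_, ?_⟩, ?_, ?_⟩ <;> linarith
    · rintro ⟨⟨a1, a2⟩, ⟨a3, a4⟩, a5, a6⟩
      refine ⟨?_, ?_, ?_, ?_, ?_, ?_⟩ <;> linarith
  have hScompact : IsCompact S := by
    refine (isCompact_Icc (a := ((-l 5, 0) : ℝ × ℝ)) (b := (l 0, l 1 + l 2))).of_isClosed_subset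
      hSclosed ?_
    rintro ⟨α, β⟩ hz
    obtain ⟨⟨a1, a2⟩, a3, a4⟩ := (hSmem α β).1 hz
    exact ⟨⟨(le_max_left _ _).trans a3, a1⟩, ⟨a4.trans (min_le_left _ _), a2⟩⟩
  have hint : Integrable (S.indicator G) volume :=
    (integrable_indicator_iff hSclosed.measurableSet).2
      (hGc.continuousOn.integrableOn_compact' hScompact hSclosed.measurableSet)
  rw [← integral_indicator hSclosed.measurableSet]
  rw [Measure.volume_eq_prod] at hint ⊢
  rw [integral_prod_symm _ hint]
  rw [intervalIntegral.integral_of_le (by linarith), ← integral_Icc_eq_integral_Ioc,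
    ← integral_indicator measurableSet_Icc]
  congr 1
  ext β
  by_cases hβ : β ∈ Icc 0 (l 1 + l 2)
  · rw [indicator_of_mem hβ, intervalIntegral.integral_of_le, ← integral_Icc_eq_integral_Ioc,
      ← integral_indicator measurableSet_Icc]
    · congr 1
      ext α
      by_cases hα : α ∈ Icc (max (-l 5) (-β)) (min (l 0) (l 0 + l 1 - β))
      · rw [indicator_of_mem hα, indicator_of_mem ((hSmem α β).2 ⟨hβ, hα⟩)]
      · rw [indicator_of_notMem hα, indicator_of_notMem fun hh => hα ((hSmem α β).1 hh).2]
    · obtain ⟨b1, b2⟩ := hβ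
      rw [max_le_iff, le_min_iff, le_min_iff]
      -- The bounds are in the right order because the top edge has positive length, `l 3 = l 0 - l
      -- 2 + l 5 > 0`.
      refine ⟨⟨?_, ?_⟩, ?_, ?_⟩ <;> linarith [h.1 3]
  · rw [indicator_of_notMem hβ]
    have : (fun α => S.indicator G (α, β)) = fun _ => 0 := by
      ext α
      exact indicator_of_notMem (fun hh => hβ ((hSmem α β).1 hh).1) _
    simp [this]

/-- The integral of a function along the `i`-th edge of a hexagon. -/
noncomputable def edgeIntegral (θ : ℝ) (l : Fin 6 → ℝ) (v : Fin 6 → Plane) (f : Plane → ℝ)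
    (i : Fin 6) : ℝ := ∫ s in (0)..(l i), f (v i + s • unitVec (hexAngle θ i))

theorem IsHexagonWith.edgeIntegral_eq (h : IsHexagonWith θ l v) (f : Plane → ℝ) :
    edgeIntegral θ l v f 1 = (∫ β in (0)..(l 1), f (oblique θ (v 0) (l 0) β)) ∧
    edgeIntegral θ l v f 2 =
      (∫ β in (l 1)..(l 1 + l 2), f (oblique θ (v 0) (l 0 + l 1 - β) β)) ∧
    edgeIntegral θ l v f 4 = (∫ β in (l 5)..(l 1 + l 2), f (oblique θ (v 0) (-l 5) β)) ∧
    edgeIntegral θ l v f 5 = (∫ β in (0)..(l 5), f (oblique θ (v 0) (-β) β)) := by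
  obtain ⟨w0, w1, w2, w3, w4, w5, e1, e2⟩ := h.vertex_eq
  obtain ⟨u2, u3, u4, u5⟩ := hexAngle_succ_cases unitVec_add_two_thirds θ
  unfold edgeIntegral
  refine ⟨?_, ?_, ?_, ?_⟩
  · rw [w1]
    congr 1; ext s; congr 1; simp only [oblique]; module
  · have := intervalIntegral.integral_comp_add_left (a := 0) (b := l 2)
      (fun β => f (oblique θ (v 0) (l 0 + l 1 - β) β)) (l 1)
    rw [add_zero] at this
    rw [← this, w2, u2]
    congr 1; ext s; congr 1; simp only [oblique]; module
  · have := intervalIntegral.integral_comp_sub_left (a := 0) (b := l 4)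
      (fun β => f (oblique θ (v 0) (- l 5) β)) (l 4 + l 5)
    rw [sub_zero, add_sub_cancel_left] at this
    rw [e2, ← this, w4, u4]
    congr 1; ext s; congr 1; simp only [oblique]; module
  · have := intervalIntegral.integral_comp_sub_left (a := 0) (b := l 5)
      (fun β => f (oblique θ (v 0) (-β) β)) (l 5)
    rw [sub_zero, sub_self] at this
    rw [← this, w5, u5]
    congr 1; ext s; congr 1; simp only [oblique]; module

/-- The fundamental theorem of calculus on each slice leaves the values at its two ends. Edges `0`
and `3`, parallel to the slices, do not contribute. -/
theorem IsHexagonWith.setIntegral_fderiv_zero (h : IsHexagonWith θ l v) {f : Plane → ℝ}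
    (hf : ContDiff ℝ 1 f) :
    ∫ x in hexagonRegion v, fderiv ℝ f x (unitVec (hexAngle θ 0)) = √3 / 2 *
      (edgeIntegral θ l v f 1 + edgeIntegral θ l v f 2 -
        edgeIntegral θ l v f 4 - edgeIntegral θ l v f 5) := by
  obtain ⟨w0, w1, w2, w3, w4, w5, e1, e2⟩ := h.vertex_eq
  have p1 := h.1 1
  have p2 := h.1 2
  have p4 := h.1 4
  have p5 := h.1 5
  have hfd : Continuous fun x => fderiv ℝ f x (unitVec (hexAngle θ 0)) :=
    (hf.continuous_fderiv one_ne_zero).clm_apply continuous_const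
  rw [h.setIntegral_eq hfd]
  congr 1
  have ftc (β a b : ℝ) : ∫ α in a..b, fderiv ℝ f (oblique θ (v 0) α β) (unitVec (hexAngle θ 0)) =
      f (oblique θ (v 0) b β) - f (oblique θ (v 0) a β) := by
    refine intervalIntegral.integral_eq_sub_of_hasDerivAt
      (f := fun α => f (oblique θ (v 0) α β)) (fun α _ => ?_) ?_
    · have hd : HasDerivAt (fun α => oblique θ (v 0) α β) (unitVec (hexAngle θ 0)) α := by
        have := (((hasDerivAt_id α).smul_const (unitVec (hexAngle θ 0))).const_add (v 0)).add_const
          (β • unitVec (hexAngle θ 1))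
        rw [one_smul] at this
        exact this
      exact ((hf.differentiable one_ne_zero _).hasFDerivAt).comp_hasDerivAt α hd
    · refine Continuous.intervalIntegrable ?_ _ _
      exact hfd.comp ((continuous_oblique θ (v 0)).comp (continuous_id.prodMk continuous_const))
  simp only [ftc]
  have hobl {p q : ℝ → ℝ} (hp : Continuous p) (hq : Continuous q) :
      Continuous fun β => f (oblique θ (v 0) (p β) (q β)) :=
    hf.continuous.comp ((continuous_oblique θ (v 0)).comp (hp.prodMk hq))
  have c1 : Continuous fun β => f (oblique θ (v 0) (min (l 0) (l 0 + l 1 - β)) β) :=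
    hobl (by fun_prop) (by fun_prop)
  have c2 : Continuous fun β => f (oblique θ (v 0) (max (-l 5) (-β)) β) :=
    hobl (by fun_prop) (by fun_prop)
  rw [intervalIntegral.integral_sub (c1.intervalIntegrable _ _) (c2.intervalIntegrable _ _),
    ← intervalIntegral.integral_add_adjacent_intervals (b := l 1) (c1.intervalIntegrable _ _)
      (c1.intervalIntegrable _ _),
    ← intervalIntegral.integral_add_adjacent_intervals (b := l 5) (c2.intervalIntegrable _ _)
      (c2.intervalIntegrable _ _)]
  obtain ⟨E1, E2, E4, E5⟩ := h.edgeIntegral_eq f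
  rw [E1, E2, E4, E5]
  have i1 : ∫ β in (0)..(l 1), f (oblique θ (v 0) (min (l 0) (l 0 + l 1 - β)) β) =
      ∫ β in (0)..(l 1), f (oblique θ (v 0) (l 0) β) := by
    refine intervalIntegral.integral_congr fun β hβ => ?_
    rw [uIcc_of_le p1.le] at hβ
    rw [min_eq_left (by linarith [hβ.2])]
  have i2 : ∫ β in (l 1)..(l 1 + l 2), f (oblique θ (v 0) (min (l 0) (l 0 + l 1 - β)) β) =
      ∫ β in (l 1)..(l 1 + l 2), f (oblique θ (v 0) (l 0 + l 1 - β) β) := by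
    refine intervalIntegral.integral_congr fun β hβ => ?_
    rw [uIcc_of_le (by linarith)] at hβ
    rw [min_eq_right (by linarith [hβ.1])]
  have i3 : ∫ β in (0)..(l 5), f (oblique θ (v 0) (max (-l 5) (-β)) β) =
      ∫ β in (0)..(l 5), f (oblique θ (v 0) (-β) β) := by
    refine intervalIntegral.integral_congr fun β hβ => ?_
    rw [uIcc_of_le p5.le] at hβ
    rw [max_eq_right (by linarith [hβ.2])]
  have i4 : ∫ β in (l 5)..(l 1 + l 2), f (oblique θ (v 0) (max (-l 5) (-β)) β) =
      ∫ β in (l 5)..(l 1 + l 2), f (oblique θ (v 0) (-l 5) β) := by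
    refine intervalIntegral.integral_congr fun β hβ => ?_
    rw [uIcc_of_le (by linarith)] at hβ
    rw [max_eq_left (by linarith [hβ.1])]
  rw [i1, i2, i3, i4]; ring

theorem edgeIntegral_shift (f : Plane → ℝ) (i j : Fin 6) :
    edgeIntegral (hexAngle θ j) (fun i => l (i + j)) (fun i => v (i + j)) f i =
      edgeIntegral θ l v f (i + j) := by
  simp only [edgeIntegral, unitVec_hexAngle_add]

theorem IsHexagonWith.setIntegral_fderiv_one (h : IsHexagonWith θ l v) {f : Plane → ℝ}
    (hf : ContDiff ℝ 1 f) :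
    ∫ x in hexagonRegion v, fderiv ℝ f x (unitVec (hexAngle θ 1)) = √3 / 2 *
      (edgeIntegral θ l v f 2 + edgeIntegral θ l v f 3 -
        edgeIntegral θ l v f 5 - edgeIntegral θ l v f 0) := by
  have := (h.shift 1).setIntegral_fderiv_zero hf
  rw [hexagonRegion_shift, hexAngle_zero (hexAngle θ 1)] at this
  simp only [edgeIntegral_shift] at this
  exact this

end slicing

/-- The divergence is the trace of the derivative. Up to the factor `√3/2`, the normal `1` and minus
the normal `0` form the dual basis of the unit vectors `0` and `1`. -/
theorem divergence_eq (θ : ℝ) {φ : Plane → Plane} {x : Plane} (hφ : DifferentiableAt ℝ φ x) :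
    √3 / 2 * divergence φ x =
      fderiv ℝ (fun y => outerNormal (hexAngle θ 1) (φ y)) x (unitVec (hexAngle θ 0)) -
      fderiv ℝ (fun y => outerNormal (hexAngle θ 0) (φ y)) x (unitVec (hexAngle θ 1)) := by
  have hN (ψ : ℝ) (u : Plane) : fderiv ℝ (fun y => outerNormal ψ (φ y)) x u =
      outerNormal ψ (fderiv ℝ φ x u) := by
    have : fderiv ℝ (fun y => outerNormal ψ (φ y)) x = (outerNormal ψ).comp (fderiv ℝ φ x) :=
      ((outerNormal ψ).hasFDerivAt.comp x hφ.hasFDerivAt).fderiv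
    rw [this]; rfl
  have hu (ψ : ℝ) : unitVec ψ = Real.cos ψ • EuclideanSpace.single 0 1 +
      Real.sin ψ • EuclideanSpace.single 1 1 := by
    apply plane_ext <;> simp
  rw [hN, hN, hu, hu]
  simp only [divergence, Fin.sum_univ_two, map_add, map_smul, outerNormal_apply, hexAngle_zero,
    hexAngle_one, Real.cos_add, Real.sin_add, Real.cos_pi_div_three, Real.sin_pi_div_three,
    smul_eq_mul]
  generalize fderiv ℝ φ x (EuclideanSpace.single 0 1) = a
  generalize fderiv ℝ φ x (EuclideanSpace.single 1 1) = b
  linear_combination (-(√3 / 2) * (a 0 + b 1)) * Real.sin_sq_add_cos_sq θ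

section gauss

variable {θ : ℝ} {l : Fin 6 → ℝ} {v : Fin 6 → Plane}

/-- The divergence theorem on an equiangular hexagon. -/
theorem IsHexagonWith.setIntegral_divergence (h : IsHexagonWith θ l v) {φ : Plane → Plane}
    (hφ : ContDiff ℝ 1 φ) : ∫ x in hexagonRegion v, divergence φ x =
      ∑ i, edgeIntegral θ l v (fun x => outerNormal (hexAngle θ i) (φ x)) i := by
  have hk : (0 : ℝ) < √3 / 2 := by positivity
  obtain ⟨n2, n3, n4, n5⟩ := hexAngle_succ_cases outerNormal_add_two_thirds θ
  have hc (ψ : ℝ) : ContDiff ℝ 1 fun y => outerNormal ψ (φ y) := (outerNormal ψ).contDiff.comp hφ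
  have hint (ψ : ℝ) (u : Plane) : IntegrableOn (fun x => fderiv ℝ (fun y => outerNormal ψ (φ y)) x u)
      (hexagonRegion v) volume :=
    (((hc ψ).continuous_fderiv one_ne_zero).clm_apply
      continuous_const).continuousOn.integrableOn_compact (isCompact_hexagonRegion v)
  have h0 : √3 / 2 * ∫ x in hexagonRegion v, divergence φ x =
      (∫ x in hexagonRegion v, fderiv ℝ (fun y => outerNormal (hexAngle θ 1) (φ y)) x
        (unitVec (hexAngle θ 0))) -
      ∫ x in hexagonRegion v, fderiv ℝ (fun y => outerNormal (hexAngle θ 0) (φ y)) x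
        (unitVec (hexAngle θ 1)) := by
    rw [← integral_const_mul, ← integral_sub (hint _ _) (hint _ _)]
    congr 1
    ext x
    exact divergence_eq θ (hφ.differentiable one_ne_zero x)
  rw [h.setIntegral_fderiv_zero (hc _), h.setIntegral_fderiv_one (hc _), ← mul_sub] at h0
  rw [mul_left_cancel₀ hk.ne' h0]
  have hneg (f : Plane → ℝ) (i) : edgeIntegral θ l v (fun x => -f x) i = -edgeIntegral θ l v f i :=
    intervalIntegral.integral_neg
  have hsub (ψ ψ' : ℝ) (i) : edgeIntegral θ l v
      (fun x => outerNormal ψ (φ x) - outerNormal ψ' (φ x)) i =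
      edgeIntegral θ l v (fun x => outerNormal ψ (φ x)) i -
      edgeIntegral θ l v (fun x => outerNormal ψ' (φ x)) i := by
    have hi (ψ : ℝ) : IntervalIntegrable
        (fun s : ℝ => outerNormal ψ (φ (v i + s • unitVec (hexAngle θ i)))) volume 0 (l i) := by
      refine Continuous.intervalIntegrable ?_ _ _
      have := (hc ψ).continuous
      fun_prop
    exact intervalIntegral.integral_sub (hi ψ) (hi ψ')
  rw [Fin.sum_univ_six, n2, n3, n4, n5]
  simp only [sub_apply, neg_apply, hneg, hsub]
  ring

/-- By the divergence theorem, since a field of norm at most 1 has normal component at most 1. -/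
theorem IsHexagonWith.caccioppoliPerimeter_le (h : IsHexagonWith θ l v) :
    caccioppoliPerimeter (hexagonRegion v) ≤ ENNReal.ofReal (∑ i, l i) := by
  refine iSup_le fun φ => iSup_le fun h1 => iSup_le fun h2 => iSup_le fun h3 => ?_
  refine ENNReal.ofReal_le_ofReal ?_
  rw [h.setIntegral_divergence h1]
  refine Finset.sum_le_sum fun i _ => ?_
  have := intervalIntegral.norm_integral_le_of_norm_le_const (a := 0) (b := l i) (C := 1)
    (f := fun s => outerNormal (hexAngle θ i) (φ (v i + s • unitVec (hexAngle θ i))))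
    fun s _ => (abs_outerNormal_le _ _).trans (h3 _)
  rw [sub_zero, abs_of_pos (h.1 i), one_mul] at this
  exact (le_abs_self _).trans this

theorem IsHexagonWith.volume_hexagonRegion (h : IsHexagonWith θ l v) :
    volume (hexagonRegion v) = ENNReal.ofReal
      (√3 / 2 * (l 0 * (l 1 + l 2) - l 2 ^ 2 / 2 + l 5 * l 4 + l 5 ^ 2 / 2)) := by
  have hk : (0 : ℝ) < √3 / 2 := by positivity
  have hne : volume (hexagonRegion v) ≠ ∞ := (isCompact_hexagonRegion v).measure_lt_top.ne
  rw [← ENNReal.ofReal_toReal hne]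
  congr 1
  -- The area is the integral of a constant, realized as the derivative of the linear function
  -- `outerNormal (hexAngle θ 1)` so that the boundary formula applies.
  have hmul : (√3 / 2) * (volume (hexagonRegion v)).toReal =
      ∫ x in hexagonRegion v, fderiv ℝ (outerNormal (hexAngle θ 1)) x (unitVec (hexAngle θ 0)) := by
    simp only [ContinuousLinearMap.fderiv, outerNormal_one_zero]
    rw [setIntegral_const, smul_eq_mul, mul_comm]; rfl
  rw [h.setIntegral_fderiv_zero (outerNormal _).contDiff] at hmul
  rw [mul_left_cancel₀ hk.ne' hmul]
  obtain ⟨w0, w1, w2, w3, w4, w5, e1, e2⟩ := h.vertex_eq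
  have hN (α β : ℝ) : outerNormal (hexAngle θ 1) (oblique θ (v 0) α β) =
      outerNormal (hexAngle θ 1) (v 0) + √3 / 2 * α := by
    simp only [oblique, map_add, map_smul, outerNormal_one_zero, outerNormal_one_one, smul_eq_mul]
    ring
  obtain ⟨E1, E2, E4, E5⟩ := h.edgeIntegral_eq (outerNormal (hexAngle θ 1))
  rw [E1, E2, E4, E5]
  simp only [hN]
  have lin (c m a b : ℝ) : ∫ β in a..b, (c + √3 / 2 * (m - β)) =
      (c + √3 / 2 * m) * (b - a) - √3 / 2 * ((b ^ 2 - a ^ 2) / 2) := by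
    have : (fun β : ℝ => c + √3 / 2 * (m - β)) = fun β => (c + √3 / 2 * m) - √3 / 2 * β := by
      ext β; ring
    rw [this, intervalIntegral.integral_sub (by simp)
      (Continuous.intervalIntegrable (by fun_prop) _ _), intervalIntegral.integral_const_mul, integral_id,
      intervalIntegral.integral_const, smul_eq_mul]
    ring
  have lin0 (c a b : ℝ) : ∫ β in a..b, (c + √3 / 2 * (-β)) =
      c * (b - a) - √3 / 2 * ((b ^ 2 - a ^ 2) / 2) := by
    simpa using lin c 0 a b
  rw [lin, lin0]
  simp only [intervalIntegral.integral_const, smul_eq_mul]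
  rw [e2]
  have e2' : l 1 = l 4 + l 5 - l 2 := by linarith
  rw [e2']
  ring

end gauss

/-! ### The lower bound for the perimeter, by test fields. -/

/-- Pairwise disjoint compact sets can be separated by smooth compactly supported functions with
values in `[0, 1]`, at most one of which is different from zero at each point. -/
theorem exists_contDiff_separating {κ : Type*} [Finite κ] {K : κ → Set Plane}
    (hK : ∀ i, IsCompact (K i)) (hne : ∀ i, (K i).Nonempty)
    (hd : ∀ i j, i ≠ j → Disjoint (K i) (K j)) :
    ∃ f : κ → Plane → ℝ, (∀ i, ContDiff ℝ 1 (f i)) ∧ (∀ i, HasCompactSupport (f i)) ∧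
      (∀ i x, f i x ∈ Icc (0 : ℝ) 1) ∧ (∀ i, ∀ x ∈ K i, f i x = 1) ∧
      ∀ i j x, i ≠ j → f i x ≠ 0 → f j x = 0 := by
  have step (i : κ) : ∃ f : Plane → ℝ, ContDiff ℝ 1 f ∧ HasCompactSupport f ∧
      (∀ x, f x ∈ Icc (0 : ℝ) 1) ∧ (∀ x ∈ K i, f x = 1) ∧
      ∀ j x, j ≠ i → Metric.infDist x (K j) ≤ Metric.infDist x (K i) → f x = 0 := by
    obtain ⟨r, hr⟩ := (hK i).isBounded.subset_ball 0
    -- The zero set prescribed for the `i`-th function: the complement of a ball, for compact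
    -- support, and the points at least as close to some other `K j` as to `K i`. Of two different
    -- functions, one thus vanishes at any given point.
    set s : Set Plane := (Metric.ball 0 r)ᶜ ∪
      ⋃ j, ⋃ (_ : j ≠ i), {x | Metric.infDist x (K j) ≤ Metric.infDist x (K i)} with hs
    have hsc : IsClosed s := by
      refine Metric.isOpen_ball.isClosed_compl.union (isClosed_iUnion_of_finite fun j =>
        isClosed_iUnion_of_finite fun _ => ?_)
      exact isClosed_le (Metric.continuous_infDist_pt _) (Metric.continuous_infDist_pt _)
    have hdis : Disjoint s (K i) := by
      rw [Set.disjoint_left]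
      rintro x (hx | hx) hxi
      · exact hx (hr hxi)
      · simp only [mem_iUnion] at hx
        obtain ⟨j, hj, hx⟩ := hx
        have h1 : Metric.infDist x (K j) ≤ Metric.infDist x (K i) := hx
        rw [Metric.infDist_zero_of_mem hxi] at h1
        have h2 := ((hK j).isClosed.mem_iff_infDist_zero (hne j)).2
          (le_antisymm h1 Metric.infDist_nonneg)
        exact Set.disjoint_left.1 (hd j i hj) h2 hxi
    obtain ⟨f, f0, f1, f2⟩ := exists_contMDiffMap_zero_one_of_isClosed (n := 1)
      (modelWithCornersSelf ℝ Plane) hsc (hK i).isClosed hdis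
    refine ⟨f, contMDiff_iff_contDiff.1 f.contMDiff, ?_, f2, fun x hx => f1 hx, ?_⟩
    · refine HasCompactSupport.intro (isCompact_closedBall (0 : Plane) r) fun x hx => f0 (Or.inl ?_)
      exact fun hx' => hx (Metric.ball_subset_closedBall hx')
    · intro j x hj hx
      refine f0 (Or.inr ?_)
      simp only [mem_iUnion]
      exact ⟨j, hj, hx⟩
  choose f h1 h2 h3 h4 h5 using step
  refine ⟨f, h1, h2, h3, h4, fun i j x hij hx => ?_⟩
  rcases le_total (Metric.infDist x (K i)) (Metric.infDist x (K j)) with h | h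
  · exact h5 j i x hij h
  · exact absurd (h5 i j x hij.symm h) hx

section lower

variable {θ : ℝ} {l : Fin 6 → ℝ} {v : Fin 6 → Plane}

/-- The test field equals the outer unit normal on each edge shortened by `δ` at both ends. The
middle part contributes `l i - 2δ` and each end at least `-δ`, hence the loss `4δ`. -/
theorem IsHexagonWith.le_caccioppoliPerimeter_aux (h : IsHexagonWith θ l v) {δ : ℝ}
    (hδ : 0 < δ) (hl : ∀ i, δ < l i / 2) :
    ENNReal.ofReal (∑ i, (l i - 4 * δ)) ≤ caccioppoliPerimeter (hexagonRegion v) := by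
  set e : Fin 6 → ℝ → Plane := fun i s => v i + s • unitVec (hexAngle θ i) with he
  have hec (i) : Continuous (e i) := by simp only [he]; fun_prop
  obtain ⟨f, f1, f2, f3, f4, f5⟩ := exists_contDiff_separating
    (K := fun i => e i '' Icc δ (l i - δ))
    (fun i => isCompact_Icc.image (hec i))
    (fun i => (nonempty_Icc.2 (by linarith [hl i])).image _)
    (by
      intro i j hij
      rw [Set.disjoint_left]
      rintro _ ⟨s, hs, rfl⟩ ⟨t, ht, hst⟩
      have := h.outerNormal_edge_lt (i := i) (j := j) (t := s) (by linarith [hs.1])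
        (by linarith [hs.2]) hij.symm
      have hst' : v j + t • unitVec (hexAngle θ j) = v i + s • unitVec (hexAngle θ i) := hst
      rw [← hst', outerNormal_edge_self] at this
      exact lt_irrefl _ this)
  set φ : Plane → Plane := fun x => ∑ i, f i x • unitVec (hexAngle θ i - Real.pi / 2) with hφ
  have hφ1 : ContDiff ℝ 1 φ := ContDiff.sum fun i _ => (f1 i).smul contDiff_const
  have single (i : Fin 6) (x : Plane) (hx : f i x ≠ 0) :
      φ x = f i x • unitVec (hexAngle θ i - Real.pi / 2) := by
    refine Finset.sum_eq_single i (fun j _ hj => ?_) (by simp)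
    rw [f5 i j x hj.symm hx, zero_smul]
  have hφ2 : HasCompactSupport φ := by
    refine HasCompactSupport.intro (isCompact_iUnion fun i => f2 i) (fun x hx => ?_)
    refine Finset.sum_eq_zero fun i _ => ?_
    have : x ∉ tsupport (f i) := fun hh => hx (mem_iUnion.2 ⟨i, hh⟩)
    rw [image_eq_zero_of_notMem_tsupport this, zero_smul]
  have hφ3 : ∀ x, ‖φ x‖ ≤ 1 := by
    intro x
    by_cases hx : ∃ i, f i x ≠ 0
    · obtain ⟨i, hi⟩ := hx
      rw [single i x hi, norm_smul, norm_unitVec, mul_one, Real.norm_eq_abs,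
        abs_of_nonneg (f3 i x).1]
      exact (f3 i x).2
    · push Not at hx
      simp [hφ, hx]
  refine le_trans ?_ (le_iSup₂_of_le φ hφ1 (le_iSup₂_of_le hφ2 hφ3 le_rfl))
  refine ENNReal.ofReal_le_ofReal ?_
  rw [h.setIntegral_divergence hφ1]
  refine Finset.sum_le_sum fun i _ => ?_
  have hli := hl i
  have hc : Continuous fun s => outerNormal (hexAngle θ i) (φ (e i s)) :=
    (outerNormal _).continuous.comp (hφ1.continuous.comp (hec i))
  have hint (a b : ℝ) : IntervalIntegrable (fun s => outerNormal (hexAngle θ i) (φ (e i s)))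
    volume a b := hc.intervalIntegrable _ _
  have lower (a b : ℝ) (hab : a ≤ b) :
      -(b - a) ≤ ∫ s in a..b, outerNormal (hexAngle θ i) (φ (e i s)) := by
    have := intervalIntegral.norm_integral_le_of_norm_le_const (a := a) (b := b) (C := 1)
      (f := fun s => outerNormal (hexAngle θ i) (φ (e i s)))
      fun s _ => (abs_outerNormal_le _ _).trans (hφ3 _)
    rw [abs_of_nonneg (sub_nonneg.2 hab), one_mul] at this
    exact (abs_le.1 this).1
  have mid : ∫ s in δ..(l i - δ), outerNormal (hexAngle θ i) (φ (e i s)) = l i - 2 * δ := by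
    have : ∫ s in δ..(l i - δ), outerNormal (hexAngle θ i) (φ (e i s)) =
        ∫ s in δ..(l i - δ), (1 : ℝ) := by
      refine intervalIntegral.integral_congr fun s hs => ?_
      rw [uIcc_of_le (by linarith)] at hs
      have h1 := f4 i (e i s) (mem_image_of_mem _ hs)
      have h2 := single i (e i s) (by rw [h1]; exact one_ne_zero)
      simp only [h2, h1, one_smul, outerNormal_unitVec, sub_sub_cancel, Real.sin_pi_div_two]
    rw [this, intervalIntegral.integral_const, smul_eq_mul]; ring
  have split : edgeIntegral θ l v (fun x => outerNormal (hexAngle θ i) (φ x)) i =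
      (∫ s in (0)..δ, outerNormal (hexAngle θ i) (φ (e i s))) +
      (∫ s in δ..(l i - δ), outerNormal (hexAngle θ i) (φ (e i s))) +
      ∫ s in (l i - δ)..(l i), outerNormal (hexAngle θ i) (φ (e i s)) := by
    rw [intervalIntegral.integral_add_adjacent_intervals (hint _ _) (hint _ _),
      intervalIntegral.integral_add_adjacent_intervals (hint _ _) (hint _ _)]
    rfl
  rw [split, mid]
  have b1 := lower 0 δ hδ.le
  have b2 := lower (l i - δ) (l i) (by linarith)
  linarith

/-- The perimeter of an equiangular hexagon is the sum of its side lengths. -/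
theorem IsHexagonWith.caccioppoliPerimeter_eq (h : IsHexagonWith θ l v) :
    caccioppoliPerimeter (hexagonRegion v) = ENNReal.ofReal (∑ i, l i) := by
  refine le_antisymm h.caccioppoliPerimeter_le ?_
  have hc : Continuous fun δ : ℝ => ENNReal.ofReal (∑ i, (l i - 4 * δ)) :=
    ENNReal.continuous_ofReal.comp (by fun_prop)
  have ht : Filter.Tendsto (fun δ : ℝ => ENNReal.ofReal (∑ i, (l i - 4 * δ)))
      (nhdsWithin 0 (Ioi 0)) (nhds (ENNReal.ofReal (∑ i, l i))) := by
    have := hc.tendsto 0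
    simp only [mul_zero, sub_zero] at this
    exact this.mono_left nhdsWithin_le_nhds
  refine le_of_tendsto ht ?_
  have h1 : ∀ᶠ δ in nhdsWithin (0 : ℝ) (Ioi 0), ∀ i, δ < l i / 2 :=
    Filter.eventually_all.2 fun i => nhdsWithin_le_nhds (eventually_lt_nhds (half_pos (h.1 i)))
  filter_upwards [h1, self_mem_nhdsWithin] with δ hδ h0
  exact h.le_caccioppoliPerimeter_aux h0 hδ

end lower

theorem caccioppoliPerimeter_congr {E F : Set Plane} (h : E =ᵐ[volume] F) :
    caccioppoliPerimeter E = caccioppoliPerimeter F := by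
  unfold caccioppoliPerimeter
  simp only [setIntegral_congr_set h]

/-! ### Standard tilings by two centrally symmetric hexagons. -/

instance vaddInvariantMeasure_submodule (L : Submodule ℤ Plane) :
    VAddInvariantMeasure L Plane (volume : Measure Plane) :=
  ⟨fun g s _ => measure_preimage_add volume (g : Plane) s⟩

/-- A set of the same measure as a fundamental domain, with almost disjoint translates, is a
fundamental domain. -/
theorem isAddFundamentalDomain_of_volume_eq {L : Submodule ℤ Plane} [Countable L]
    {F D : Set Plane} (hF : IsAddFundamentalDomain L F volume) (hFfin : volume F ≠ ∞)
    (hD : NullMeasurableSet D volume)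
    (hdis : Pairwise (Function.onFun (AEDisjoint volume) fun g : L => g +ᵥ D))
    (hvol : volume D = volume F) : IsAddFundamentalDomain L D volume := by
  refine ⟨hD, ?_, hdis⟩
  have hDg : ∀ g : L, NullMeasurableSet (g +ᵥ D) volume := fun g => hD.vadd g
  set U : Set Plane := ⋃ g : L, g +ᵥ D with hU
  -- Cutting `D` along the translates of `F` and moving the pieces into `F` preserves measure; the
  -- pieces are almost disjoint and so fill `F`.
  have hFU : volume (U ∩ F) = volume F := by
    rw [hU, iUnion_inter, measure_iUnion₀, ← hvol, hF.measure_eq_tsum]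
    · exact fun g g' hg => (hdis hg).mono inter_subset_left inter_subset_left
    · exact fun g => (hDg g).inter hF.nullMeasurableSet
  have hUF : (U ∩ F : Set Plane) =ᵐ[volume] F :=
    ae_eq_of_subset_of_measure_ge inter_subset_right hFU.ge
      ((NullMeasurableSet.iUnion hDg).inter hF.nullMeasurableSet) hFfin
  have hsub : ∀ᵐ x : Plane, x ∈ F → x ∈ U := by
    filter_upwards [hUF.mem_iff] with x hx hxF using (hx.2 hxF).1
  have hall : ∀ᵐ x : Plane, ∀ g : L, g +ᵥ x ∈ F → g +ᵥ x ∈ U :=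
    ae_all_iff.2 fun g => (measurePreserving_vadd g volume).quasiMeasurePreserving.ae hsub
  filter_upwards [hall, hF.ae_covers] with x hx ⟨g, hg⟩
  obtain ⟨g', hg'⟩ := mem_iUnion.1 (hx g hg)
  refine ⟨-g' + g, ?_⟩
  rw [mem_vadd_set_iff_neg_vadd_mem] at hg'
  rwa [add_vadd]

theorem volume_outerNormal_eq (φ c : ℝ) : volume {x : Plane | outerNormal φ x = c} = 0 := by
  have h := (measurePreserving_add_right (volume : Measure Plane)
    (-(c • unitVec (φ - Real.pi / 2)))).quasiMeasurePreserving.ae (ae_outerNormal_ne_zero φ)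
  rw [ae_iff] at h
  convert h using 3
  ext x
  simp [outerNormal_unitVec, ← sub_eq_add_neg, sub_eq_zero]

/-- The vertices of the centrally symmetric equiangular hexagon with side lengths `a, b, c`. -/
noncomputable def symHexagon (θ : ℝ) (p : Plane) (a b c : ℝ) : Fin 6 → Plane :=
  ![oblique θ p 0 0, oblique θ p a 0, oblique θ p a b, oblique θ p (a - c) (b + c),
    oblique θ p (-c) (b + c), oblique θ p (-c) c]

theorem symHexagon_zero (θ : ℝ) (p : Plane) (a b c : ℝ) : symHexagon θ p a b c 0 = p := by
  simp [symHexagon, oblique]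

theorem isHexagonWith_symHexagon (θ : ℝ) (p : Plane) {a b c : ℝ} (ha : 0 < a) (hb : 0 < b)
    (hc : 0 < c) : IsHexagonWith θ ![a, b, c, a, b, c] (symHexagon θ p a b c) := by
  obtain ⟨u2, u3, u4, u5⟩ := hexAngle_succ_cases unitVec_add_two_thirds θ
  have q2 : (1 + 1 : Fin 6) = 2 := rfl
  have q3 : (2 + 1 : Fin 6) = 3 := rfl
  have q4 : (3 + 1 : Fin 6) = 4 := rfl
  have q5 : (4 + 1 : Fin 6) = 5 := rfl
  have q6 : (5 + 1 : Fin 6) = 0 := rfl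
  constructor
  · intro i; fin_cases i <;> simp [ha, hb, hc]
  · intro i
    fin_cases i <;> simp only [Fin.zero_eta, Fin.mk_one, Fin.reduceFinMk, zero_add, q2, q3, q4, q5,
      q6, u2, u3, u4, u5] <;> simp only [symHexagon, oblique, Matrix.cons_val] <;> module

/-- One pair of equal opposite sides suffices: the closing relations then give `l 5 = l 2` and `l 4
= l 1`. -/
theorem IsHexagonWith.eq_symHexagon {θ : ℝ} {l : Fin 6 → ℝ} {v : Fin 6 → Plane}
    (h : IsHexagonWith θ l v) (h3 : l 3 = l 0) : v = symHexagon θ (v 0) (l 0) (l 1) (l 2) := by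
  obtain ⟨w0, w1, w2, w3, w4, w5, e1, e2⟩ := h.vertex_eq
  have h5 : l 5 = l 2 := by linarith
  have h4 : l 4 = l 1 := by linarith
  rw [h5] at w4 w5
  rw [h4] at w4
  ext i : 1
  fin_cases i
  · exact w0
  · exact w1
  · exact w2
  · exact w3
  · exact w4
  · exact w5

section sym

variable {θ : ℝ} {p : Plane} {a a' b c : ℝ}

theorem oblique_oblique (θ : ℝ) (p : Plane) (x y α β : ℝ) :
    oblique θ (oblique θ p x y) α β = oblique θ p (x + α) (y + β) := by
  simp only [oblique]; module

theorem oblique_add (θ : ℝ) (p : Plane) (x y α β : ℝ) :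
    oblique θ 0 x y + oblique θ p α β = oblique θ p (x + α) (y + β) := by
  simp only [oblique]; module

theorem symHexagon_vadd (θ : ℝ) (g p : Plane) (a b c : ℝ) :
    (fun i => g + symHexagon θ p a b c i) = symHexagon θ (g + p) a b c := by
  ext i : 1
  fin_cases i <;> simp [symHexagon, oblique, add_assoc]

theorem hexagonRegion_symHexagon_vadd (θ : ℝ) (g p : Plane) (a b c : ℝ) :
    g +ᵥ hexagonRegion (symHexagon θ p a b c) = hexagonRegion (symHexagon θ (g + p) a b c) := by
  rw [← hexagonRegion_vadd, symHexagon_vadd]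

theorem oblique_mem_symHexagon_iff (ha : 0 < a) (hb : 0 < b) (hc : 0 < c) (x y α β : ℝ) :
    oblique θ p α β ∈ hexagonRegion (symHexagon θ (oblique θ p x y) a b c) ↔
      y ≤ β ∧ α - x ≤ a ∧ (α - x) + (β - y) ≤ a + b ∧ β - y ≤ b + c ∧ -c ≤ α - x ∧
      0 ≤ (α - x) + (β - y) := by
  have h := (isHexagonWith_symHexagon θ (oblique θ p x y) ha hb hc).oblique_mem_iff
    (α - x) (β - y)
  rw [symHexagon_zero, oblique_oblique, add_sub_cancel, add_sub_cancel] at h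
  rw [h]
  simp

theorem volume_symHexagon (ha : 0 < a) (hb : 0 < b) (hc : 0 < c) :
    volume (hexagonRegion (symHexagon θ p a b c)) =
      ENNReal.ofReal (√3 / 2 * (a * (b + c) + b * c)) := by
  rw [(isHexagonWith_symHexagon θ p ha hb hc).volume_hexagonRegion]
  congr 1
  simp
  ring

theorem caccioppoliPerimeter_symHexagon (ha : 0 < a) (hb : 0 < b) (hc : 0 < c) :
    caccioppoliPerimeter (hexagonRegion (symHexagon θ p a b c)) =
      ENNReal.ofReal (2 * (a + b + c)) := by
  rw [(isHexagonWith_symHexagon θ p ha hb hc).caccioppoliPerimeter_eq]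
  congr 1
  simp [Fin.sum_univ_six]
  ring

/-- In each of the six alternatives, a line parallel to one of the three edge directions separates
the hexagons, so they meet inside a null line. -/
theorem aedisjoint_symHexagon (ha : 0 < a) (ha' : 0 < a') (hb : 0 < b) (hc : 0 < c) {x y : ℝ}
    (h : b + c ≤ y ∨ y ≤ -(b + c) ∨ a + c ≤ x ∨ x ≤ -(a' + c) ∨ a + b ≤ x + y ∨
      x + y ≤ -(a' + b)) :
    AEDisjoint volume (hexagonRegion (symHexagon θ p a b c))
      (hexagonRegion (symHexagon θ (oblique θ p x y) a' b c)) := by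
  have hN (α β : ℝ) : outerNormal (hexAngle θ 0) (oblique θ p α β) =
      outerNormal (hexAngle θ 0) p - √3 / 2 * β ∧
      outerNormal (hexAngle θ 1) (oblique θ p α β) =
      outerNormal (hexAngle θ 1) p + √3 / 2 * α ∧ outerNormal (hexAngle θ 2) (oblique θ p α β) =
      outerNormal (hexAngle θ 2) p + √3 / 2 * (α + β) := by
    rw [(hexAngle_succ_cases outerNormal_add_two_thirds θ).1]
    simp only [oblique, map_add, map_smul, outerNormal_one_zero, outerNormal_one_one, smul_eq_mul,
      outerNormal_zero_zero, outerNormal_zero_one, sub_apply]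
    refine ⟨by ring, by ring, by ring⟩
  have key : ∃ φ z, ∀ α β, oblique θ p α β ∈ hexagonRegion (symHexagon θ (oblique θ p 0 0) a b c) →
      oblique θ p α β ∈ hexagonRegion (symHexagon θ (oblique θ p x y) a' b c) →
      outerNormal φ (oblique θ p α β) = z := by
    simp only [oblique_mem_symHexagon_iff ha hb hc, oblique_mem_symHexagon_iff ha' hb hc]
    rcases h with h | h | h | h | h | h
    · refine ⟨hexAngle θ 0, outerNormal (hexAngle θ 0) p - √3 / 2 * (b + c), ?_⟩
      rintro α β ⟨a1, a2, a3, a4, a5, a6⟩ ⟨b1, b2, b3, b4, b5, b6⟩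
      rw [(hN α β).1]; congr 2; linarith
    · refine ⟨hexAngle θ 0, outerNormal (hexAngle θ 0) p - √3 / 2 * 0, ?_⟩
      rintro α β ⟨a1, a2, a3, a4, a5, a6⟩ ⟨b1, b2, b3, b4, b5, b6⟩
      rw [(hN α β).1]; congr 2; linarith
    · refine ⟨hexAngle θ 1, outerNormal (hexAngle θ 1) p + √3 / 2 * a, ?_⟩
      rintro α β ⟨a1, a2, a3, a4, a5, a6⟩ ⟨b1, b2, b3, b4, b5, b6⟩
      rw [(hN α β).2.1]; congr 2; linarith
    · refine ⟨hexAngle θ 1, outerNormal (hexAngle θ 1) p + √3 / 2 * (-c), ?_⟩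
      rintro α β ⟨a1, a2, a3, a4, a5, a6⟩ ⟨b1, b2, b3, b4, b5, b6⟩
      rw [(hN α β).2.1]; congr 2; linarith
    · refine ⟨hexAngle θ 2, outerNormal (hexAngle θ 2) p + √3 / 2 * (a + b), ?_⟩
      rintro α β ⟨a1, a2, a3, a4, a5, a6⟩ ⟨b1, b2, b3, b4, b5, b6⟩
      rw [(hN α β).2.2]; congr 2; linarith
    · refine ⟨hexAngle θ 2, outerNormal (hexAngle θ 2) p + √3 / 2 * 0, ?_⟩
      rintro α β ⟨a1, a2, a3, a4, a5, a6⟩ ⟨b1, b2, b3, b4, b5, b6⟩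
      rw [(hN α β).2.2]; congr 2; linarith
  have hp : oblique θ p 0 0 = p := by simp [oblique]
  rw [hp] at key
  obtain ⟨φ, z, H⟩ := key
  refine measure_mono_null ?_ (volume_outerNormal_eq φ z)
  rintro w ⟨h1, h2⟩
  obtain ⟨α, β, rfl⟩ := exists_eq_oblique θ p w
  exact H α β h1 h2

end sym

section lattice

variable {θ A a₁ a₂ b c : ℝ}

/-- Generators of the lattice of a tiling by two centrally symmetric hexagons with side lengths
`a₁, b, c` and `a₂, b, c`, where `A = a₁ + a₂`. -/
noncomputable def hexVector (θ A b c : ℝ) : Fin 2 → Plane :=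
  -- The first vector carries edge `0` of either hexagon to its edge `3`. The second crosses one
  -- hexagon of each kind: `(a₁ + c, -c) + (a₂ + c, -c)`.
  ![oblique θ 0 (-c) (b + c), oblique θ 0 (A + 2 * c) (-(2 * c))]

/-- The lattice of a tiling by two centrally symmetric hexagons with side lengths
`a₁, b, c` and `a₂, b, c`, where `A = a₁ + a₂`. -/
noncomputable def hexLattice (θ A b c : ℝ) : Submodule ℤ Plane :=
  Submodule.span ℤ (range (hexVector θ A b c))

theorem linearIndependent_hexVector (θ : ℝ) (hA : 0 < A) (hb : 0 < b) (hc : 0 < c) :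
    LinearIndependent ℝ (hexVector θ A b c) := by
  refine LinearIndependent.pair_iff.2 fun s t h => ?_
  have h' : oblique θ 0 (s * (-c) + t * (A + 2 * c)) (s * (b + c) + t * (-(2 * c))) =
      oblique θ 0 0 0 := by
    have e : oblique θ 0 0 0 = 0 := by simp [oblique]
    refine Eq.trans ?_ (h.trans e.symm)
    simp only [oblique]; module
  obtain ⟨h1, h2⟩ := oblique_inj h'
  have hdet : 0 < A * (b + c) + 2 * (b * c) := by positivity
  have ht : t * (A * (b + c) + 2 * (b * c)) = 0 := by linear_combination (b + c) * h1 + c * h2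
  have ht0 : t = 0 := by simpa [hdet.ne'] using ht
  rw [ht0] at h1
  have : s * c = 0 := by linarith
  exact ⟨by simpa [hc.ne'] using this, ht0⟩

/-- The generators of `hexLattice` as a basis of the plane. -/
noncomputable def hexBasis (θ : ℝ) (hA : 0 < A) (hb : 0 < b) (hc : 0 < c) :
    Module.Basis (Fin 2) ℝ Plane :=
  basisOfLinearIndependentOfCardEqFinrank (linearIndependent_hexVector θ hA hb hc) (by simp)

theorem coe_hexBasis (θ : ℝ) (hA : 0 < A) (hb : 0 < b) (hc : 0 < c) :
    ⇑(hexBasis θ hA hb hc) = hexVector θ A b c :=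
  coe_basisOfLinearIndependentOfCardEqFinrank _ _

theorem hexLattice_eq_span (θ : ℝ) (hA : 0 < A) (hb : 0 < b) (hc : 0 < c) :
    hexLattice θ A b c = Submodule.span ℤ (range (hexBasis θ hA hb hc)) := by
  rw [coe_hexBasis]; rfl

theorem discreteTopology_hexLattice (θ : ℝ) (hA : 0 < A) (hb : 0 < b) (hc : 0 < c) :
    DiscreteTopology (hexLattice θ A b c) := by
  rw [hexLattice_eq_span θ hA hb hc]; infer_instance

theorem isZLattice_hexLattice (θ : ℝ) (hA : 0 < A) (hb : 0 < b) (hc : 0 < c)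
    [DiscreteTopology (hexLattice θ A b c)] :
    IsZLattice ℝ (hexLattice θ A b c) := by
  refine ⟨?_⟩
  rw [hexLattice_eq_span θ hA hb hc]
  exact ZSpan.span_top _

theorem mem_hexLattice_iff {x : Plane} : x ∈ hexLattice θ A b c ↔ ∃ m n : ℤ,
    x = oblique θ 0 (-(m * c) + n * (A + 2 * c)) (m * (b + c) - n * (2 * c)) := by
  have hr : range (hexVector θ A b c) = {hexVector θ A b c 0, hexVector θ A b c 1} := by
    ext x; simp [eq_comm]
  rw [hexLattice, hr, Submodule.mem_span_pair]
  refine exists_congr fun m => exists_congr fun n => ?_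
  have : m • hexVector θ A b c 0 + n • hexVector θ A b c 1 =
      oblique θ 0 (-(m * c) + n * (A + 2 * c)) (m * (b + c) - n * (2 * c)) := by
    simp only [hexVector, oblique, Matrix.cons_val, ← Int.cast_smul_eq_zsmul ℝ]; module
  rw [this, eq_comm]

/-- This covolume is the sum of the areas of the two hexagons when `A = a₁ + a₂`. -/
theorem volume_fundamentalDomain_hexBasis (θ : ℝ) (hA : 0 < A) (hb : 0 < b) (hc : 0 < c) :
    volume (ZSpan.fundamentalDomain (hexBasis θ hA hb hc)) =
      ENNReal.ofReal (√3 / 2 * (A * (b + c) + 2 * (b * c))) := by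
  rw [ZSpan.measure_fundamentalDomain _ _ (EuclideanSpace.basisFun (Fin 2) ℝ).toBasis,
    measure_congr (ZSpan.fundamentalDomain_ae_parallelepiped _ volume),
    OrthonormalBasis.coe_toBasis, OrthonormalBasis.volume_parallelepiped, mul_one]
  congr 1
  rw [Module.Basis.det_apply, Matrix.det_fin_two]
  have e (i j) : (EuclideanSpace.basisFun (Fin 2) ℝ).toBasis.toMatrix (hexBasis θ hA hb hc) i j =
      hexVector θ A b c j i := by
    rw [Module.Basis.toMatrix_apply, coe_hexBasis]; simp
  simp only [e]
  have : hexVector θ A b c 0 0 * hexVector θ A b c 1 1 -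
      hexVector θ A b c 1 0 * hexVector θ A b c 0 1 =
      -(√3 / 2 * (A * (b + c) + 2 * (b * c))) := by
    simp [hexVector, oblique, hexAngle_zero, hexAngle_one, Real.cos_add, Real.sin_add]
    linear_combination (-(√3 / 2 * (A * (b + c) + 2 * (b * c)))) * Real.sin_sq_add_cos_sq θ
  rw [this, abs_neg, abs_of_pos (by positivity)]

/-- The two hexagons that generate the standard tiling. -/
noncomputable def hexPair (θ : ℝ) (p : Plane) (a₁ a₂ b c : ℝ) : Fin 2 → Fin 6 → Plane :=
  ![symHexagon θ p a₁ b c, symHexagon θ (oblique θ p (a₁ + c) (-c)) a₂ b c]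

theorem aedisjoint_hexPair_self {a : ℝ} (ha : 0 < a) (haA : a ≤ A) (hb : 0 < b)
    (hc : 0 < c) {θ : ℝ} (p : Plane) {g : Plane} (hg : g ∈ hexLattice θ A b c) (hg0 : g ≠ 0) :
    AEDisjoint volume (hexagonRegion (symHexagon θ p a b c))
      (g +ᵥ hexagonRegion (symHexagon θ p a b c)) := by
  obtain ⟨m, n, rfl⟩ := mem_hexLattice_iff.1 hg
  have hp : p = oblique θ p 0 0 := by simp [oblique]
  have e : oblique θ 0 (-(m * c) + n * (A + 2 * c)) (m * (b + c) - n * (2 * c)) + p =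
      oblique θ p (-(m * c) + n * (A + 2 * c)) (m * (b + c) - n * (2 * c)) := by
    conv_lhs => rw [hp]
    rw [oblique_add]; simp
  rw [hexagonRegion_symHexagon_vadd, e]
  refine aedisjoint_symHexagon ha ha hb hc ?_
  have cast (k : ℤ) (h : 0 ≤ k) : (0 : ℝ) ≤ k := by exact_mod_cast h
  -- The translation has coordinates `x = nA + (2n - m)c` and `x + y = nA + mb`. For `n ≠ 0`, the
  -- sign of `n` and the comparison of `m` with `2n` select the separating direction; for `n = 0` it
  -- is `y = m(b + c)`.
  rcases lt_trichotomy n 0 with hn | hn | hn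
  · have hn1 := mul_nonneg (cast (-1 - n) (by omega)) (ha.le.trans haA)
    rcases le_or_gt m (2 * n) with hm | hm
    · have h1 := mul_nonneg (cast (2 * n - m) (by omega)) hb.le
      have h2 := mul_nonneg (cast (-1 - n) (by omega)) hb.le
      push_cast at hn1 h1 h2
      iterate 5 right
      nlinarith
    · have h1 := mul_nonneg (cast (m - 2 * n - 1) (by omega)) hc.le
      push_cast at hn1 h1
      iterate 3 right
      left
      nlinarith
  · subst hn
    rcases lt_trichotomy m 0 with hm | hm | hm
    · have h1 := mul_nonneg (cast (-1 - m) (by omega)) (add_pos hb hc).le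
      push_cast at h1
      right; left
      push_cast
      nlinarith
    · subst hm
      exfalso
      simp [oblique] at hg0
    · have h1 := mul_nonneg (cast (m - 1) (by omega)) (add_pos hb hc).le
      push_cast at h1
      left
      push_cast
      nlinarith
  · have hn1 := mul_nonneg (cast (n - 1) (by omega)) (ha.le.trans haA)
    rcases le_or_gt (2 * n) m with hm | hm
    · have h1 := mul_nonneg (cast (m - 2 * n) (by omega)) hb.le
      have h2 := mul_nonneg (cast (n - 1) (by omega)) hb.le
      push_cast at hn1 h1 h2
      iterate 4 right
      left
      nlinarith
    · have h1 := mul_nonneg (cast (2 * n - 1 - m) (by omega)) hc.le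
      push_cast at hn1 h1
      iterate 2 right
      left
      nlinarith

theorem aedisjoint_hexPair_cross (h₁ : 0 < a₁) (h₂ : 0 < a₂) (hb : 0 < b)
    (hc : 0 < c) {θ : ℝ} (p : Plane) {g : Plane} (hg : g ∈ hexLattice θ (a₁ + a₂) b c) :
    AEDisjoint volume (hexagonRegion (symHexagon θ p a₁ b c))
      (g +ᵥ hexagonRegion (symHexagon θ (oblique θ p (a₁ + c) (-c)) a₂ b c)) := by
  obtain ⟨m, n, rfl⟩ := mem_hexLattice_iff.1 hg
  rw [hexagonRegion_symHexagon_vadd, oblique_add]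
  refine aedisjoint_symHexagon h₁ h₂ hb hc ?_
  have cast (k : ℤ) (h : 0 ≤ k) : (0 : ℝ) ≤ k := by exact_mod_cast h
  -- Here `x = a₁ + c + nA + (2n - m)c` and `x + y = a₁ + nA + mb`; since `A = a₁ + a₂`, negative
  -- `n` leaves `-a₂` in place of `a₁`.
  rcases lt_or_ge n 0 with hn | hn
  · have hn1 := mul_nonneg (cast (-1 - n) (by omega)) (add_pos h₁ h₂).le
    rcases le_or_gt m (2 * n + 1) with hm | hm
    · have h1 := mul_nonneg (cast (-1 - m) (by omega)) hb.le
      push_cast at hn1 h1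
      iterate 5 right
      nlinarith
    · have h1 := mul_nonneg (cast (m - 2 * n - 2) (by omega)) hc.le
      push_cast at hn1 h1
      iterate 3 right
      left
      nlinarith
  · have hn1 := mul_nonneg (cast n hn) (add_pos h₁ h₂).le
    rcases le_or_gt m (2 * n) with hm | hm
    · have h1 := mul_nonneg (cast (2 * n - m) (by omega)) hc.le
      push_cast at hn1 h1
      iterate 2 right
      left
      nlinarith
    · have h1 := mul_nonneg (cast (m - 1) (by omega)) hb.le
      push_cast at hn1 h1
      iterate 4 right
      left
      nlinarith

theorem aedisjoint_vadd_iff {g h : Plane} {S T : Set Plane} :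
    AEDisjoint volume (g +ᵥ S) (h +ᵥ T) ↔ AEDisjoint volume S ((h - g) +ᵥ T) := by
  have : (g +ᵥ S) ∩ (h +ᵥ T) = g +ᵥ (S ∩ ((h - g) +ᵥ T)) := by
    rw [vadd_set_inter, vadd_vadd, add_sub_cancel]
  rw [AEDisjoint, AEDisjoint, this, measure_vadd]

theorem aedisjoint_hexPair (h₁ : 0 < a₁) (h₂ : 0 < a₂) (hb : 0 < b) (hc : 0 < c) (θ : ℝ)
    (p : Plane) : Pairwise fun r s : Fin 2 × hexLattice θ (a₁ + a₂) b c =>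
      AEDisjoint volume ((r.2 : Plane) +ᵥ hexagonRegion (hexPair θ p a₁ a₂ b c r.1))
        ((s.2 : Plane) +ᵥ hexagonRegion (hexPair θ p a₁ a₂ b c s.1)) := by
  rintro ⟨k, g, hg⟩ ⟨k', g', hg'⟩ hne
  rcases Fin.exists_fin_two.1 ⟨k, rfl⟩ with rfl | rfl <;>
    rcases Fin.exists_fin_two.1 ⟨k', rfl⟩ with rfl | rfl
  · rw [aedisjoint_vadd_iff]
    refine aedisjoint_hexPair_self h₁ (by linarith) hb hc p (sub_mem hg' hg) (sub_ne_zero.2 ?_)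
    rintro rfl; exact hne rfl
  · rw [aedisjoint_vadd_iff]
    exact aedisjoint_hexPair_cross h₁ h₂ hb hc p (sub_mem hg' hg)
  · refine AEDisjoint.symm ?_
    rw [aedisjoint_vadd_iff]
    exact aedisjoint_hexPair_cross h₁ h₂ hb hc p (sub_mem hg hg')
  · rw [aedisjoint_vadd_iff]
    refine aedisjoint_hexPair_self h₂ (by linarith) hb hc _ (sub_mem hg' hg) (sub_ne_zero.2 ?_)
    rintro rfl; exact hne rfl

/-- Only disjointness needs geometry: covering follows because the total area equals the covolume.
-/
theorem isAddFundamentalDomain_hexPair (h₁ : 0 < a₁) (h₂ : 0 < a₂) (hb : 0 < b) (hc : 0 < c)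
    (θ : ℝ) (p : Plane) : IsAddFundamentalDomain (hexLattice θ (a₁ + a₂) b c)
      (hexagonRegion (hexPair θ p a₁ a₂ b c 0) ∪ hexagonRegion (hexPair θ p a₁ a₂ b c 1))
      volume := by
  have hA := add_pos h₁ h₂
  have hdis := aedisjoint_hexPair h₁ h₂ hb hc θ p
  have := discreteTopology_hexLattice θ hA hb hc
  have hF := ZSpan.isAddFundamentalDomain (hexBasis θ hA hb hc) volume
  rw [← hexLattice_eq_span] at hF
  have := isZLattice_hexLattice θ hA hb hc
  have hcount : Countable (hexLattice θ (a₁ + a₂) b c) := inferInstance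
  have hms (k : Fin 2) : MeasurableSet (hexagonRegion (hexPair θ p a₁ a₂ b c k)) :=
    (isCompact_hexagonRegion _).measurableSet
  have hd01 : AEDisjoint volume (hexagonRegion (hexPair θ p a₁ a₂ b c 0))
      (hexagonRegion (hexPair θ p a₁ a₂ b c 1)) := by
    have := hdis (i := (0, 0)) (j := (1, 0)) (by simp)
    simpa using this
  refine isAddFundamentalDomain_of_volume_eq hF ?_ ((hms 0).union (hms 1)).nullMeasurableSet
    (fun g g' hg => ?_) ?_
  · rw [volume_fundamentalDomain_hexBasis]; exact ENNReal.ofReal_ne_top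
  · have key (k k' : Fin 2) : AEDisjoint volume
        (g +ᵥ hexagonRegion (hexPair θ p a₁ a₂ b c k))
        (g' +ᵥ hexagonRegion (hexPair θ p a₁ a₂ b c k')) :=
      hdis (i := (k, g)) (j := (k', g')) fun hh => hg (Prod.ext_iff.1 hh).2
    simp only [Function.onFun, vadd_set_union]
    exact ((key 0 0).union_right (key 0 1)).union_left ((key 1 0).union_right (key 1 1))
  · rw [measure_union₀ (hms 1).nullMeasurableSet hd01, volume_fundamentalDomain_hexBasis]
    simp only [hexPair, Matrix.cons_val_zero, Matrix.cons_val_one]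
    rw [volume_symHexagon h₁ hb hc, volume_symHexagon h₂ hb hc,
      ← ENNReal.ofReal_add (by positivity) (by positivity)]
    congr 1; ring

theorem ae_cover_hexPair (h₁ : 0 < a₁) (h₂ : 0 < a₂) (hb : 0 < b) (hc : 0 < c)
    (θ : ℝ) (p : Plane) : ∀ᵐ x : Plane, ∃ (k : Fin 2) (g : hexLattice θ (a₁ + a₂) b c),
      x ∈ (g : Plane) +ᵥ hexagonRegion (hexPair θ p a₁ a₂ b c k) := by
  filter_upwards [(isAddFundamentalDomain_hexPair h₁ h₂ hb hc θ p).ae_covers] with x ⟨g, hg⟩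
  rcases hg with hg | hg
  · exact ⟨0, -g, by rw [mem_vadd_set_iff_neg_vadd_mem]; rw [← NegMemClass.coe_neg, neg_neg]; exact hg⟩
  · exact ⟨1, -g, by rw [mem_vadd_set_iff_neg_vadd_mem]; rw [← NegMemClass.coe_neg, neg_neg]; exact hg⟩

/-- The standard tiling by two centrally symmetric hexagons. -/
noncomputable def hexTiling (h₁ : 0 < a₁) (h₂ : 0 < a₂) (hb : 0 < b) (hc : 0 < c)
    (θ : ℝ) (p : Plane) : PeriodicTiling 2 where
  lattice := hexLattice θ (a₁ + a₂) b c
  discrete := discreteTopology_hexLattice θ (add_pos h₁ h₂) hb hc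
  isZLattice := by
    have := discreteTopology_hexLattice θ (add_pos h₁ h₂) hb hc
    exact isZLattice_hexLattice θ (add_pos h₁ h₂) hb hc
  tile k := hexagonRegion (hexPair θ p a₁ a₂ b c k)
  nullMeasurableSet_tile k := (isCompact_hexagonRegion _).measurableSet.nullMeasurableSet
  aedisjoint := aedisjoint_hexPair h₁ h₂ hb hc θ p
  ae_cover := ae_cover_hexPair h₁ h₂ hb hc θ p

end lattice

/-! ### Edges of a periodic hexagon tiling glued modulo the lattice. -/

theorem unitVec_hexAngle_inj {θ : ℝ} {i j : Fin 6}
    (h : unitVec (hexAngle θ i) = unitVec (hexAngle θ j)) : i = j := by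
  obtain ⟨k, rfl⟩ : ∃ k, i = k + j := ⟨i - j, by simp⟩
  have hs : (0 : ℝ) < √3 := by positivity
  rw [unitVec_hexAngle_add] at h
  generalize hexAngle θ j = φ at h
  obtain ⟨u2, u3, u4, u5⟩ := hexAngle_succ_cases unitVec_add_two_thirds φ
  have e := congrArg (outerNormal (hexAngle φ 0)) h
  have h' : unitVec φ = unitVec (hexAngle φ 0) := by rw [hexAngle_zero]
  rw [h', outerNormal_zero_zero] at e
  rw [h'] at h
  fin_cases k
  · simp
  · simp only [Fin.mk_one, outerNormal_zero_one] at e; linarith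
  · simp only [Fin.reduceFinMk, u2, map_sub, outerNormal_zero_one, outerNormal_zero_zero] at e
    linarith
  · simp only [Fin.reduceFinMk, u3] at h
    have := congrArg (outerNormal (hexAngle φ 1)) h
    rw [map_neg, outerNormal_one_zero] at this
    linarith
  · simp only [Fin.reduceFinMk, u4, map_neg, outerNormal_zero_one] at e; linarith
  · simp only [Fin.reduceFinMk, u5, map_sub, outerNormal_zero_one, outerNormal_zero_zero] at e
    linarith

theorem unitVec_hexAngle_opp (θ : ℝ) (i : Fin 6) :
    unitVec (hexAngle θ (i + 3)) = -unitVec (hexAngle θ i) := by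
  rw [add_comm, unitVec_hexAngle_add, (hexAngle_succ_cases unitVec_add_two_thirds _).2.1,
    hexAngle_zero]

theorem unitVec_hexAngle_congr {θ φ : ℝ} {n : Fin 6}
    (h : unitVec (hexAngle θ n) = unitVec (hexAngle φ n)) (i : Fin 6) :
    unitVec (hexAngle θ i) = unitVec (hexAngle φ i) := by
  have hc : Real.cos (hexAngle θ n) = Real.cos (hexAngle φ n) := by
    rw [← unitVec_zero_apply, h, unitVec_zero_apply]
  have hs : Real.sin (hexAngle θ n) = Real.sin (hexAngle φ n) := by
    rw [← unitVec_one_apply, h, unitVec_one_apply]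
  obtain ⟨k, rfl⟩ : ∃ k, i = k + n := ⟨i - n, by simp⟩
  rw [unitVec_hexAngle_add, unitVec_hexAngle_add]
  generalize hexAngle θ n = ψ at hc hs
  generalize hexAngle φ n = χ at hc hs
  apply plane_ext <;>
    simp only [unitVec_zero_apply, unitVec_one_apply, hexAngle, Real.cos_add, Real.sin_add, hc, hs]

/-- The point depends only on `θ`, `v 0` and `ε`, so two hexagons with the same direction and the
same vertex `0` share it as an interior point. -/
theorem IsHexagonWith.interior_point {θ : ℝ} {l : Fin 6 → ℝ} {v : Fin 6 → Plane}
    (h : IsHexagonWith θ l v) {ε : ℝ} (h0 : 0 < ε) (h1 : ε < l 1) (i : Fin 6) :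
    outerNormal (hexAngle θ i) (oblique θ (v 0) 0 ε - v i) < 0 := by
  rw [h.outerNormal_oblique]
  refine mul_neg_of_pos_of_neg (by positivity) ?_
  have p0 := h.1 0
  have p2 := h.1 2
  have p5 := h.1 5
  fin_cases i <;> simp <;> linarith

/-- A subfamily that already covers almost everything leaves no room for another hexagon, whose
interior is nonempty. -/
theorem IsHexagonTiling.eq_univ_of_ae_cover {ι : Type*} {θ : ι → ℝ} {l : ι → Fin 6 → ℝ}
    {v : ι → Fin 6 → Plane} (h : IsHexagonTiling θ l v) {J : Set ι}
    (hJ : ∀ᵐ x : Plane, ∃ q ∈ J, x ∈ hexagonRegion (v q)) (q : ι) : q ∈ J := by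
  by_contra hq
  have := h.countable
  have hd : ∀ᵐ x : Plane, ∀ q' ∈ J, x ∉ hexagonRegion (v q) ∩ hexagonRegion (v q') := by
    refine ae_all_iff.2 fun q' => ?_
    by_cases hq' : q' ∈ J
    · have hne : q ≠ q' := by rintro rfl; exact hq hq'
      have h2 : ∀ᵐ x : Plane, x ∉ hexagonRegion (v q) ∩ hexagonRegion (v q') := by
        rw [ae_iff]; simp only [not_not]; exact h.aedisjoint hne
      filter_upwards [h2] with x hx _ using hx
    · exact Filter.Eventually.of_forall fun x hx => absurd hx hq'
  have hz : ∀ᵐ x : Plane, x ∉ hexagonRegion (v q) := by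
    filter_upwards [hd, hJ] with x hx ⟨q', hq', hxq'⟩ hxq using hx q' hq' ⟨hxq, hxq'⟩
  have hl := (h.hexagon q).1 1
  obtain ⟨y, hy, hy'⟩ := (Measure.dense_of_ae hz).inter_nhds_nonempty
    (x := oblique (θ q) (v q 0) 0 (l q 1 / 2))
    (t := hexagonRegion (v q)) (by
      have : ∀ᶠ y in nhds (oblique (θ q) (v q 0) 0 (l q 1 / 2)),
          ∀ i, outerNormal (hexAngle (θ q) i) (y - v q i) < 0 := by
        refine Filter.eventually_all.2 fun i => ?_
        have hc : Continuous fun x => outerNormal (hexAngle (θ q) i) (x - v q i) := by fun_prop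
        exact hc.continuousAt.eventually_lt continuousAt_const
          ((h.hexagon q).interior_point (half_pos hl) (half_lt_self hl) i)
      filter_upwards [this] with y hy
      exact ((h.hexagon q).mem_hexagonRegion_iff y).2 fun i => (hy i).le)
  exact hy hy'

section periodic

variable {T : PeriodicTiling 2} {θ : Fin 2 → ℝ} {l : Fin 2 → Fin 6 → ℝ} {v : Fin 2 → Fin 6 → Plane}

/-- The generators of `T` are, up to negligible sets, the hexagons with vertices `v k`. -/
def PeriodicTiling.IsHexagonal (T : PeriodicTiling 2) (θ : Fin 2 → ℝ) (l : Fin 2 → Fin 6 → ℝ)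
    (v : Fin 2 → Fin 6 → Plane) : Prop :=
  ∀ k, IsHexagonWith (θ k) (l k) (v k) ∧ T.tile k =ᵐ[volume] hexagonRegion (v k)

theorem PeriodicTiling.countable_lattice {N : ℕ} (T : PeriodicTiling N) : Countable T.lattice := by
  have := T.discrete
  have := T.isZLattice
  infer_instance

theorem PeriodicTiling.locallyFinite_vadd {N : ℕ} (T : PeriodicTiling N) {R : Fin N → Set Plane}
    (hR : ∀ k, Bornology.IsBounded (R k)) :
    LocallyFinite fun q : Fin N × T.lattice => (q.2 : Plane) +ᵥ R q.1 := by
  have := T.discrete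
  intro x
  refine ⟨Metric.ball x 1, Metric.ball_mem_nhds x one_pos, ?_⟩
  obtain ⟨r, hr⟩ := (Bornology.isBounded_iUnion.2 hR).subset_ball 0
  have hclosed : IsClosed (T.lattice : Set Plane) :=
    AddSubgroup.isClosed_of_discrete (H := T.lattice.toAddSubgroup)
  have hfin : ((Metric.ball 0 (‖x‖ + 1 + r)) ∩ (T.lattice : Set Plane)).Finite :=
    Metric.finite_isBounded_inter_isClosed ⟨this⟩ Metric.isBounded_ball hclosed
  have hfin' : {g : T.lattice | (g : Plane) ∈ Metric.ball 0 (‖x‖ + 1 + r)}.Finite := by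
    refine Finite.of_finite_image (f := fun g : T.lattice => (g : Plane)) (hfin.subset ?_)
      Subtype.val_injective.injOn
    rintro _ ⟨g, hg, rfl⟩
    exact ⟨hg, g.2⟩
  refine ((finite_univ (α := Fin N)).prod hfin').subset ?_
  rintro ⟨k, g⟩ ⟨y, hy1, hy2⟩
  refine ⟨trivial, ?_⟩
  obtain ⟨z, hz, rfl⟩ := hy1
  have h1 : ‖z‖ < r := by simpa using hr (mem_iUnion.2 ⟨k, hz⟩)
  have h2 : ‖(g : Plane) + z - x‖ < 1 := by simpa [dist_eq_norm] using hy2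
  have h3 : (g : Plane) = ((g : Plane) + z - x) + x - z := by abel
  simp only [mem_ofPred_eq, mem_ball_zero_iff]
  rw [h3]
  calc ‖((g : Plane) + z - x) + x - z‖ ≤ ‖(g : Plane) + z - x‖ + ‖x‖ + ‖z‖ :=
        (norm_sub_le _ _).trans (add_le_add_left (norm_add_le _ _) _)
    _ < ‖x‖ + 1 + r := by linarith

theorem vadd_ae_eq {S S' : Set Plane} (h : S =ᵐ[volume] S') (g : Plane) :
    (g +ᵥ S : Set Plane) =ᵐ[volume] (g +ᵥ S' : Set Plane) := by
  have h2 := (measurePreserving_add_left (volume : Measure Plane)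
    (-g)).quasiMeasurePreserving.ae h.mem_iff
  refine Filter.eventuallyEq_set.2 ?_
  filter_upwards [h2] with x hx
  rw [mem_vadd_set_iff_neg_vadd_mem, mem_vadd_set_iff_neg_vadd_mem]
  exact hx

theorem PeriodicTiling.IsHexagonal.isHexagonTiling (h : T.IsHexagonal θ l v) :
    IsHexagonTiling (ι := Fin 2 × T.lattice) (fun q => θ q.1) (fun q => l q.1)
      (fun q i => (q.2 : Plane) + v q.1 i) where
  countable := by
    have := T.countable_lattice
    infer_instance
  hexagon q := (h q.1).1.vadd _
  aedisjoint := by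
    intro q q' hq
    simp only [hexagonRegion_vadd]
    exact (T.aedisjoint hq).congr (vadd_ae_eq (h _).2 _).symm (vadd_ae_eq (h _).2 _).symm
  ae_cover := by
    have := T.countable_lattice
    have h2 : ∀ᵐ x : Plane, ∀ q : Fin 2 × T.lattice, x ∈ (q.2 : Plane) +ᵥ T.tile q.1 ↔
        x ∈ (q.2 : Plane) +ᵥ hexagonRegion (v q.1) :=
      ae_all_iff.2 fun q => (vadd_ae_eq (h q.1).2 _).mem_iff
    filter_upwards [h2, T.ae_cover] with x hx ⟨k, g, hxk⟩
    refine ⟨(k, g), ?_⟩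
    rw [hexagonRegion_vadd]
    exact (hx (k, g)).1 hxk
  locallyFinite := by
    simp only [hexagonRegion_vadd]
    exact T.locallyFinite_vadd fun k => (isCompact_hexagonRegion (v k)).isBounded

theorem PeriodicTiling.IsHexagonal.shift (h : T.IsHexagonal θ l v) (j : Fin 2 → Fin 6) :
    T.IsHexagonal (fun k => hexAngle (θ k) (j k)) (fun k i => l k (i + j k))
      (fun k i => v k (i + j k)) :=
  fun k => ⟨(h k).1.shift _, by rw [hexagonRegion_shift]; exact (h k).2⟩

end periodic

/-- The `i`-th edge of the hexagon `v` is glued, modulo the lattice `L`, to the `(i+3)`-th edge of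
the hexagon `w`. -/
def EdgeGlued (L : Submodule ℤ Plane) (l m : Fin 6 → ℝ) (v w : Fin 6 → Plane) (i : Fin 6) : Prop :=
  -- Opposite edges are traversed in opposite directions, so the start of one matches the end of the
  -- other.
  l i = m (i + 3) ∧ v i - w (i + 4) ∈ L ∧ v (i + 1) - w (i + 3) ∈ L

theorem edgeGlued_shift {L : Submodule ℤ Plane} {l m : Fin 6 → ℝ} {v w : Fin 6 → Plane}
    {i j : Fin 6} : EdgeGlued L (fun i => l (i + j)) (fun i => m (i + j)) (fun i => v (i + j))
      (fun i => w (i + j)) i ↔ EdgeGlued L l m v w (i + j) := by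
  simp only [EdgeGlued, add_right_comm _ j]

theorem EdgeGlued.symm {L : Submodule ℤ Plane} {l m : Fin 6 → ℝ} {v w : Fin 6 → Plane}
    {i : Fin 6} (h : EdgeGlued L l m v w i) : EdgeGlued L m l w v (i + 3) := by
  obtain ⟨h1, h2, h3⟩ := h
  have e3 : i + 3 + 3 = i := by omega
  have e4 : i + 3 + 4 = i + 1 := by omega
  have e5 : i + 3 + 1 = i + 4 := by omega
  refine ⟨by rw [e3, h1], ?_, ?_⟩
  · rw [e4, ← neg_sub]; exact neg_mem h3
  · rw [e3, e5, ← neg_sub]; exact neg_mem h2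

section gluing

variable {T : PeriodicTiling 2} {θ : Fin 2 → ℝ} {l : Fin 2 → Fin 6 → ℝ} {v : Fin 2 → Fin 6 → Plane}

theorem PeriodicTiling.IsHexagonal.exists_neighbor (h : T.IsHexagonal θ l v) (i : Fin 6) :
    ∃ k j, unitVec (hexAngle (θ k) j) = -unitVec (hexAngle (θ 0) i) ∧ l 0 i = l k j ∧
      v 0 i - v k (j + 1) ∈ T.lattice ∧ v 0 (i + 1) - v k j ∈ T.lattice := by
  obtain ⟨⟨k, g⟩, -, j, h1, h2, h3, h4⟩ := h.isHexagonTiling.edge_to_edge (0, 0) i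
  refine ⟨k, j, h1, h2.symm, ?_, ?_⟩
  · have : v 0 i - v k (j + 1) = g := by
      have e : (g : Plane) + v k (j + 1) = v 0 i := by simpa using h4
      rw [← e]; abel
    rw [this]; exact g.2
  · have : v 0 (i + 1) - v k j = g := by
      have e : (g : Plane) + v k j = v 0 (i + 1) := by simpa using h3
      rw [← e]; abel
    rw [this]; exact g.2

/-- With common edge directions, `i + 3` is the only index whose direction is opposite to that of
`i`. -/
theorem edgeGlued_of_neighbor {L : Submodule ℤ Plane} {φ : ℝ} {l m : Fin 6 → ℝ}
    {v w : Fin 6 → Plane} {i j : Fin 6}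
    (hu : unitVec (hexAngle φ j) = -unitVec (hexAngle φ i)) (hl : l i = m j)
    (h1 : v i - w (j + 1) ∈ L) (h2 : v (i + 1) - w j ∈ L) : EdgeGlued L l m v w i := by
  rw [← unitVec_hexAngle_opp] at hu
  have hj := unitVec_hexAngle_inj hu
  subst hj
  have e : i + 3 + 1 = i + 4 := by omega
  rw [e] at h1
  exact ⟨hl, h1, h2⟩

/-- Either all edges of the first hexagon are glued to edges of the same hexagon, or the second
hexagon can be relabelled so that both have the same edge directions. -/
theorem PeriodicTiling.IsHexagonal.exists_aligned (h : T.IsHexagonal θ l v) :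
    (∀ i, EdgeGlued T.lattice (l 0) (l 0) (v 0) (v 0) i) ∨
    ∃ m w, T.IsHexagonal (fun _ => θ 0) ![l 0, m] ![v 0, w] := by
  by_cases hself : ∀ i, EdgeGlued T.lattice (l 0) (l 0) (v 0) (v 0) i
  · exact Or.inl hself
  right
  push Not at hself
  obtain ⟨i, hi⟩ := hself
  obtain ⟨k, j, hu, hl, h1, h2⟩ := h.exists_neighbor i
  rcases Fin.exists_fin_two.1 ⟨k, rfl⟩ with rfl | rfl
  · exact absurd (edgeGlued_of_neighbor hu hl h1 h2) hi
  -- This shift gives the neighbouring edge `j` of the second hexagon the index `i + 3`. Agreement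
  -- of one direction then forces agreement of all.
  · set s : Fin 6 := j - (i + 3) with hs
    refine ⟨fun n => l 1 (n + s), fun n => v 1 (n + s), fun k => ?_⟩
    rcases Fin.exists_fin_two.1 ⟨k, rfl⟩ with rfl | rfl
    · exact h 0
    · have hw := (h 1).1.shift s
      have hdir : ∀ n, unitVec (hexAngle (hexAngle (θ 1) s) n) = unitVec (hexAngle (θ 0) n) := by
        refine unitVec_hexAngle_congr (n := i + 3) ?_
        rw [← unitVec_hexAngle_add, unitVec_hexAngle_opp, ← hu, hs, add_sub_cancel]
      refine ⟨⟨hw.1, fun n => ?_⟩, ?_⟩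
      · refine (hw.2 n).trans ?_
        rw [hdir]; rfl
      · show T.tile 1 =ᵐ[volume] hexagonRegion fun n => v 1 (n + s)
        rw [hexagonRegion_shift]; exact (h 1).2

/-- In an aligned tiling every edge of the first hexagon is glued to the opposite edge of one of the
two hexagons. -/
theorem PeriodicTiling.IsHexagonal.edgeGlued_or {φ : ℝ} (h : T.IsHexagonal (fun _ => φ) l v)
    (i : Fin 6) : EdgeGlued T.lattice (l 0) (l 0) (v 0) (v 0) i ∨
      EdgeGlued T.lattice (l 0) (l 1) (v 0) (v 1) i := by
  obtain ⟨k, j, hu, hl, h1, h2⟩ := h.exists_neighbor i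
  rcases Fin.exists_fin_two.1 ⟨k, rfl⟩ with rfl | rfl
  · exact Or.inl (edgeGlued_of_neighbor hu hl h1 h2)
  · exact Or.inr (edgeGlued_of_neighbor hu hl h1 h2)

/-- Corresponding vertices of the two hexagons of an aligned tiling are not equivalent modulo the
lattice. -/
theorem PeriodicTiling.IsHexagonal.vertex_sub_notMem {φ : ℝ} (h : T.IsHexagonal (fun _ => φ) l v) :
    v 0 0 - v 1 0 ∉ T.lattice := by
  intro hg
  set ε := min (l 0 1) (l 1 1) / 2 with hε
  have h0 := (h 0).1.1 1
  have h1 := (h 1).1.1 1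
  have hmin : 0 < min (l 0 1) (l 1 1) := lt_min h0 h1
  have e0 : ε < l 0 1 := (half_lt_self hmin).trans_le (min_le_left _ _)
  have e1 : ε < l 1 1 := (half_lt_self hmin).trans_le (min_le_right _ _)
  have hH := h.isHexagonTiling
  -- Otherwise a lattice translate of the second hexagon would have the same vertex `0` as the
  -- first, and both would contain one point in their interiors.
  refine hH.not_both_interior (q := (0, 0)) (q' := (1, ⟨_, hg⟩)) (by simp)
    (oblique φ (v 0 0) 0 ε) (fun i => ?_) fun i => ?_
  · have := (h 0).1.interior_point (half_pos hmin) e0 i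
    simpa using this
  · have := ((h 1).1.vadd (v 0 0 - v 1 0)).interior_point (half_pos hmin) e1 i
    simpa using this

/-- Two consecutive edges of the first hexagon cannot both be glued to that same hexagon, since
otherwise its translates would cover the plane. -/
theorem PeriodicTiling.IsHexagonal.not_edgeGlued_self_consecutive (h : T.IsHexagonal θ l v)
    (i : Fin 6) (h0 : EdgeGlued T.lattice (l 0) (l 0) (v 0) (v 0) i)
    (h1 : EdgeGlued T.lattice (l 0) (l 0) (v 0) (v 0) (i + 1)) : False := by
  wlog hi : i = 0 generalizing θ l v i
  · refine this (h.shift fun _ => i) 0 ?_ ?_ rfl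
    · rw [edgeGlued_shift, zero_add]; exact h0
    · rw [edgeGlued_shift, zero_add, add_comm]; exact h1
  subst hi
  have hv := (h 0).1
  have hsym := hv.eq_symHexagon h0.1.symm
  have pa := hv.1 0
  have pb := hv.1 1
  have pc := hv.1 2
  generalize l 0 0 = a at *
  generalize l 0 1 = b at *
  generalize l 0 2 = c at *
  set p := v 0 0 with hp
  have t0 : oblique (θ 0) 0 (-c) (b + c) ∈ T.lattice := by
    have e : oblique (θ 0) 0 (-c) (b + c) = -(v 0 0 - v 0 4) := by
      rw [hsym]; simp only [symHexagon, oblique, Matrix.cons_val]; module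
    rw [e]
    exact neg_mem h0.2.1
  have hτ : oblique (θ 0) 0 (a + c) (-c) ∈ T.lattice := by
    have e : oblique (θ 0) 0 (a + c) (-c) = v 0 1 - v 0 5 := by
      rw [hsym]; simp only [symHexagon, oblique, Matrix.cons_val]; module
    rw [e]
    exact h1.2.1
  -- The standard tiling with `a₁ = a₂ = a` consists of translates of the first hexagon alone: its
  -- second hexagon is the translate by `(a + c, -c)`, and twice this vector is the second lattice
  -- generator.
  have hsub : hexLattice (θ 0) (a + a) b c ≤ T.lattice := by
    refine Submodule.span_le.2 ?_
    rintro _ ⟨k, rfl⟩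
    rcases Fin.exists_fin_two.1 ⟨k, rfl⟩ with rfl | rfl
    · exact t0
    · have e : hexVector (θ 0) (a + a) b c 1 =
          oblique (θ 0) 0 (a + c) (-c) + oblique (θ 0) 0 (a + c) (-c) := by
        simp only [hexVector, oblique, Matrix.cons_val]; module
      rw [e]
      exact add_mem hτ hτ
  have hcov := ae_cover_hexPair pa pa pb pc (θ 0) p
  have := h.isHexagonTiling.eq_univ_of_ae_cover (J := {q | q.1 = 0}) (by
    filter_upwards [hcov] with x ⟨k, g, hx⟩
    rcases Fin.exists_fin_two.1 ⟨k, rfl⟩ with rfl | rfl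
    · refine ⟨(0, ⟨g, hsub g.2⟩), rfl, ?_⟩
      rw [hexagonRegion_vadd, hsym]
      exact hx
    · refine ⟨(0, ⟨g + oblique (θ 0) 0 (a + c) (-c), add_mem (hsub g.2) hτ⟩), rfl, ?_⟩
      rw [hexagonRegion_vadd]
      simp only [hsym]
      rw [hexagonRegion_symHexagon_vadd]
      have hx' : x ∈ (g : Plane) +ᵥ
          hexagonRegion (symHexagon (θ 0) (oblique (θ 0) p (a + c) (-c)) a b c) := hx
      rw [hexagonRegion_symHexagon_vadd] at hx'
      convert hx' using 3
      simp only [oblique]; module) (1, 0)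
  exact absurd this (by simp)

end gluing

/-! ### Reduction to standard tilings. -/

/-- Up to negligible sets and up to the choice of the translates of the generators, `T` is the
standard tiling by centrally symmetric hexagons with side lengths `a₁, b, c` and `a₂, b, c`. -/
structure PeriodicTiling.IsStandard (T : PeriodicTiling 2) (θ : ℝ) (p : Plane) (a₁ a₂ b c : ℝ) :
    Prop where
  pos₁ : 0 < a₁
  pos₂ : 0 < a₂
  pos_b : 0 < b
  pos_c : 0 < c
  lattice_eq : T.lattice = hexLattice θ (a₁ + a₂) b c
  tile_zero : T.tile 0 =ᵐ[volume] hexagonRegion (hexPair θ p a₁ a₂ b c 0)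
  tile_one : ∃ g ∈ T.lattice, T.tile 1 =ᵐ[volume] g +ᵥ hexagonRegion (hexPair θ p a₁ a₂ b c 1)

/-- The self-gluing makes the first hexagon centrally symmetric; the other three gluings and the
closing relations transfer `b, c` and the symmetry to the second. The gluing vectors generate the
standard lattice. -/
theorem PeriodicTiling.IsHexagonal.isStandard {T : PeriodicTiling 2} {φ : ℝ}
    {l : Fin 2 → Fin 6 → ℝ} {v : Fin 2 → Fin 6 → Plane} (h : T.IsHexagonal (fun _ => φ) l v)
    (h0 : EdgeGlued T.lattice (l 0) (l 0) (v 0) (v 0) 0)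
    (h1 : EdgeGlued T.lattice (l 0) (l 1) (v 0) (v 1) 1)
    (h2 : EdgeGlued T.lattice (l 0) (l 1) (v 0) (v 1) 2)
    (h4 : EdgeGlued T.lattice (l 0) (l 1) (v 0) (v 1) 4) :
    T.IsStandard φ (v 0 0) (l 0 0) (l 1 0) (l 0 1) (l 0 2) := by
  have hv := (h 0).1
  have hw := (h 1).1
  have hsv := hv.eq_symHexagon h0.1.symm
  obtain ⟨-, -, -, -, -, -, e1, e2⟩ := hv.vertex_eq
  obtain ⟨-, -, -, -, -, -, f1, f2⟩ := hw.vertex_eq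
  have m4 : l 0 1 = l 1 4 := h1.1
  have m1 : l 0 4 = l 1 1 := h4.1
  have m5 : l 0 2 = l 1 5 := h2.1
  have l3 : l 0 0 = l 0 3 := h0.1
  have hm1 : l 1 1 = l 0 1 := by linarith
  have hm2 : l 1 2 = l 0 2 := by linarith
  have hsw := hw.eq_symHexagon (by linarith)
  rw [hm1, hm2] at hsw
  have pa := hv.1 0
  have pa' := hw.1 0
  have pb := hv.1 1
  have pc := hv.1 2
  have t0 : v 0 0 - v 0 4 ∈ T.lattice := h0.2.1
  have g1 : v 0 2 - v 1 4 ∈ T.lattice := h1.2.2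
  have g1' : v 0 1 - v 1 5 ∈ T.lattice := h1.2.1
  have g4 : v 0 4 - v 1 2 ∈ T.lattice := h4.2.1
  have hH := h.isHexagonTiling
  have hone : T.tile 1 =ᵐ[volume] hexagonRegion (v 1) := (h 1).2
  have hzero : T.tile 0 =ᵐ[volume] hexagonRegion (v 0) := (h 0).2
  generalize l 0 0 = a₁ at *
  generalize l 1 0 = a₂ at *
  generalize l 0 1 = b at *
  generalize l 0 2 = c at *
  set p := v 0 0 with hp
  set q := v 1 0 with hq
  have hsub : hexLattice φ (a₁ + a₂) b c ≤ T.lattice := by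
    refine Submodule.span_le.2 ?_
    rintro _ ⟨k, rfl⟩
    rcases Fin.exists_fin_two.1 ⟨k, rfl⟩ with rfl | rfl
    · have e : hexVector φ (a₁ + a₂) b c 0 = -(v 0 0 - v 0 4) := by
        rw [hsv]; simp only [hexVector, symHexagon, oblique, Matrix.cons_val]; module
      rw [e]; exact neg_mem t0
    · have e : hexVector φ (a₁ + a₂) b c 1 = (v 0 2 - v 1 4) - (v 0 4 - v 1 2) := by
        rw [hsv, hsw]; simp only [hexVector, symHexagon, oblique, Matrix.cons_val]; module
      rw [e]; exact sub_mem g1 g4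
  have hshift : (v 0 1 - v 1 5) + q = oblique φ p (a₁ + c) (-c) := by
    rw [hsv, hsw]; simp only [symHexagon, oblique, Matrix.cons_val]; module
  have hregion : hexagonRegion (hexPair φ p a₁ a₂ b c 1) =
      (v 0 1 - v 1 5) +ᵥ hexagonRegion (v 1) := by
    have : hexPair φ p a₁ a₂ b c 1 = symHexagon φ (oblique φ p (a₁ + c) (-c)) a₂ b c := rfl
    rw [this, ← hshift, ← hexagonRegion_symHexagon_vadd, ← hsw]
  refine ⟨pa, pa', pb, pc, le_antisymm (fun g hg => ?_) hsub, ?_, ?_⟩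
  · have hcov := ae_cover_hexPair pa pa' pb pc φ p
    -- The standard tiling already covers the plane using only translates of the first hexagon by
    -- `hexLattice`, so no further translate of it can occur and the lattice is no larger.
    have := hH.eq_univ_of_ae_cover (J := {r | r.1 = 0 → (r.2 : Plane) ∈ hexLattice φ (a₁ + a₂) b c})
      (by
        filter_upwards [hcov] with x ⟨k, g, hx⟩
        rcases Fin.exists_fin_two.1 ⟨k, rfl⟩ with rfl | rfl
        · refine ⟨(0, ⟨g, hsub g.2⟩), fun _ => g.2, ?_⟩
          rw [hexagonRegion_vadd, hsv]
          exact hx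
        · refine ⟨(1, ⟨g + (v 0 1 - v 1 5), add_mem (hsub g.2) g1'⟩), by simp, ?_⟩
          rw [hexagonRegion_vadd]
          rw [hregion, vadd_vadd] at hx
          exact hx) (0, ⟨g, hg⟩)
    exact this rfl
  · rw [hsv] at hzero; exact hzero
  · refine ⟨-(v 0 1 - v 1 5), neg_mem g1', ?_⟩
    rw [hregion, vadd_vadd, neg_add_cancel, zero_vadd]
    exact hone

/-- A tiling by two hexagons is, up to a relabelling of the edges, a standard one. -/
theorem PeriodicTiling.IsType66.exists_isStandard {T : PeriodicTiling 2} (h : T.IsType66) :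
    ∃ θ p a₁ a₂ b c, T.IsStandard θ p a₁ a₂ b c := by
  choose v hv hT using h
  choose θ l hl using hv
  have hH : T.IsHexagonal θ l v := fun k => ⟨hl k, hT k⟩
  rcases hH.exists_aligned with hself | ⟨m, w, hal⟩
  · exact (hH.not_edgeGlued_self_consecutive 0 (hself 0) (hself _)).elim
  generalize ![l 0, m] = l' at hal
  generalize ![v 0, w] = v' at hal
  generalize θ 0 = φ at hal
  clear hH hl hT v θ l m w
  by_cases hex : ∃ d, EdgeGlued T.lattice (l' 0) (l' 0) (v' 0) (v' 0) d
  · obtain ⟨d, hd⟩ := hex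
    have hcross (i : Fin 6) (hi : ¬ EdgeGlued T.lattice (l' 0) (l' 0) (v' 0) (v' 0) (i + d)) :
        EdgeGlued T.lattice (fun i => l' 0 (i + d)) (fun i => l' 1 (i + d)) (fun i => v' 0 (i + d))
          (fun i => v' 1 (i + d)) i :=
      edgeGlued_shift.2 ((hal.edgeGlued_or (i + d)).resolve_left hi)
    -- After relabelling, edges `0` and `3` are self-glued. Edges `1`, `2` and `4` are each adjacent
    -- to one of them, so they are glued to the second hexagon.
    refine ⟨_, _, _, _, _, _, (hal.shift fun _ => d).isStandard
      (by rw [edgeGlued_shift, zero_add]; exact hd) (hcross 1 fun hs => ?_)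
      (hcross 2 fun hs => ?_) (hcross 4 fun hs => ?_)⟩
    · exact hal.not_edgeGlued_self_consecutive d hd (by rwa [add_comm])
    · refine hal.not_edgeGlued_self_consecutive (2 + d) hs ?_
      have := hd.symm
      have e : 2 + d + 1 = d + 3 := by omega
      rwa [e]
    · refine hal.not_edgeGlued_self_consecutive (d + 3) hd.symm ?_
      have e : d + 3 + 1 = 4 + d := by omega
      rwa [e]
  · push Not at hex
    exfalso
    -- If all gluings are crossed, then modulo the lattice `v' 0 0 ≡ v' 1 4 ≡ v' 0 2 ≡ v' 1 0`,
    -- which identifies corresponding vertices.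
    have c (i) := (hal.edgeGlued_or i).resolve_left (hex i)
    have c0 : v' 0 0 - v' 1 4 ∈ T.lattice := (c 0).2.1
    have c1 : v' 0 2 - v' 1 4 ∈ T.lattice := (c 1).2.2
    have c2 : v' 0 2 - v' 1 0 ∈ T.lattice := (c 2).2.1
    refine hal.vertex_sub_notMem ?_
    have := add_mem (sub_mem c0 c1) c2
    convert this using 1; abel

theorem hexTiling_isStandard {a₁ a₂ b c : ℝ} (h₁ : 0 < a₁) (h₂ : 0 < a₂) (hb : 0 < b) (hc : 0 < c)
    (θ : ℝ) (p : Plane) : (hexTiling h₁ h₂ hb hc θ p).IsStandard θ p a₁ a₂ b c :=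
  ⟨h₁, h₂, hb, hc, rfl, Filter.EventuallyEq.rfl, 0, zero_mem _, by rw [zero_vadd]; rfl⟩

/-! ### Areas, perimeter and minimization over the side lengths. -/

section standard

variable {T : PeriodicTiling 2} {θ a₁ a₂ b c : ℝ} {p : Plane}

theorem PeriodicTiling.IsStandard.volume_tile (h : T.IsStandard θ p a₁ a₂ b c) (k : Fin 2) :
    volume (T.tile k) = ENNReal.ofReal (√3 / 2 * (![a₁, a₂] k * (b + c) + b * c)) := by
  rcases Fin.exists_fin_two.1 ⟨k, rfl⟩ with rfl | rfl
  · rw [measure_congr h.tile_zero]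
    exact volume_symHexagon h.pos₁ h.pos_b h.pos_c
  · obtain ⟨g, -, hg⟩ := h.tile_one
    rw [measure_congr hg, measure_vadd]
    exact volume_symHexagon h.pos₂ h.pos_b h.pos_c

theorem PeriodicTiling.IsStandard.area_eq (h : T.IsStandard θ p a₁ a₂ b c) (k : Fin 2) :
    T.area k = √3 / 2 * (![a₁, a₂] k * (b + c) + b * c) := by
  have h1 := h.pos₁
  have h2 := h.pos₂
  have h3 := h.pos_b
  have h4 := h.pos_c
  rw [PeriodicTiling.area, h.volume_tile, ENNReal.toReal_ofReal]
  rcases Fin.exists_fin_two.1 ⟨k, rfl⟩ with rfl | rfl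
  · simp only [Matrix.cons_val_zero]; positivity
  · simp only [Matrix.cons_val_one, Matrix.cons_val_zero]; positivity

theorem PeriodicTiling.IsStandard.perimeter_eq (h : T.IsStandard θ p a₁ a₂ b c) :
    T.perimeter = ENNReal.ofReal (a₁ + a₂ + 2 * b + 2 * c) := by
  have h1 := h.pos₁
  have h2 := h.pos₂
  have h3 := h.pos_b
  have h4 := h.pos_c
  obtain ⟨g, -, hg⟩ := h.tile_one
  have e0 : caccioppoliPerimeter (T.tile 0) = ENNReal.ofReal (2 * (a₁ + b + c)) := by
    rw [caccioppoliPerimeter_congr h.tile_zero]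
    exact caccioppoliPerimeter_symHexagon h1 h3 h4
  have e1 : caccioppoliPerimeter (T.tile 1) = ENNReal.ofReal (2 * (a₂ + b + c)) := by
    rw [caccioppoliPerimeter_congr hg]
    have : hexPair θ p a₁ a₂ b c 1 = symHexagon θ (oblique θ p (a₁ + c) (-c)) a₂ b c := rfl
    rw [this, hexagonRegion_symHexagon_vadd]
    exact caccioppoliPerimeter_symHexagon h2 h3 h4
  have half : (1 / 2 : ℝ≥0∞) = ENNReal.ofReal (1 / 2) := by
    rw [ENNReal.ofReal_div_of_pos two_pos]; simp
  rw [PeriodicTiling.perimeter, Fin.sum_univ_two, e0, e1, half,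
    ← ENNReal.ofReal_add (by positivity) (by positivity), ← ENNReal.ofReal_mul (by positivity)]
  congr 1; ring

end standard

/-- If the side lengths `a₁, a₂, b, c` minimize the perimeter among all those with the same areas,
then `b = c` and `a₁ + a₂ = 2 * b`. -/
theorem eq_of_forall_perimeter_le {a₁ a₂ b c : ℝ} (h₁ : 0 < a₁) (h₂ : 0 < a₂) (hb : 0 < b)
    (hc : 0 < c) (hmin : ∀ a₁' a₂' b' c', 0 < a₁' → 0 < a₂' → 0 < b' → 0 < c' →
      a₁' * (b' + c') + b' * c' = a₁ * (b + c) + b * c →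
      a₂' * (b' + c') + b' * c' = a₂ * (b + c) + b * c →
      a₁ + a₂ + 2 * b + 2 * c ≤ a₁' + a₂' + 2 * b' + 2 * c') : b = c ∧ a₁ + a₂ = 2 * b := by
  have hs : 0 < b + c := add_pos hb hc
  -- Given `b', c'`, the area constraints determine `a₁', a₂'`, which are positive by `p₁, p₂`. The
  -- perimeter inequality is then multiplied by `b' + c'`.
  have key (b' c' : ℝ) (hb' : 0 < b') (hc' : 0 < c')
      (p₁ : b' * c' < a₁ * (b + c) + b * c) (p₂ : b' * c' < a₂ * (b + c) + b * c) :
      (a₁ + a₂ + 2 * b + 2 * c) * (b' + c') ≤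
        (a₁ + a₂) * (b + c) + 2 * (b * c) - 2 * (b' * c') + 2 * (b' + c') ^ 2 := by
    have hs' : 0 < b' + c' := add_pos hb' hc'
    have := hmin ((a₁ * (b + c) + b * c - b' * c') / (b' + c'))
      ((a₂ * (b + c) + b * c - b' * c') / (b' + c')) b' c' (div_pos (by linarith) hs')
      (div_pos (by linarith) hs') hb' hc' (by field_simp; ring) (by field_simp; ring)
    have := mul_le_mul_of_nonneg_right this hs'.le
    refine this.trans (le_of_eq ?_)
    field_simp
    ring
  have small {f : ℝ → ℝ} (hf : Continuous f) {z : ℝ} (hz : f 0 < z) :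
      ∀ᶠ t in nhdsWithin (0 : ℝ) (Ioi 0), f t < z :=
    nhdsWithin_le_nhds (hf.continuousAt.eventually_lt continuousAt_const hz)
  have q₁ := mul_pos h₁ hs
  have q₂ := mul_pos h₂ hs
  have hbc : b = c := by
    by_contra hne
    have hd : 0 < (c - b) ^ 2 := by have := sub_ne_zero.2 (Ne.symm hne); positivity
    have c1 := small (f := fun t => t * (1 - t) * (c - b) ^ 2) (by fun_prop)
      (z := a₁ * (b + c)) (by simpa using q₁)
    have c2 := small (f := fun t => t * (1 - t) * (c - b) ^ 2) (by fun_prop)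
      (z := a₂ * (b + c)) (by simpa using q₂)
    have c3 := small (f := fun t => t) (by fun_prop) (z := 1) one_pos
    obtain ⟨t, ⟨⟨h1, h2⟩, h3⟩, h0⟩ := (((c1.and c2).and c3).and self_mem_nhdsWithin).exists
    have ht : 0 < t := h0
    have hpos : 0 < t * (1 - t) * (c - b) ^ 2 := mul_pos (mul_pos ht (by linarith)) hd
    -- At fixed sum `b' + c'`, the inequality `key` says that the product `b'c'` cannot exceed `bc`;
    -- moving `b` and `c` towards each other increases it.
    have e : (b + t * (c - b)) * (c - t * (c - b)) = b * c + t * (1 - t) * (c - b) ^ 2 := by ring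
    have := key (b + t * (c - b)) (c - t * (c - b))
      (by nlinarith [mul_pos ht hc, mul_pos (sub_pos.2 h3) hb])
      (by nlinarith [mul_pos ht hb, mul_pos (sub_pos.2 h3) hc])
      (by rw [e]; linarith) (by rw [e]; linarith)
    rw [e] at this
    nlinarith
  subst hbc
  refine ⟨rfl, ?_⟩
  by_contra hne
  have hd : 0 < (a₁ + a₂ - 2 * b) ^ 2 := by have := sub_ne_zero.2 hne; positivity
  set D := a₁ + a₂ - 2 * b with hD
  have c1 := small (f := fun s => (b + s * D) * (b + s * D)) (by fun_prop)
    (z := a₁ * (b + b) + b * b) (by simpa using q₁)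
  have c2 := small (f := fun s => (b + s * D) * (b + s * D)) (by fun_prop)
    (z := a₂ * (b + b) + b * b) (by simpa using q₂)
  have c3 := small (f := fun s => -(b + s * D)) (by fun_prop) (z := 0) (by simpa using hb)
  -- For `b' = c' = b + sD` the inequality `key` becomes `s D² (1 - 3s) ≤ 0`, false for `0 < s <
  -- 1/3`.
  have c4 := small (f := fun s => s) (by fun_prop) (z := 1 / 3) (by norm_num)
  obtain ⟨s, ⟨⟨⟨h1, h2⟩, h3⟩, h4⟩, h0⟩ :=
    ((((c1.and c2).and c3).and c4).and self_mem_nhdsWithin).exists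
  have hs0 : 0 < s := h0
  have := key (b + s * D) (b + s * D) (by linarith) (by linarith) h1 h2
  have hA : a₁ + a₂ = D + 2 * b := by rw [hD]; ring
  rw [hA] at this
  have h5 : s * D ^ 2 * (1 - 3 * s) ≤ 0 := by nlinarith
  exact absurd h5 (not_le.2 (mul_pos (mul_pos hs0 hd) (by linarith)))

/-! ### Consequences of optimality. -/

section optimal

variable {T T' : PeriodicTiling 2} {θ θ' a₁ a₂ b c x x' : ℝ} {p p' : Plane}

theorem PeriodicTiling.IsStandard.eq_of_isoperimetric (h : T.IsStandard θ p a₁ a₂ b c)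
    (hiso : T.Isoperimetric) : b = c ∧ a₁ + a₂ = 2 * b := by
  refine eq_of_forall_perimeter_le h.pos₁ h.pos₂ h.pos_b h.pos_c
    fun a₁' a₂' b' c' p₁ p₂ p₃ p₄ e₁ e₂ => ?_
  have h' := hexTiling_isStandard p₁ p₂ p₃ p₄ θ p
  have := hiso (hexTiling p₁ p₂ p₃ p₄ θ p) fun k => by
    rw [h.volume_tile, h'.volume_tile]
    rcases Fin.exists_fin_two.1 ⟨k, rfl⟩ with rfl | rfl
    · simp only [Matrix.cons_val_zero, e₁]
    · simp only [Matrix.cons_val_one, Matrix.cons_val_zero, e₂]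
  rwa [h.perimeter_eq, h'.perimeter_eq, ENNReal.ofReal_le_ofReal_iff (by positivity)] at this

theorem isRegularHexagon_symHexagon (θ : ℝ) (p : Plane) (hx : 0 < x) :
    IsRegularHexagon (symHexagon θ p x x x) := by
  have h := isHexagonWith_symHexagon θ p hx hx hx
  have hd (i : Fin 6) : dist (symHexagon θ p x x x i) (symHexagon θ p x x x (i + 1)) = x := by
    rw [dist_comm, dist_eq_norm, h.2 i, norm_smul, norm_unitVec, mul_one, Real.norm_eq_abs,
      abs_of_pos (h.1 i)]
    fin_cases i <;> rfl
  exact ⟨⟨θ, _, h⟩, fun i j => by rw [hd, hd]⟩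

theorem shareEdge_symHexagon (θ : ℝ) (p : Plane) (hx : 0 < x) :
    ShareEdge (symHexagon θ p x x x) (symHexagon θ (oblique θ p (x + x) (-x)) x x x) := by
  have v1 : symHexagon θ p x x x 1 = oblique θ p x 0 := rfl
  have v2 : symHexagon θ p x x x (1 + 1) = oblique θ p x x := rfl
  have w4 : symHexagon θ (oblique θ p (x + x) (-x)) x x x 4 = oblique θ p x x := by
    have : symHexagon θ (oblique θ p (x + x) (-x)) x x x 4 =
      oblique θ (oblique θ p (x + x) (-x)) (-x) (x + x) := rfl
    rw [this, oblique_oblique]; congr 1 <;> ring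
  have w5 : symHexagon θ (oblique θ p (x + x) (-x)) x x x (4 + 1) = oblique θ p x 0 := by
    have : symHexagon θ (oblique θ p (x + x) (-x)) x x x (4 + 1) =
      oblique θ (oblique θ p (x + x) (-x)) (-x) x := rfl
    rw [this, oblique_oblique]; congr 1 <;> ring
  have hp : oblique θ p 0 0 = p := by simp [oblique]
  refine ⟨1, 4, ?_, ?_⟩
  · have hm (α β) := oblique_mem_symHexagon_iff (θ := θ) (p := p) hx hx hx 0 0 α β
    rw [hp] at hm
    rw [v1, v2]
    apply Subset.antisymm
    · rintro y ⟨hy1, hy2⟩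
      obtain ⟨α, β, rfl⟩ := exists_eq_oblique θ p y
      rw [hm] at hy1
      rw [oblique_mem_symHexagon_iff hx hx hx] at hy2
      obtain ⟨a1, a2, a3, a4, a5, a6⟩ := hy1
      obtain ⟨b1, b2, b3, b4, b5, b6⟩ := hy2
      have hα : α = x := by linarith
      have := oblique_convex_comb (convex_segment (𝕜 := ℝ) (oblique θ p x 0) (oblique θ p x x))
        (left_mem_segment ℝ _ _) (right_mem_segment ℝ _ _) (t := β / x)
        (div_nonneg (by linarith) hx.le) (by rw [div_le_one hx]; linarith)
      convert this using 2
      · rw [hα]; ring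
      · field_simp; ring
    · have hc : Convex ℝ (hexagonRegion (symHexagon θ p x x x) ∩
          hexagonRegion (symHexagon θ (oblique θ p (x + x) (-x)) x x x)) :=
        (convex_convexHull ℝ _).inter (convex_convexHull ℝ _)
      refine hc.segment_subset ?_ ?_
      · refine ⟨(hm _ _).2 ?_, (oblique_mem_symHexagon_iff hx hx hx _ _ _ _).2 ?_⟩ <;>
          refine ⟨?_, ?_, ?_, ?_, ?_, ?_⟩ <;> linarith
      · refine ⟨(hm _ _).2 ?_, (oblique_mem_symHexagon_iff hx hx hx _ _ _ _).2 ?_⟩ <;>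
          refine ⟨?_, ?_, ?_, ?_, ?_, ?_⟩ <;> linarith
  · rw [v1, v2, w4, w5, segment_symm]

/-- The lattice depends only on `a₁ + a₂ = x + x`, so it is also the lattice of the standard tiling
by two regular hexagons of side `x`; these need not be the generators of `T`. -/
theorem PeriodicTiling.IsStandard.exists_regular (h : T.IsStandard θ p a₁ a₂ x x)
    (hA : a₁ + a₂ = 2 * x) : ∃ v w : Fin 6 → Plane, IsRegularHexagon v ∧ IsRegularHexagon w ∧
      ShareEdge v w ∧
      IsAddFundamentalDomain T.lattice (hexagonRegion v ∪ hexagonRegion w) volume := by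
  have hx := h.pos_b
  refine ⟨_, _, isRegularHexagon_symHexagon θ p hx,
    isRegularHexagon_symHexagon θ (oblique θ p (x + x) (-x)) hx, shareEdge_symHexagon θ p hx, ?_⟩
  rw [h.lattice_eq, hA, two_mul]
  exact isAddFundamentalDomain_hexPair hx hx hx hx θ p

theorem PeriodicTiling.IsStandard.area_add (h : T.IsStandard θ p a₁ a₂ x x)
    (hA : a₁ + a₂ = 2 * x) : T.area 0 + T.area 1 = √3 / 2 * (6 * x ^ 2) := by
  rw [h.area_eq, h.area_eq]
  simp only [Matrix.cons_val_zero, Matrix.cons_val_one]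
  linear_combination (√3 / 2 * (2 * x)) * hA

/-- The ratio is `(2aₖx + x²) / (6x²)`, and `0 < aₖ < 2x`. -/
theorem PeriodicTiling.IsStandard.area_ratio (h : T.IsStandard θ p a₁ a₂ x x)
    (hA : a₁ + a₂ = 2 * x) (k : Fin 2) : 1 / 6 < T.area k / (T.area 0 + T.area 1) ∧
      T.area k / (T.area 0 + T.area 1) < 5 / 6 := by
  have h1 := h.pos₁
  have h2 := h.pos₂
  have hx := h.pos_b
  have hk : (0 : ℝ) < √3 / 2 := by positivity
  rw [h.area_add hA, h.area_eq, mul_div_mul_left _ _ hk.ne']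
  have hak : 0 < ![a₁, a₂] k ∧ ![a₁, a₂] k < 2 * x := by
    rcases Fin.exists_fin_two.1 ⟨k, rfl⟩ with rfl | rfl
    · exact ⟨h1, show a₁ < 2 * x by linarith⟩
    · exact ⟨h2, show a₂ < 2 * x by linarith⟩
  generalize ![a₁, a₂] k = a at hak
  obtain ⟨ha, ha'⟩ := hak
  have := mul_pos ha hx
  have := mul_pos (sub_pos.2 ha') hx
  rw [div_lt_div_iff₀ (by norm_num) (by positivity), div_lt_div_iff₀ (by positivity) (by norm_num)]
  constructor <;> nlinarith

theorem PeriodicTiling.IsStandard.perimeter_optimal (h : T.IsStandard θ p a₁ a₂ x x)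
    (hA : a₁ + a₂ = 2 * x) : T.perimeter = ENNReal.ofReal
      (2 * (3 : ℝ) ^ (1 / 4 : ℝ) * Real.sqrt (T.area 0 + T.area 1)) := by
  have hx := h.pos_b
  rw [h.perimeter_eq, h.area_add hA, hA]
  congr 1
  have h4 : (3 : ℝ) ^ (1 / 4 : ℝ) = √√3 := by
    rw [Real.sqrt_eq_rpow, Real.sqrt_eq_rpow, ← Real.rpow_mul (by norm_num)]; norm_num
  rw [h4, mul_assoc, ← Real.sqrt_mul (Real.sqrt_nonneg 3)]
  have h3 : √3 * √3 = 3 := Real.mul_self_sqrt (by norm_num)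
  have : √3 * (√3 / 2 * (6 * x ^ 2)) = (3 * x) ^ 2 := by linear_combination (3 * x ^ 2) * h3
  rw [this, Real.sqrt_sq (by positivity)]
  ring

end optimal

/-! ### Uniqueness up to isometries. -/

/-- The rigid motion with linear part `planeRotation ψ` that maps `p` to `p'`. -/
noncomputable def rigidMotion (ψ : ℝ) (p p' : Plane) : Plane ≃ᵃⁱ[ℝ] Plane :=
  (planeRotation ψ).toAffineIsometryEquiv.trans
    (AffineIsometryEquiv.constVAdd ℝ Plane (p' - planeRotation ψ p))

theorem rigidMotion_apply (ψ : ℝ) (p p' y : Plane) :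
    rigidMotion ψ p p' y = p' - planeRotation ψ p + planeRotation ψ y := rfl

theorem linearIsometryEquiv_rigidMotion (ψ : ℝ) (p p' y : Plane) :
    (rigidMotion ψ p p').linearIsometryEquiv y = planeRotation ψ y := by
  have := (rigidMotion ψ p p').map_vadd 0 y
  simp only [rigidMotion_apply, vadd_eq_add, map_zero, add_zero] at this
  rw [add_comm] at this
  exact (add_right_cancel this).symm

theorem rigidMotion_image_congr (ψ : ℝ) (p p' : Plane) {S S' : Set Plane} (h : S =ᵐ[volume] S') :
    (rigidMotion ψ p p' '' S : Set Plane) =ᵐ[volume] (rigidMotion ψ p p' '' S' : Set Plane) := by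
  have e (U : Set Plane) : rigidMotion ψ p p' '' U =
      (p' - planeRotation ψ p) +ᵥ ((planeRotation ψ).symm ⁻¹' U) := by
    rw [← LinearIsometryEquiv.image_eq_preimage_symm, ← image_vadd, image_image]; rfl
  rw [e, e]
  refine vadd_ae_eq ?_ _
  exact (planeRotation ψ).symm.measurePreserving.quasiMeasurePreserving.preimage_ae_eq h

theorem planeRotation_oblique (θ θ' α β : ℝ) :
    planeRotation (θ' - θ) (oblique θ 0 α β) = oblique θ' 0 α β := by
  have e (i : Fin 6) : hexAngle θ i + (θ' - θ) = hexAngle θ' i := by simp only [hexAngle]; ring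
  simp only [oblique, map_add, map_smul, map_zero, planeRotation_unitVec, e]

theorem rigidMotion_oblique (θ θ' α β : ℝ) (p p' : Plane) :
    rigidMotion (θ' - θ) p p' (oblique θ p α β) = oblique θ' p' α β := by
  have e (θ : ℝ) (p : Plane) : oblique θ p α β = p + oblique θ 0 α β := by
    simp only [oblique]; module
  rw [rigidMotion_apply, e θ p, map_add, planeRotation_oblique, e θ' p']; abel

theorem rigidMotion_image_hexagonRegion (θ θ' : ℝ) (p p' : Plane) (x y a b c : ℝ) :
    rigidMotion (θ' - θ) p p' '' hexagonRegion (symHexagon θ (oblique θ p x y) a b c) =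
      hexagonRegion (symHexagon θ' (oblique θ' p' x y) a b c) := by
  have h1 := AffineMap.image_convexHull
    (rigidMotion (θ' - θ) p p').toAffineEquiv.toAffineMap
    (range (symHexagon θ (oblique θ p x y) a b c))
  refine h1.trans ?_
  rw [hexagonRegion, ← range_comp]
  congr 2
  ext i : 1
  have h2 : ∀ α β, rigidMotion (θ' - θ) p p' (oblique θ (oblique θ p x y) α β) =
      oblique θ' (oblique θ' p' x y) α β := fun α β => by
    rw [oblique_oblique, oblique_oblique, rigidMotion_oblique]
  fin_cases i <;> exact h2 _ _

section congruence

variable {T T' : PeriodicTiling 2} {θ θ' a₁ a₂ b c : ℝ} {p p' : Plane}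

/-- Standard tilings with the same side lengths are congruent. -/
theorem PeriodicTiling.IsStandard.congruent (h : T.IsStandard θ p a₁ a₂ b c)
    (h' : T'.IsStandard θ' p' a₁ a₂ b c) : T.Congruent T' := by
  have hp (θ : ℝ) (p : Plane) : oblique θ p 0 0 = p := by simp [oblique]
  have hlat : ∀ y, y ∈ T.lattice ↔ planeRotation (θ' - θ) y ∈ T'.lattice := by
    intro y
    rw [h.lattice_eq, h'.lattice_eq, mem_hexLattice_iff, mem_hexLattice_iff]
    refine exists_congr fun m => exists_congr fun n => ?_
    rw [← planeRotation_oblique θ θ', (planeRotation (θ' - θ)).injective.eq_iff]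
  refine ⟨rigidMotion (θ' - θ) p p', fun y => ?_, fun k => ?_⟩
  · rw [linearIsometryEquiv_rigidMotion]; exact hlat y
  rcases Fin.exists_fin_two.1 ⟨k, rfl⟩ with rfl | rfl
  · refine ⟨0, zero_mem _, ?_⟩
    rw [zero_vadd]
    refine (rigidMotion_image_congr _ p p' h.tile_zero).trans ?_
    have := rigidMotion_image_hexagonRegion θ θ' p p' 0 0 a₁ b c
    rw [hp, hp] at this
    refine Filter.EventuallyEq.trans ?_ h'.tile_zero.symm
    exact Filter.EventuallyEq.of_eq this
  · obtain ⟨g, hg, e⟩ := h.tile_one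
    obtain ⟨g', hg', e'⟩ := h'.tile_one
    -- The second generators are the translates by `g` and `g'` of the standard hexagons, and the
    -- motion turns `g` into its rotated image.
    refine ⟨planeRotation (θ' - θ) g - g', sub_mem ((hlat g).1 hg) hg', ?_⟩
    refine (rigidMotion_image_congr _ p p' e).trans ?_
    have h1 := rigidMotion_image_hexagonRegion θ θ' p p' (a₁ + c) (-c) a₂ b c
    have h2 : rigidMotion (θ' - θ) p p' '' (g +ᵥ hexagonRegion (hexPair θ p a₁ a₂ b c 1)) =
        planeRotation (θ' - θ) g +ᵥ hexagonRegion (hexPair θ' p' a₁ a₂ b c 1) := by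
      have h3 : hexagonRegion (hexPair θ' p' a₁ a₂ b c 1) =
        rigidMotion (θ' - θ) p p' '' hexagonRegion (hexPair θ p a₁ a₂ b c 1) := h1.symm
      rw [h3, ← image_vadd, ← image_vadd, image_image, image_image]
      refine image_congr fun y _ => ?_
      simp only [rigidMotion_apply, vadd_eq_add, map_add]; abel
    rw [h2]
    have h4 := vadd_ae_eq e' (planeRotation (θ' - θ) g - g')
    rw [vadd_vadd, sub_add_cancel] at h4
    exact h4.symm

/-- The total area `3√3 x²` determines `x`, and then each area determines its `aₖ`. -/
theorem PeriodicTiling.IsStandard.eq_of_volume_eq {x x' a₁' a₂' : ℝ}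
    (h : T.IsStandard θ p a₁ a₂ x x) (hA : a₁ + a₂ = 2 * x)
    (h' : T'.IsStandard θ' p' a₁' a₂' x' x') (hA' : a₁' + a₂' = 2 * x')
    (hvol : ∀ k, volume (T'.tile k) = volume (T.tile k)) : x' = x ∧ a₁' = a₁ ∧ a₂' = a₂ := by
  have hk : (√3 / 2 : ℝ) ≠ 0 := by positivity
  have hx := h.pos_b
  have hx' := h'.pos_b
  have harea (k) : T'.area k = T.area k := by simp only [PeriodicTiling.area, hvol k]
  have hsum := h'.area_add hA'
  rw [harea, harea, h.area_add hA] at hsum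
  have hxx : x' = x := by
    have := mul_left_cancel₀ hk hsum
    have h2 : x' ^ 2 = x ^ 2 := by linarith
    exact (sq_eq_sq₀ hx'.le hx.le).1 h2
  subst hxx
  have h0 := harea 0
  have h1 := harea 1
  rw [h.area_eq, h'.area_eq] at h0 h1
  have h0' := mul_left_cancel₀ hk h0
  have h1' := mul_left_cancel₀ hk h1
  simp only [Matrix.cons_val_zero, Matrix.cons_val_one] at h0' h1'
  have h2x : x' + x' ≠ 0 := by positivity
  exact ⟨rfl, mul_right_cancel₀ h2x (by linarith), mul_right_cancel₀ h2x (by linarith)⟩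

end congruence

theorem theorem3p2 (T : PeriodicTiling 2) (hnd : T.Nondegenerate) (hiso : T.Isoperimetric)
    (h66 : T.IsType66) :
    (∃ v w : Fin 6 → Plane, IsRegularHexagon v ∧ IsRegularHexagon w ∧ ShareEdge v w ∧
      IsAddFundamentalDomain T.lattice (hexagonRegion v ∪ hexagonRegion w) volume) ∧
    (∀ k, 1 / 6 < T.area k / (T.area 0 + T.area 1) ∧
      T.area k / (T.area 0 + T.area 1) < 5 / 6) ∧
    T.perimeter = ENNReal.ofReal
      (2 * (3 : ℝ) ^ (1 / 4 : ℝ) * Real.sqrt (T.area 0 + T.area 1)) ∧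
    (∀ T' : PeriodicTiling 2, T'.Nondegenerate → T'.Isoperimetric → T'.IsType66 →
      (∀ k, volume (T'.tile k) = volume (T.tile k)) → T.Congruent T') := by
  obtain ⟨θ, p, a₁, a₂, x, c, h⟩ := h66.exists_isStandard
  obtain ⟨rfl, hA⟩ := h.eq_of_isoperimetric hiso
  refine ⟨h.exists_regular hA, h.area_ratio hA, h.perimeter_optimal hA,
    fun T' _ hiso' h66' hvol => ?_⟩
  obtain ⟨θ', p', a₁', a₂', x', c', h'⟩ := h66'.exists_isStandard
  obtain ⟨rfl, hA'⟩ := h'.eq_of_isoperimetric hiso'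
  obtain ⟨rfl, rfl, rfl⟩ := h.eq_of_volume_eq hA h' hA' hvol
  exact h.congruent h'
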